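/- Let $\mathbb O$ be either the unit disk $\mathbb D=\{|z|<1\}$ or the upper half plane $\mathbb U=\{\operatorname{Im} z>0\}$, with boundary $\partial\mathbb O=\mathbb T$, respectively $\partial\mathbb O=\mathbb R\cup\{\infty\}$, in the Riemann sphere. Put $\alpha_0=0$, respectively $\alpha_0=i$. For $a\in\mathbb O$ put $\varpi_a(z)=1-\bar a z$, respectively $\varpi_a(z)=z-\bar a$, and $$\zeta_a(z)=z_a\frac{z-a}{\varpi_a(z)},\qquad z_{\alpha_0}=1,\qquad z_a=-\frac{|a|}{a},\ \text{ respectively } z_a=\frac{|1+a^2|}{1+a^2},\quad a\ne\alpha_0 .$$ Let $D(t,z)=\frac{\zeta_{\alpha_0}(t)+\zeta_{\alpha_0}(z)}{\zeta_{\alpha_0}(t)-\zeta_{\alpha_0}(z)}$ and, for $t\in\partial\mathbb O$, $D_R(t,z)=\operatorname{Re}D(t,z)$. Let $m$ be the measure on $\partial\mathbb O$ given by normalized arc length on $\mathbb T$, respectively by $\frac{dt}{\pi(1+t^2)}$ on $\mathbb R$ (with no mass at $\infty$). Let $(\alpha_n)_{n\ge1}$ be a sequence in $\mathbb O$, with $\alpha_0$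 as above; an index $n$ on $\zeta,\varpi,z$ stands for $\alpha_n$. Let $\mu$ be a Borel probability measure on $\partial\mathbb O$, and let $\mu'=d\mu/dm$ be the density of its absolutely continuous part with respect to $m$. *Iterates.* Let $F(z)=\int D(t,z)\,d\mu(t)$ and $f_0=\frac1{\zeta_{\alpha_0}}\frac{F-1}{F+1}$ on $\mathbb O$. The $\alpha$-iterates of $\mu$ are the analytic functions on $\mathbb O$ given by $f_0$ and $$f_{k+1}=\frac1{\zeta_{k+1}}\,\frac{f_k-\gamma_k}{1-\overline{\gamma_k}f_k},\qquad \gamma_k=f_k(\alpha_{k+1}),$$ removable singularities being removed; the sequence ends at the first $f_k$ which is a unimodular constant. *Orthogonal rational functions.* Let $B_0=1$, $B_k=\zeta_1\cdots\zeta_k$. The functions $\Phi_0=1,\Phi_1,\Phi_2,\dots$ are obtained by orthonormalizing $B_0,B_1,B_2,\dots$ in $L^2(\mu)$. For $\Phi_k=\sum_{j\le k}c_jB_j$ put $\Phi_k^*=B_k\,\Phi_{k*}=\sum_{j\le k}\overline{c_j}\,\zeta_{j+1}\cdots\zeta_k$, where $\Phi_{k*}(z)=\overline{\Phi_k(\hat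 z)}$ with $\hat z=1/\bar z$, respectively $\hat z=\bar z$. The unimodular factor left free in $\Phi_k$ is fixed recursively by $$\frac{\Phi_k^*(\alpha_{k-1})\,\varpi_k(\alpha_{k-1})}{\varpi_{k-1}(\alpha_{k-1})\,\Phi_{k-1}^*(\alpha_{k-1})}>0\qquad(k\ge1),$$ which is the normalization under which, for some $\Lambda_k\in\mathbb D$ and $e_k>0$, $\Phi_k=e_k\frac{\varpi_{k-1}}{\varpi_k}\left(z_k\overline{z_{k-1}}\zeta_{k-1}\Phi_{k-1}+\overline{\Lambda_k}\Phi_{k-1}^*\right)$ and $\Phi_k^*=e_k\frac{\varpi_{k-1}}{\varpi_k}\left(\Lambda_kz_k\overline{z_{k-1}}\zeta_{k-1}\Phi_{k-1}+\Phi_{k-1}^*\right)$. The inverse iterates of $\mu$ are $b_k=\overline{z_k}\,\Phi_k/\Phi_k^*$. **Theorem K1 (weak rational Khrushchev formula).** Let $n\ge0$ be such that $\mu$ is not concentrated on $n$ or fewer points (so that $\Phi_n$ and $f_n$ exist). Then for $m$-almost every $t\in\partial\mathbb O$ the boundary value $f_n(t)=\lim_{r\uparrow1}f_n(rt)$, respectively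 $f_n(t)=\lim_{\epsilon\downarrow0}f_n(t+i\epsilon)$, exists, $1-\zeta_n(t)b_n(t)f_n(t)\neq0$, and $$\frac{|\Phi_n(t)|^2}{D_R(t,\alpha_n)}\,\mu'(t)=\frac{1-|f_n(t)|^2}{|1-\zeta_n(t)\,b_n(t)\,f_n(t)|^2}.$$ -/

import Mathlib

open MeasureTheory Filter Topology
open scoped ComplexConjugate

noncomputable section

namespace RatKhrushchev

/-- The Riemann sphere `ℂ ∪ {∞}`, with its Borel σ-algebra. -/
abbrev Sphere : Type := OnePoint ℂ

instance : MeasurableSpace Sphere := borel Sphere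

instance : BorelSpace Sphere := ⟨rfl⟩

/-- The two settings treated simultaneously: the unit disk and the upper half plane. -/
inductive Setting : Type
  | disk
  | halfPlane

/-- The domain: `{|z| < 1}` or `{Im z > 0}`. -/
def dom : Setting → Set ℂ
  | .disk => {z | ‖z‖ < 1}
  | .halfPlane => {z | 0 < z.im}

/-- The boundary of the domain in the sphere: the unit circle, or `ℝ ∪ {∞}`. -/
def bdry : Setting → Set Sphere
  | .disk => (fun z : ℂ => (z : Sphere)) '' {z | ‖z‖ = 1}
  | .halfPlane => insert OnePoint.infty ((fun z : ℂ => (z : Sphere)) '' {z | z.im = 0})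

/-- The base point `α₀`: `0` or `i`. -/
def base : Setting → ℂ
  | .disk => 0
  | .halfPlane => Complex.I

/-- `ϖ_a(z)`: `1 - conj a * z` or `z - conj a`. -/
def varpi (O : Setting) (a z : ℂ) : ℂ :=
  match O with
  | .disk => 1 - conj a * z
  | .halfPlane => z - conj a

open Classical in
/-- The unimodular factor `z_a`, equal to `1` at the base point. -/
def zfac (O : Setting) (a : ℂ) : ℂ :=
  if a = base O then 1
  else match O with
    | .disk => -(‖a‖ : ℂ) / a
    | .halfPlane => (‖1 + a ^ 2‖ : ℂ) / (1 + a ^ 2)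

/-- The limit of `(z - a) / ϖ_a(z)` as `z → ∞`
(for the disk and `a = 0` the point `∞` is a pole, and the value is never used). -/
def mobiusInfty (O : Setting) (a : ℂ) : ℂ :=
  match O with
  | .disk => -1 / conj a
  | .halfPlane => 1

/-- `ζ_a(z) = z_a (z - a) / ϖ_a(z)` on the sphere. -/
def zeta (O : Setting) (a : ℂ) (z : Sphere) : ℂ :=
  zfac O a * z.elim (mobiusInfty O a) (fun x => (x - a) / varpi O a x)

/-- The point `ẑ` symmetric to `z`: `1 / conj z` or `conj z`. -/
def hat (O : Setting) (z : ℂ) : ℂ :=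
  match O with
  | .disk => 1 / conj z
  | .halfPlane => conj z

/-! ### Reference measure, kernel, C-function and S-function -/

/-- The reference measure `m` on the boundary: normalized arc length on the unit circle, or
`dt / (π (1 + t²))` on the real line. -/
def refMeasure : Setting → Measure Sphere
  | .disk => ENNReal.ofReal (1 / (2 * Real.pi)) •
      Measure.map (fun θ : ℝ => ((Complex.exp (θ * Complex.I) : ℂ) : Sphere))
        (volume.restrict (Set.Ioc (-Real.pi) Real.pi))
  | .halfPlane =>
      Measure.map (fun t : ℝ => (((t : ℂ)) : Sphere))
        (volume.withDensity fun t => ENNReal.ofReal (1 / (Real.pi * (1 + t ^ 2))))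

/-- `D(t, z) = (ζ₀(t) + ζ₀(z)) / (ζ₀(t) - ζ₀(z))`. -/
def kernelD (O : Setting) (t : Sphere) (z : ℂ) : ℂ :=
  (zeta O (base O) t + zeta O (base O) z) / (zeta O (base O) t - zeta O (base O) z)

/-- `D_R(t, z)` for `t` on the boundary, where it is the real part of `D(t, z)`. -/
def kernelDR (O : Setting) (t : Sphere) (z : ℂ) : ℝ :=
  (kernelD O t z).re

/-- The C-function `F(z; μ) = ∫ D(t, z) dμ(t)`. -/
def cFun (O : Setting) (μ : Measure Sphere) (z : ℂ) : ℂ :=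
  ∫ t, kernelD O t z ∂μ

/-- The analytic function `h / ζ_a`, for `h` analytic with `h(a) = 0`: away from `a` it is the
quotient (see `divZeta_eq`), and `dslope` supplies the removable singularity at `a`. -/
def divZeta (O : Setting) (a : ℂ) (h : ℂ → ℂ) (z : ℂ) : ℂ :=
  varpi O a z / zfac O a * dslope h a z

theorem divZeta_eq (O : Setting) (a : ℂ) (h : ℂ → ℂ) (ha : h a = 0) {z : ℂ} (hz : z ≠ a) :
    divZeta O a h z = h z / zeta O a z := by
  have hza : z - a ≠ 0 := sub_ne_zero.2 hz
  simp only [divZeta, zeta, dslope_of_ne _ hz, slope_def_field, ha, sub_zero, OnePoint.elim_some]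
  rw [div_mul_div_comm, mul_div_assoc', div_div_eq_mul_div, mul_comm (varpi O a z)]

/-- The S-function `f(z; μ) = (1 / ζ₀) (F - 1) / (F + 1)` of a probability measure. -/
def sFun (O : Setting) (μ : Measure Sphere) : ℂ → ℂ :=
  divZeta O (base O) fun z => (cFun O μ z - 1) / (cFun O μ z + 1)

/-- One step of the Nevanlinna-Pick algorithm at `a`:
`f ↦ (1 / ζ_a) (f - f(a)) / (1 - conj (f(a)) f)`. -/
def npStep (O : Setting) (a : ℂ) (f : ℂ → ℂ) : ℂ → ℂ :=
  divZeta O a fun z => (f z - f a) / (1 - conj (f a) * f z)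

/-- The `α`-iterates of the measure `μ`: `f₀ = f(·; μ)`, and `f_{n+1}` is obtained from `f_n` by
the Nevanlinna-Pick step at `α_{n+1}`. -/
def iterate (O : Setting) (α : ℕ → ℂ) (μ : Measure Sphere) : ℕ → ℂ → ℂ
  | 0 => sFun O μ
  | n + 1 => npStep O (α (n + 1)) (iterate O α μ n)

/-! ### Orthogonal rational functions -/

/-- The Blaschke product `B_n = ζ_1 ⋯ ζ_n`, `ζ_k = ζ_{α_k}`. -/
def blaschke (O : Setting) (α : ℕ → ℂ) (n : ℕ) (z : Sphere) : ℂ :=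
  ∏ j ∈ Finset.Ioc 0 n, zeta O (α j) z

/-- The function `∑_{k ≤ n} c_k B_k`. -/
def comb (O : Setting) (α : ℕ → ℂ) (n : ℕ) (c : ℕ → ℂ) (z : Sphere) : ℂ :=
  ∑ k ∈ Finset.range (n + 1), c k * blaschke O α k z

/-- The function `φ^* = B_n φ_*` for `φ = ∑_{k ≤ n} c_k B_k`, where `φ_*(z) = conj (φ(ẑ))`. As
`(B_k)_* = 1 / B_k`, it is `∑_{k ≤ n} conj c_k ζ_{k+1} ⋯ ζ_n`, which has no spurious singularity
at the zeros of `B_n` (see `combStar_eq`). -/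
def combStar (O : Setting) (α : ℕ → ℂ) (n : ℕ) (c : ℕ → ℂ) (z : Sphere) : ℂ :=
  ∑ k ∈ Finset.range (n + 1), conj (c k) * ∏ j ∈ Finset.Ioc k n, zeta O (α j) z

theorem zfac_mul_conj (O : Setting) {a : ℂ} (ha : a ∈ dom O) : zfac O a * conj (zfac O a) = 1 := by
  unfold zfac
  split_ifs with h
  · simp
  · rw [Complex.mul_conj, Complex.normSq_eq_norm_sq]
    cases O with
    | disk =>
      have : ‖a‖ ≠ 0 := norm_ne_zero_iff.2 h
      simp [this]
    | halfPlane =>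
      have : ‖1 + a ^ 2‖ ≠ 0 := by
        refine norm_ne_zero_iff.2 fun h0 => ?_
        have h1 : (a - Complex.I) * (a + Complex.I) = 0 := by
          linear_combination h0 - Complex.I_sq
        rcases mul_eq_zero.1 h1 with h2 | h2
        · exact h (sub_eq_zero.1 h2)
        · have h3 : a = -Complex.I := eq_neg_of_add_eq_zero_left h2
          have h4 : 0 < a.im := ha
          rw [h3] at h4
          norm_num at h4
      simp [this]

theorem conj_zeta_hat (O : Setting) {a z : ℂ} (ha : a ∈ dom O)
    (hz : O = Setting.disk → z ≠ 0) :
    conj (zeta O a (hat O z)) = (zeta O a z)⁻¹ := by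
  have h1 : conj (zfac O a) = (zfac O a)⁻¹ := eq_inv_of_mul_eq_one_right (zfac_mul_conj O ha)
  simp only [zeta, OnePoint.elim_some, map_mul, h1, mul_inv, map_div₀, inv_div]
  congr 1
  cases O with
  | disk =>
    have hz0 := hz rfl
    simp only [varpi, hat, map_sub, map_mul, map_div₀, map_one, Complex.conj_conj]
    rw [← mul_div_mul_right _ _ hz0]
    congr 1 <;> field_simp
  | halfPlane => simp [varpi, hat]

theorem combStar_eq (O : Setting) (α : ℕ → ℂ) (hα : ∀ k, α k ∈ dom O) (n : ℕ) (c : ℕ → ℂ) {z : ℂ}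
    (hz : O = Setting.disk → z ≠ 0) (hB : ∀ k, zeta O (α k) z ≠ 0) :
    combStar O α n c z = blaschke O α n z * conj (comb O α n c (hat O z)) := by
  simp only [combStar, comb, map_sum, Finset.mul_sum]
  refine Finset.sum_congr rfl fun k hk => ?_
  have hk' : k ≤ n := Nat.lt_succ_iff.1 (Finset.mem_range.1 hk)
  have h1 : blaschke O α n z = blaschke O α k z * ∏ j ∈ Finset.Ioc k n, zeta O (α j) z :=
    (Finset.prod_Ioc_consecutive _ (Nat.zero_le k) hk').symm
  have h2 : conj (blaschke O α k (hat O z)) = (blaschke O α k z)⁻¹ := by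
    simp only [blaschke, map_prod, conj_zeta_hat O (hα _) hz, Finset.prod_inv_distrib]
  have h3 : blaschke O α k z ≠ 0 := Finset.prod_ne_zero_iff.2 fun j _ => hB j
  rw [map_mul, h1, h2]
  field_simp

/-- The coefficients of the orthogonal rational function `Φ_n` with respect to `B_0, …, B_n`.
They are obtained by orthonormalization of `B_0, B_1, …` in `L²(μ)`: `Φ_0 = 1`, and `Φ_{n+1}` is
a unimodular multiple of `φ / ‖φ‖`, where `φ = B_{n+1} - ∑_{k ≤ n} ⟨Φ_k, B_{n+1}⟩ Φ_k`. The
unimodular factor is fixed by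
`Φ_{n+1}^*(α_n) ϖ_{n+1}(α_n) / (ϖ_n(α_n) Φ_n^*(α_n)) > 0`.
This is the normalization for which
`Φ_{n+1} = e (ϖ_n / ϖ_{n+1}) (z_{n+1} conj(z_n) ζ_n Φ_n + conj(Λ) Φ_n^*)` and
`Φ_{n+1}^* = e (ϖ_n / ϖ_{n+1}) (Λ z_{n+1} conj(z_n) ζ_n Φ_n + Φ_n^*)` with `|Λ| < 1` and `e > 0`:
evaluate the second relation at `α_n`, where `ζ_n` vanishes. -/
def orfCoeff (O : Setting) (α : ℕ → ℂ) (μ : Measure Sphere) : ℕ → ℕ → ℂ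
  | 0 => Pi.single 0 1
  | n + 1 =>
    let φ : ℕ → ℂ := Pi.single (n + 1) 1 - ∑ k : Fin (n + 1),
      (∫ t, conj (comb O α k (orfCoeff O α μ k) t) * blaschke O α (n + 1) t ∂μ) •
        orfCoeff O α μ k
    let w : ℂ := combStar O α (n + 1) φ (α n) * varpi O (α (n + 1)) (α n) /
      (varpi O (α n) (α n) * combStar O α n (orfCoeff O α μ n) (α n))
    (w / ‖w‖ / (Real.sqrt (∫ t, ‖comb O α (n + 1) φ t‖ ^ 2 ∂μ) : ℂ)) • φ

/-- The orthogonal rational functions `Φ_n` associated with `μ` and `α`. -/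
def orf (O : Setting) (α : ℕ → ℂ) (μ : Measure Sphere) (n : ℕ) : Sphere → ℂ :=
  comb O α n (orfCoeff O α μ n)

/-- `Φ_n^* = B_n (Φ_n)_*`. -/
def orfStar (O : Setting) (α : ℕ → ℂ) (μ : Measure Sphere) (n : ℕ) : Sphere → ℂ :=
  combStar O α n (orfCoeff O α μ n)

/-- The inverse iterates `b_n = conj(z_n) Φ_n / Φ_n^*`. -/
def invIterate (O : Setting) (α : ℕ → ℂ) (μ : Measure Sphere) (n : ℕ) (t : Sphere) : ℂ :=
  conj (zfac O (α n)) * orf O α μ n t / orfStar O α μ n t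

/-- `w` is the boundary value at `t` of the function `f` on the domain:
`w = lim_{r ↑ 1} f(r t)`, respectively `w = lim_{ε ↓ 0} f(t + i ε)`. The point `t = ∞`, which is
null for `refMeasure`, has no boundary value. -/
def HasBdryValue (O : Setting) (f : ℂ → ℂ) (t : Sphere) (w : ℂ) : Prop :=
  t.elim False fun x =>
    match O with
    | .disk => Tendsto (fun r : ℝ => f (r * x)) (𝓝[<] 1) (𝓝 w)
    | .halfPlane => Tendsto (fun ε : ℝ => f (x + ε * Complex.I)) (𝓝[>] 0) (𝓝 w)

end RatKhrushchev

end

/-! The map `ζ_{α₀}` carries both settings to the unit disk, so the heart of the matter is a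
probability measure `ν` on the unit circle. Below, `Φ_n`, `ζ_n`, `ϖ_n`, `z_n`, `a_n` refer to the
disk.

Orthogonal functions and iterates are linked by two Cauchy transforms, `X_n = ∫ 2 ζ_n Φ_n conj(B_n)
/ (u - z) dν` and `Y_n = ∫ 2 conj(Φ_n) / (u - z) dν` (`xT`, `yT`). For `n = 0` they satisfy `X_0 = F
+ 1` and `z Y_0 = F - 1`, so that `f_0 = Y_0 / X_0`. In general `f_n = z_n Y_n / X_n`
(`diskIterate`). Indeed, the recurrence candidate for `Φ_{n+1}` with parameter `Λ` is orthogonal to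
`B_0, …, B_n` as soon as `Λ z_{n+1} conj(z_n) X_n + Y_n` vanishes at `a_{n+1}`
(`recurrence_orthogonal`), that is, for `Λ = -conj(z_{n+1}) f_n(a_{n+1})`. With this `Λ` the linear
map that sends `(ζ_n Φ_n, Φ_n^*)` to `(Φ_{n+1}, Φ_{n+1}^*)` also sends `(X_n, Y_n)` to `(X_{n+1},
ζ_{n+1} Y_{n+1})` (`xT_recurrence`, `yT_recurrence`), and on the quotient it acts as the
Nevanlinna-Pick step. Its determinant controls `X_n Φ_n^* - ζ_n Y_n Φ_n = 2 z_n (1 - |a_n|²) / ϖ_n²`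
and gives `e² (1 - |γ_n|²) = (1 - |a_{n+1}|²) / (1 - |a_n|²)`. The Schwarz lemma preserves `|f_n| ≤
1`; `|γ_n| = 1` is impossible because `ν` does not live on few points. All this is the induction
step `exists_orfStep`.

On the boundary, almost everywhere, `(F - 1) / (F + 1)` has a nontangential limit `g ≠ 1` with `μ'
|1 - g|² = 1 - |g|²` (`ae_exists_tendsto_cayley_herglotz`). This is the case `n = 0` of `μ' |Φ_n^* -
conj(z_n) ζ_n Φ_n f_n|² = (1 - |f_n|²) (1 - |a_n|²) / |ϖ_n|²`, and the step from `n` to `n + 1` is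
pointwise algebra (`BdryData.succ`). Division by `|Φ_n^*| = |Φ_n|` gives the formula.

The limits rest on Fatou's theorem, proved through Poisson integrals: Lebesgue points treat
densities, and a dyadic estimate treats measures of vanishing density. Bounded analytic functions
are Poisson integrals by weak compactness in `L²`. The value `g = 1` is excluded because the
circular means of `log |F + 1|` are constant. -/

noncomputable section

namespace RatKhrushchev

/-! ### Poisson integrals of measures with vanishing density, in Stolz regions. -/

/-- The filter of approach to `ζ` inside the Stolz region of aperture `C` of the unit disk. -/
def stolz (C : ℝ) (ζ : ℂ) : Filter ℂ :=
  𝓝[{w : ℂ | ‖w‖ < 1 ∧ ‖w - ζ‖ ≤ C * (1 - ‖w‖)}] ζ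

/-- The point `e^{iθ}` of the unit circle. -/
def cis (θ : ℝ) : ℂ := Complex.exp (θ * Complex.I)

theorem norm_cis (θ : ℝ) : ‖cis θ‖ = 1 := Complex.norm_exp_ofReal_mul_I θ

@[fun_prop]
theorem continuous_cis : Continuous cis := by unfold cis; fun_prop

theorem norm_cis_sub_cis (s x : ℝ) : ‖cis s - cis x‖ = 2 * |Real.sin ((s - x) / 2)| := by
  have h : cis s - cis x = cis x * (Complex.exp (Complex.I * ((s - x : ℝ) : ℂ)) - 1) := by
    unfold cis
    rw [mul_sub, mul_one, ← Complex.exp_add]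
    congr 2
    push_cast
    ring
  rw [h, norm_mul, norm_cis, one_mul, Complex.norm_exp_I_mul_ofReal_sub_one]
  simp

/-- Normalized arc length on the circle in terms of the angle, running over `(b, b + 2π]`. -/
def angleMeasure (b : ℝ) : Measure ℝ :=
  ENNReal.ofReal (1 / (2 * Real.pi)) • volume.restrict (Set.Ioc b (b + 2 * Real.pi))

/-- Chord and arc are comparable as long as `s - x` stays away from `±2π`, which holds because `x`
is interior to the window. Half of `|s - x|` is at most `y < π`, the larger half-distance from `x`
to an endpoint, and concavity of the sine on `[0, π]` puts its graph above the chord from `0` to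
`y`. -/
theorem exists_mul_abs_le_norm_cis_sub_cis {b x : ℝ} (hx : x ∈ Set.Ioo b (b + 2 * Real.pi)) :
    ∃ κ > 0, ∀ s ∈ Set.Ioc b (b + 2 * Real.pi), κ * |s - x| ≤ ‖cis s - cis x‖ := by
  set y := max ((x - b) / 2) ((b + 2 * Real.pi - x) / 2) with hy
  have hy0 : 0 < y := lt_max_of_lt_left (by linarith [hx.1])
  have hyπ : y < Real.pi := max_lt (by linarith [hx.2]) (by linarith [hx.1])
  have hsin : 0 < Real.sin y := Real.sin_pos_of_pos_of_lt_pi hy0 hyπ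
  refine ⟨Real.sin y / y, by positivity, fun s hs => ?_⟩
  rw [norm_cis_sub_cis]
  have h1 : |s - x| / 2 ≤ y := by
    rcases abs_cases (s - x) with ⟨h, _⟩ | ⟨h, _⟩ <;> rw [h]
    · exact le_max_of_le_right (by linarith [hs.2])
    · exact le_max_of_le_left (by linarith [hs.1])
  have h2 : |Real.sin ((s - x) / 2)| = Real.sin (|s - x| / 2) := by
    have : |s - x| / 2 = |(s - x) / 2| := by rw [abs_div]; simp
    rw [this]
    have h3 : 0 ≤ Real.sin (|(s - x) / 2|) :=
      Real.sin_nonneg_of_nonneg_of_le_pi (abs_nonneg _) (by rw [← this]; linarith)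
    rcases abs_cases ((s - x) / 2) with ⟨h, _⟩ | ⟨h, _⟩
    · rw [h] at h3 ⊢; exact abs_of_nonneg h3
    · rw [h, Real.sin_neg] at h3 ⊢; exact abs_of_nonpos (by linarith)
  have ha : 0 ≤ |s - x| / 2 / y := by positivity
  have hb : 0 ≤ 1 - |s - x| / 2 / y := by rw [sub_nonneg, div_le_one hy0]; exact h1
  have hy1 : y ∈ Set.Icc 0 Real.pi := ⟨hy0.le, hyπ.le⟩
  have hy2 : (0 : ℝ) ∈ Set.Icc 0 Real.pi := ⟨le_rfl, Real.pi_pos.le⟩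
  have h4 := (strictConcaveOn_sin_Icc.concaveOn).2 hy1 hy2 ha hb (by ring)
  simp only [smul_eq_mul, Real.sin_zero, mul_zero, add_zero] at h4
  rw [div_mul_cancel₀ _ hy0.ne'] at h4
  rw [h2]
  calc Real.sin y / y * |s - x| = 2 * (|s - x| / 2 / y * Real.sin y) := by ring
    _ ≤ _ := by linarith

/-- Dyadic balls of radius `2^k ε / κ` dominate the kernel. If `k ≥ 1` is the least index whose ball
contains `s`, then `κ |s - x| > 2^(k-1) ε`, and the kernel is at most `2ε / (4^(k-1) ε²) = 8 / (4^k
ε)`. That ball has mass at most `η 2^k ε / κ`, so the terms sum to `(8η/κ) ∑ 2^(-k)`. -/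
theorem lintegral_dyadic_kernel_le {σ : Measure ℝ} {x κ ε η : ℝ} (hκ : 0 < κ) (hε : 0 < ε)
    (hη : 0 ≤ η) (hσ : ∀ r > 0, σ (Metric.closedBall x r) ≤ ENNReal.ofReal (η * r)) :
    ∫⁻ s, ENNReal.ofReal (2 * ε / max (ε ^ 2) (κ ^ 2 * |s - x| ^ 2)) ∂σ
      ≤ ENNReal.ofReal (16 * η / κ) := by
  have hpt : ∀ s, ENNReal.ofReal (2 * ε / max (ε ^ 2) (κ ^ 2 * |s - x| ^ 2)) ≤
      ∑' k : ℕ, (Metric.closedBall x (2 ^ k * ε / κ)).indicator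
        (fun _ => ENNReal.ofReal (8 / (4 ^ k * ε))) s := by
    intro s
    have hex : ∃ k : ℕ, κ * |s - x| ≤ 2 ^ k * ε := by
      obtain ⟨k, hk⟩ := pow_unbounded_of_one_lt (κ * |s - x| / ε) (one_lt_two (α := ℝ))
      exact ⟨k, by rw [← div_le_iff₀ hε]; exact hk.le⟩
    classical
    let k := Nat.find hex
    have hk : κ * |s - x| ≤ 2 ^ k * ε := Nat.find_spec hex
    refine le_trans ?_ (ENNReal.le_tsum k)
    have hmem : s ∈ Metric.closedBall x (2 ^ k * ε / κ) := by
      rw [Metric.mem_closedBall, Real.dist_eq, le_div_iff₀ hκ]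
      linarith
    rw [Set.indicator_of_mem hmem]
    apply ENNReal.ofReal_le_ofReal
    have hM : 0 < max (ε ^ 2) (κ ^ 2 * |s - x| ^ 2) := lt_max_of_lt_left (by positivity)
    rw [div_le_div_iff₀ hM (by positivity)]
    rcases hk0 : k with _ | j
    · have := le_max_left (ε ^ 2) (κ ^ 2 * |s - x| ^ 2)
      nlinarith
    · have hj : ¬ κ * |s - x| ≤ 2 ^ j * ε := Nat.find_min hex (by change j < k; omega)
      have h1 : (2 ^ j * ε) ^ 2 ≤ κ ^ 2 * |s - x| ^ 2 := by
        rw [← mul_pow]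
        exact pow_le_pow_left₀ (by positivity) (not_le.1 hj).le 2
      have h2 := le_max_right (ε ^ 2) (κ ^ 2 * |s - x| ^ 2)
      have h3 : (2 : ℝ) ^ j * 2 ^ j = 4 ^ j := by rw [← mul_pow]; norm_num
      rw [pow_succ]
      nlinarith
  calc _ ≤ ∫⁻ s, ∑' k : ℕ, (Metric.closedBall x (2 ^ k * ε / κ)).indicator
        (fun _ => ENNReal.ofReal (8 / (4 ^ k * ε))) s ∂σ := lintegral_mono hpt
    _ = ∑' k : ℕ, ENNReal.ofReal (8 / (4 ^ k * ε)) * σ (Metric.closedBall x (2 ^ k * ε / κ)) := by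
        rw [lintegral_tsum fun k =>
          (measurable_const.indicator measurableSet_closedBall).aemeasurable]
        simp only [lintegral_indicator_const measurableSet_closedBall]
    _ ≤ ∑' k : ℕ, ENNReal.ofReal (8 * η / κ * (1 / 2) ^ k) := by
        refine ENNReal.tsum_le_tsum fun k => ?_
        refine (mul_le_mul_right (hσ _ (by positivity)) _).trans ?_
        rw [← ENNReal.ofReal_mul (by positivity)]
        apply ENNReal.ofReal_le_ofReal
        have h3 : (4 : ℝ) ^ k = 2 ^ k * 2 ^ k := by rw [← mul_pow]; norm_num
        rw [h3, one_div, inv_pow]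
        apply le_of_eq
        field_simp
    _ = _ := by
        rw [← ENNReal.ofReal_tsum_of_nonneg (fun k => by positivity)
          ((summable_geometric_two).mul_left _), tsum_mul_left, tsum_geometric_two]
        congr 1
        ring

theorem poissonKernel_nonneg {w : ℂ} (hw : ‖w‖ < 1) (s : ℝ) : 0 ≤ poissonKernel 0 w (cis s) := by
  rw [poissonKernel_def]
  simp only [sub_zero, norm_cis]
  have : ‖w‖ ^ 2 ≤ 1 := by nlinarith [norm_nonneg w]
  apply div_nonneg <;> nlinarith [sq_nonneg ‖cis s - w‖]

/-- In a Stolz region the Poisson kernel is controlled by a radial approximate identity. -/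
theorem poissonKernel_le_of_stolz {C κ x s : ℝ} {w : ℂ} (hκ : 0 < κ) (hC : 0 ≤ C) (hw : ‖w‖ < 1)
    (hwx : ‖w - cis x‖ ≤ C * (1 - ‖w‖)) (hs : κ * |s - x| ≤ ‖cis s - cis x‖) :
    poissonKernel 0 w (cis s) ≤
      2 * (1 - ‖w‖) / max ((1 - ‖w‖) ^ 2) ((κ / (1 + C)) ^ 2 * |s - x| ^ 2) := by
  rw [poissonKernel_def]
  simp only [sub_zero, norm_cis]
  have h0 : 0 < 1 - ‖w‖ := by linarith
  have h1 : 1 - ‖w‖ ≤ ‖cis s - w‖ := by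
    have := norm_sub_norm_le (cis s) w
    rwa [norm_cis] at this
  -- By the Stolz condition `‖w - cis x‖ ≤ C (1 - ‖w‖) ≤ C ‖cis s - w‖`, hence `‖cis s - cis x‖ ≤ (1
  -- + C) ‖cis s - w‖`.
  have h2 : κ / (1 + C) * |s - x| ≤ ‖cis s - w‖ := by
    rw [div_mul_eq_mul_div, div_le_iff₀ (by positivity)]
    have := norm_sub_le_norm_sub_add_norm_sub (cis s) w (cis x)
    nlinarith
  apply div_le_div₀ (by positivity)
  · nlinarith [norm_nonneg w]
  · exact lt_max_of_lt_left (by positivity)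
  · rw [← mul_pow]
    exact max_le (pow_le_pow_left₀ h0.le h1 2) (pow_le_pow_left₀ (by positivity) h2 2)

theorem tendsto_one_sub_norm_stolz (C x : ℝ) :
    Tendsto (fun w : ℂ => 1 - ‖w‖) (stolz C (cis x)) (𝓝 0) := by
  have : Tendsto (fun w : ℂ => 1 - ‖w‖) (𝓝 (cis x)) (𝓝 (1 - ‖cis x‖)) :=
    (continuous_const.sub continuous_norm).tendsto _
  rw [norm_cis, sub_self] at this
  exact this.mono_left nhdsWithin_le_nhds

/-- The Poisson integral of a measure of vanishing density at `x` tends to `0` at `e^{ix}`. -/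
theorem tendsto_lintegral_poissonKernel_zero {σ : Measure ℝ} [IsFiniteMeasure σ] {b x : ℝ}
    (hx : x ∈ Set.Ioo b (b + 2 * Real.pi)) (hσ : σ (Set.Ioc b (b + 2 * Real.pi))ᶜ = 0)
    (hd : Tendsto (fun r : ℝ => σ (Metric.closedBall x r) / ENNReal.ofReal r) (𝓝[>] 0) (𝓝 0))
    {C : ℝ} (hC : 0 ≤ C) :
    Tendsto (fun w => ∫⁻ s, ENNReal.ofReal (poissonKernel 0 w (cis s)) ∂σ) (stolz C (cis x))
      (𝓝 0) := by
  obtain ⟨κ₀, hκ₀, hκ⟩ := exists_mul_abs_le_norm_cis_sub_cis hx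
  set κ := κ₀ / (1 + C) with hκdef
  have hκpos : 0 < κ := by positivity
  rw [ENNReal.tendsto_nhds_zero]
  intro ε hε
  obtain ⟨η, hη, hηε⟩ : ∃ η : ℝ, 0 < η ∧ ENNReal.ofReal (16 * η / κ) ≤ ε / 2 := by
    have : Tendsto (fun η : ℝ => ENNReal.ofReal (16 * η / κ)) (𝓝[>] 0) (𝓝 0) := by
      have h : Tendsto (fun η : ℝ => ENNReal.ofReal (16 * η / κ)) (𝓝 0)
          (𝓝 (ENNReal.ofReal (16 * 0 / κ))) :=
        (ENNReal.continuous_ofReal.comp (by fun_prop)).tendsto _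
      simp only [mul_zero, zero_div, ENNReal.ofReal_zero] at h
      exact h.mono_left nhdsWithin_le_nhds
    rw [ENNReal.tendsto_nhds_zero] at this
    obtain ⟨η, h1, h2⟩ := ((this (ε / 2) (ENNReal.half_pos hε.ne')).and
      self_mem_nhdsWithin).exists
    exact ⟨η, h2, h1⟩
  obtain ⟨δ₀, hδ₀, hδ⟩ : ∃ δ₀ > (0 : ℝ), ∀ r ∈ Set.Ioo 0 δ₀,
      σ (Metric.closedBall x r) ≤ ENNReal.ofReal (η * r) := by
    have h := (ENNReal.tendsto_nhds_zero.1 hd) (ENNReal.ofReal η) (by simpa using hη)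
    rw [eventually_nhdsWithin_iff, Metric.eventually_nhds_iff] at h
    obtain ⟨δ₀, h1, h2⟩ := h
    refine ⟨δ₀, h1, fun r hr => ?_⟩
    have h3 := h2 (y := r) (by rw [Real.dist_eq, sub_zero, abs_of_pos hr.1]; exact hr.2) hr.1
    rw [ENNReal.div_le_iff (by simpa using hr.1) ENNReal.ofReal_ne_top] at h3
    rwa [ENNReal.ofReal_mul hη.le]
  set δ := δ₀ / 2
  have hδpos : 0 < δ := by positivity
  -- Restriction to a small ball makes the linear growth bound valid at every radius, as the dyadic
  -- estimate requires.
  have hlocal : ∀ r > 0, (σ.restrict (Metric.closedBall x δ)) (Metric.closedBall x r) ≤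
      ENNReal.ofReal (η * r) := by
    intro r hr
    rw [Measure.restrict_apply measurableSet_closedBall]
    rcases le_or_gt r δ with h | h
    · exact (measure_mono Set.inter_subset_left).trans
        (hδ r ⟨hr, h.trans_lt (half_lt_self hδ₀)⟩)
    · refine (measure_mono Set.inter_subset_right).trans
        ((hδ δ ⟨hδpos, half_lt_self hδ₀⟩).trans (ENNReal.ofReal_le_ofReal ?_))
      nlinarith
  -- Off the ball the kernel is uniformly of order `1 - ‖w‖`.
  have hfar : ∀ᶠ w in stolz C (cis x),
      ENNReal.ofReal (2 * (1 - ‖w‖) / (κ ^ 2 * δ ^ 2)) * σ Set.univ ≤ ε / 2 := by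
    have h := (tendsto_one_sub_norm_stolz C x).const_mul 2 |>.div_const (κ ^ 2 * δ ^ 2)
    have h2 := ENNReal.Tendsto.mul_const (ENNReal.tendsto_ofReal h) (b := σ Set.univ)
      (Or.inr (measure_ne_top σ _))
    simp only [mul_zero, zero_div, ENNReal.ofReal_zero, zero_mul] at h2
    exact (ENNReal.tendsto_nhds_zero.1 h2) _ (ENNReal.half_pos hε.ne')
  filter_upwards [hfar, self_mem_nhdsWithin] with w hw1 hw
  obtain ⟨hw2, hw3⟩ := hw
  have hpos : 0 < 1 - ‖w‖ := by linarith
  have hae : ∀ᵐ s ∂σ, s ∈ Set.Ioc b (b + 2 * Real.pi) := by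
    rw [ae_iff]; exact hσ
  calc ∫⁻ s, ENNReal.ofReal (poissonKernel 0 w (cis s)) ∂σ
      ≤ ∫⁻ s, ENNReal.ofReal (2 * (1 - ‖w‖) / max ((1 - ‖w‖) ^ 2) (κ ^ 2 * |s - x| ^ 2)) ∂σ := by
        apply lintegral_mono_ae
        filter_upwards [hae] with s hs
        exact ENNReal.ofReal_le_ofReal (poissonKernel_le_of_stolz hκ₀ hC hw2 hw3 (hκ s hs))
    _ = (∫⁻ s in Metric.closedBall x δ,
          ENNReal.ofReal (2 * (1 - ‖w‖) / max ((1 - ‖w‖) ^ 2) (κ ^ 2 * |s - x| ^ 2)) ∂σ) +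
        ∫⁻ s in (Metric.closedBall x δ)ᶜ,
          ENNReal.ofReal (2 * (1 - ‖w‖) / max ((1 - ‖w‖) ^ 2) (κ ^ 2 * |s - x| ^ 2)) ∂σ :=
        (lintegral_add_compl _ measurableSet_closedBall).symm
    _ ≤ ε / 2 + ε / 2 := by
        refine add_le_add ((lintegral_dyadic_kernel_le hκpos hpos hη.le hlocal).trans hηε)
          (le_trans ?_ hw1)
        calc _ ≤ ∫⁻ s in (Metric.closedBall x δ)ᶜ,
              ENNReal.ofReal (2 * (1 - ‖w‖) / (κ ^ 2 * δ ^ 2)) ∂σ := by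
              refine setLIntegral_mono' measurableSet_closedBall.compl fun s hs => ?_
              apply ENNReal.ofReal_le_ofReal
              apply div_le_div_of_nonneg_left (by positivity) (by positivity)
              refine le_max_of_le_right ?_
              have : δ < |s - x| := by
                rw [Set.mem_compl_iff, Metric.mem_closedBall, Real.dist_eq] at hs
                exact not_le.1 hs
              gcongr
          _ ≤ _ := by
              rw [setLIntegral_const]
              gcongr
              exact Set.subset_univ _
    _ = ε := ENNReal.add_halves ε

end RatKhrushchev

end

/-! ### Nontangential limits of Poisson integrals. -/

noncomputable section

namespace RatKhrushchev

instance (b : ℝ) : IsFiniteMeasure (angleMeasure b) := by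
  unfold angleMeasure
  exact Measure.smul_finite _ ENNReal.ofReal_ne_top

theorem angleMeasure_compl (b : ℝ) : angleMeasure b (Set.Ioc b (b + 2 * Real.pi))ᶜ = 0 := by
  simp [angleMeasure, Measure.restrict_apply measurableSet_Ioc.compl]

theorem ae_angleMeasure_mem (b : ℝ) :
    ∀ᵐ x ∂(angleMeasure b), x ∈ Set.Ioo b (b + 2 * Real.pi) := by
  refine Measure.ae_smul_measure ?_ _
  rw [Measure.restrict_congr_set Ioo_ae_eq_Ioc.symm]
  exact ae_restrict_mem measurableSet_Ioo

theorem ae_angleMeasure_of_ae {b : ℝ} {p : ℝ → Prop} (h : ∀ᵐ x, p x) :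
    ∀ᵐ x ∂(angleMeasure b), p x :=
  Measure.ae_smul_measure (ae_restrict_of_ae h) _

theorem integral_angleMeasure_eq {E : Type*} [NormedAddCommGroup E] [NormedSpace ℝ E]
    (b : ℝ) (h : ℝ → E) :
    ∫ s, h s ∂(angleMeasure b) = (2 * Real.pi)⁻¹ • ∫ s in b..(b + 2 * Real.pi), h s := by
  rw [angleMeasure, integral_smul_measure, intervalIntegral.integral_of_le
    (by linarith [Real.pi_pos]), ENNReal.toReal_ofReal (by positivity), one_div]

theorem integral_angleMeasure_cis {E : Type*} [NormedAddCommGroup E] [NormedSpace ℝ E]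
    (b : ℝ) (h : ℂ → E) :
    ∫ s, h (cis s) ∂(angleMeasure b) = Real.circleAverage h 0 1 := by
  have hp : Function.Periodic (fun s : ℝ => h (cis s)) (2 * Real.pi) := by
    intro s
    have : cis (s + 2 * Real.pi) = cis s := by
      unfold cis
      rw [show ((s + 2 * Real.pi : ℝ) : ℂ) * Complex.I = s * Complex.I + 2 * Real.pi * Complex.I by
        push_cast; ring, Complex.exp_add, Complex.exp_two_pi_mul_I, mul_one]
    simp only [this]
  have h2 := hp.intervalIntegral_add_eq b 0
  rw [integral_angleMeasure_eq, Real.circleAverage_def, h2, zero_add]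
  simp [circleMap, cis]

theorem continuous_poissonKernel_cis {w : ℂ} (hw : ‖w‖ < 1) :
    Continuous fun s : ℝ => poissonKernel 0 w (cis s) := by
  simp only [poissonKernel_def, sub_zero]
  refine Continuous.div (by fun_prop) (by fun_prop) fun s h => ?_
  have h1 : cis s = w := by simpa [sub_eq_zero] using h
  rw [← h1, norm_cis] at hw
  exact lt_irrefl _ hw

theorem poissonKernel_cis_le {w : ℂ} (hw : ‖w‖ < 1) (s : ℝ) :
    ‖poissonKernel 0 w (cis s)‖ ≤ 1 / (1 - ‖w‖) ^ 2 := by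
  rw [Real.norm_of_nonneg (poissonKernel_nonneg hw s), poissonKernel_def]
  simp only [sub_zero, norm_cis]
  have h1 : 1 - ‖w‖ ≤ ‖cis s - w‖ := by
    have := norm_sub_norm_le (cis s) w
    rwa [norm_cis] at this
  have h0 : 0 < 1 - ‖w‖ := by linarith
  exact div_le_div₀ zero_le_one (by nlinarith [norm_nonneg w]) (by positivity)
    (pow_le_pow_left₀ h0.le h1 2)

theorem integral_poissonKernel_smul {E : Type*} [NormedAddCommGroup E] [NormedSpace ℂ E]
    [CompleteSpace E] (b : ℝ) {f : ℂ → E} (hf : DiffContOnCl ℂ f (Metric.ball 0 1)) {w : ℂ}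
    (hw : ‖w‖ < 1) :
    ∫ s, poissonKernel 0 w (cis s) • f (cis s) ∂(angleMeasure b) = f w := by
  rw [integral_angleMeasure_cis b fun z => poissonKernel 0 w z • f z]
  exact hf.circleAverage_poissonKernel_smul (by simpa using hw)

theorem integral_poissonKernel (b : ℝ) {w : ℂ} (hw : ‖w‖ < 1) :
    ∫ s, poissonKernel 0 w (cis s) ∂(angleMeasure b) = 1 := by
  have h := integral_poissonKernel_smul b (f := fun _ => (1 : ℂ)) diffContOnCl_const hw
  have h2 : ∫ s, ((poissonKernel 0 w (cis s) : ℝ) : ℂ) ∂(angleMeasure b) = 1 := by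
    simpa using h
  rw [integral_complex_ofReal] at h2
  exact_mod_cast h2

theorem eventually_stolz_norm_lt (C : ℝ) (ζ : ℂ) : ∀ᶠ w in stolz C ζ, ‖w‖ < 1 := by
  filter_upwards [self_mem_nhdsWithin] with w hw using hw.1

theorem integrable_poissonKernel_smul {E : Type*} [NormedAddCommGroup E] [NormedSpace ℝ E]
    {ν : Measure ℝ} {F : ℝ → E} (hF : Integrable F ν) {w : ℂ} (hw : ‖w‖ < 1) :
    Integrable (fun s => poissonKernel 0 w (cis s) • F s) ν :=
  hF.bdd_smul (1 / (1 - ‖w‖) ^ 2)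
    (continuous_poissonKernel_cis hw).aestronglyMeasurable
    (Eventually.of_forall fun s => poissonKernel_cis_le hw s)

/-- Poisson integrals of integrable functions converge nontangentially at Lebesgue points. -/
theorem ae_tendsto_integral_poissonKernel_smul {E : Type*} [NormedAddCommGroup E]
    [NormedSpace ℝ E] [CompleteSpace E] {b : ℝ} {F : ℝ → E}
    (hF : Integrable F (angleMeasure b)) :
    ∀ᵐ x ∂(angleMeasure b), ∀ C : ℝ, 0 ≤ C →
      Tendsto (fun w => ∫ s, poissonKernel 0 w (cis s) • F s ∂(angleMeasure b))
        (stolz C (cis x)) (𝓝 (F x)) := by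
  set W := Set.Ioc b (b + 2 * Real.pi) with hW
  have hc0 : ENNReal.ofReal (1 / (2 * Real.pi)) ≠ 0 := by
    rw [Ne, ENNReal.ofReal_eq_zero, not_le]; positivity
  have hFW : IntegrableOn F W := by
    have := hF
    rw [angleMeasure, integrable_smul_measure hc0 ENNReal.ofReal_ne_top] at this
    exact this
  -- Extension by zero allows the differentiation theorem for Lebesgue measure on the whole line.
  have hF' : Integrable (W.indicator F) := (integrable_indicator_iff measurableSet_Ioc).2 hFW
  have hleb := IsUnifLocDoublingMeasure.ae_tendsto_average_norm_sub (μ := (volume : Measure ℝ))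
    hF'.locallyIntegrable 1
  filter_upwards [ae_angleMeasure_mem b, ae_angleMeasure_of_ae hleb] with x hx hlx C hC
  have hlx' := hlx (l := 𝓝[>] (0 : ℝ)) (fun _ => x) (fun r => r) tendsto_id (by
    filter_upwards [self_mem_nhdsWithin] with r hr
    rw [one_mul]
    exact Metric.mem_closedBall_self (le_of_lt hr))
  have hxW : x ∈ W := ⟨hx.1, hx.2.le⟩
  have hint : Integrable (fun s => F s - F x) (angleMeasure b) := hF.sub (integrable_const _)
  -- At a Lebesgue point the measure `|F - F x|` has vanishing density, so its Poisson integral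
  -- tends to `0`.
  let σ : Measure ℝ := (angleMeasure b).withDensity fun s => ‖F s - F x‖ₑ
  have hmeas : AEMeasurable (fun s => ‖F s - F x‖ₑ) (angleMeasure b) :=
    hint.aestronglyMeasurable.enorm
  have : IsFiniteMeasure σ := isFiniteMeasure_withDensity hint.2.ne
  have hσW : σ Wᶜ = 0 := withDensity_absolutelyContinuous _ _ (angleMeasure_compl b)
  have hd : Tendsto (fun r : ℝ => σ (Metric.closedBall x r) / ENNReal.ofReal r) (𝓝[>] 0)
      (𝓝 0) := by
    -- The factor is `2`, from the length `2r` of the ball, times the `1 / (2π)` of `angleMeasure`.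
    have h1 : Tendsto (fun r : ℝ => ENNReal.ofReal
        (⨍ y in Metric.closedBall x r, ‖W.indicator F y - W.indicator F x‖) *
          ENNReal.ofReal (2 * (1 / (2 * Real.pi)))) (𝓝[>] 0) (𝓝 0) := by
      have := ENNReal.Tendsto.mul_const (ENNReal.tendsto_ofReal hlx')
        (b := ENNReal.ofReal (2 * (1 / (2 * Real.pi)))) (Or.inr ENNReal.ofReal_ne_top)
      simpa using this
    refine tendsto_of_tendsto_of_tendsto_of_le_of_le' tendsto_const_nhds h1
      (Eventually.of_forall fun _ => zero_le) ?_
    filter_upwards [self_mem_nhdsWithin] with r hr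
    have hr : 0 < r := hr
    have hbi : IntegrableOn (fun y => W.indicator F y - W.indicator F x)
        (Metric.closedBall x r) :=
      hF'.integrableOn.sub (integrableOn_const (by rw [Real.volume_closedBall]; exact ENNReal.ofReal_ne_top))
    rw [ENNReal.div_le_iff (by simpa using hr) ENNReal.ofReal_ne_top]
    calc σ (Metric.closedBall x r)
        = ENNReal.ofReal (1 / (2 * Real.pi)) *
            ∫⁻ y in Metric.closedBall x r ∩ W, ‖F y - F x‖ₑ := by
          rw [withDensity_apply _ measurableSet_closedBall, angleMeasure,
            Measure.restrict_smul, lintegral_smul_measure,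
            Measure.restrict_restrict measurableSet_closedBall]
          rfl
      _ = ENNReal.ofReal (1 / (2 * Real.pi)) *
            ∫⁻ y in Metric.closedBall x r ∩ W, ‖W.indicator F y - W.indicator F x‖ₑ := by
          congr 1
          refine setLIntegral_congr_fun (measurableSet_closedBall.inter measurableSet_Ioc) ?_
          intro y hy
          simp only [Set.indicator_of_mem hy.2, Set.indicator_of_mem hxW]
      _ ≤ ENNReal.ofReal (1 / (2 * Real.pi)) *
            ∫⁻ y in Metric.closedBall x r, ‖W.indicator F y - W.indicator F x‖ₑ := by
          gcongr
          exact Set.inter_subset_left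
      _ = ENNReal.ofReal (1 / (2 * Real.pi)) * ENNReal.ofReal
            (∫ y in Metric.closedBall x r, ‖W.indicator F y - W.indicator F x‖) := by
          rw [ofReal_integral_norm_eq_lintegral_enorm hbi]
      _ ≤ _ := by
          rw [setAverage_eq, measureReal_def, Real.volume_closedBall,
            ENNReal.toReal_ofReal (by positivity), smul_eq_mul,
            ← ENNReal.ofReal_mul (by positivity), ← ENNReal.ofReal_mul (by positivity),
            ← ENNReal.ofReal_mul (by positivity)]
          apply ENNReal.ofReal_le_ofReal
          apply le_of_eq
          field_simp
  have hlim := tendsto_lintegral_poissonKernel_zero hx hσW hd hC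
  rw [tendsto_iff_edist_tendsto_0]
  refine tendsto_of_tendsto_of_tendsto_of_le_of_le' tendsto_const_nhds hlim
    (Eventually.of_forall fun _ => zero_le) ?_
  filter_upwards [eventually_stolz_norm_lt C (cis x)] with w hw
  -- The Poisson kernel has mean one, so the error is the Poisson integral of `F - F x`.
  have h1 : ∫ s, poissonKernel 0 w (cis s) • F s ∂(angleMeasure b) - F x =
      ∫ s, poissonKernel 0 w (cis s) • (F s - F x) ∂(angleMeasure b) := by
    simp only [smul_sub]
    rw [integral_sub (integrable_poissonKernel_smul hF hw)
      (integrable_poissonKernel_smul (integrable_const _) hw), integral_smul_const,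
      integral_poissonKernel b hw, one_smul]
  rw [edist_eq_enorm_sub, h1]
  refine (enorm_integral_le_lintegral_enorm _).trans (le_of_eq ?_)
  rw [lintegral_withDensity_eq_lintegral_mul₀ hmeas
    (continuous_poissonKernel_cis hw).measurable.ennreal_ofReal.aemeasurable]
  refine lintegral_congr fun s => ?_
  rw [Pi.mul_apply, enorm_smul, mul_comm, Real.enorm_of_nonneg (poissonKernel_nonneg hw s)]

/-- Fatou's theorem: the Poisson integral of a measure converges nontangentially to its density. -/
theorem ae_tendsto_integral_poissonKernel_rnDeriv {b : ℝ} (ν : Measure ℝ) [IsFiniteMeasure ν]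
    (hν : ν (Set.Ioc b (b + 2 * Real.pi))ᶜ = 0) :
    ∀ᵐ x ∂(angleMeasure b), ∀ C : ℝ, 0 ≤ C →
      Tendsto (fun w => ∫ s, poissonKernel 0 w (cis s) ∂ν) (stolz C (cis x))
        (𝓝 (ν.rnDeriv (angleMeasure b) x).toReal) := by
  set W := Set.Ioc b (b + 2 * Real.pi) with hW
  set τ := ν.singularPart (angleMeasure b) with hτ
  have hτle : τ ≤ ν := Measure.singularPart_le _ _
  have hτW : τ Wᶜ = 0 := le_antisymm ((hτle _).trans hν.le) zero_le
  have hc0 : ENNReal.ofReal (1 / (2 * Real.pi)) ≠ 0 := by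
    rw [Ne, ENNReal.ofReal_eq_zero, not_le]; positivity
  -- The differentiation theorem needs singularity with respect to Lebesgue measure on all of `ℝ`.
  -- The complement of the window can be added to the separating set because `τ` does not charge it.
  have hsing : τ.MutuallySingular (volume : Measure ℝ) := by
    obtain ⟨A, hA, h1, h2⟩ := Measure.mutuallySingular_singularPart ν (angleMeasure b)
    refine ⟨A ∪ Wᶜ, hA.union measurableSet_Ioc.compl, measure_union_null h1 hτW, ?_⟩
    rw [Set.compl_union, compl_compl]
    rw [angleMeasure, Measure.smul_apply, smul_eq_mul, mul_eq_zero,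
      Measure.restrict_apply hA.compl] at h2
    exact h2.resolve_left hc0
  have hgint : Integrable (fun x => (ν.rnDeriv (angleMeasure b) x).toReal) (angleMeasure b) :=
    Measure.integrable_toReal_rnDeriv
  filter_upwards [ae_angleMeasure_mem b,
    ae_angleMeasure_of_ae (Besicovitch.ae_tendsto_rnDeriv τ volume),
    ae_angleMeasure_of_ae hsing.rnDeriv_ae_eq_zero,
    ae_tendsto_integral_poissonKernel_smul hgint] with x hx h1 h2 h3 C hC
  rw [h2] at h1
  have hd : Tendsto (fun r : ℝ => τ (Metric.closedBall x r) / ENNReal.ofReal r) (𝓝[>] 0)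
      (𝓝 0) := by
    have h4 := ENNReal.Tendsto.mul_const h1 (b := 2) (Or.inr (by simp))
    simp only [Pi.zero_apply, zero_mul] at h4
    refine h4.congr' ?_
    filter_upwards [self_mem_nhdsWithin] with r hr
    rw [Real.volume_closedBall, ENNReal.ofReal_mul zero_le_two, ENNReal.ofReal_ofNat,
      ENNReal.div_eq_inv_mul, ENNReal.div_eq_inv_mul,
      ENNReal.mul_inv (Or.inr ENNReal.ofReal_ne_top) (Or.inl ENNReal.ofNat_ne_top), mul_assoc,
      mul_comm, ← mul_assoc, mul_assoc _ (2 : ENNReal), ENNReal.mul_inv_cancel (by simp) (by simp),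
      mul_one, mul_comm]
  have h4 := tendsto_lintegral_poissonKernel_zero hx hτW hd hC
  have h5 := (ENNReal.tendsto_toReal (by simp)).comp h4
  have h6 := h5.add (h3 C hC)
  simp only [ENNReal.toReal_zero, zero_add] at h6
  refine h6.congr' ?_
  filter_upwards [eventually_stolz_norm_lt C (cis x)] with w hw
  have hi : ∀ μ : Measure ℝ, IsFiniteMeasure μ →
      Integrable (fun s => poissonKernel 0 w (cis s)) μ := fun μ _ => by
    simpa using integrable_poissonKernel_smul (integrable_const (1 : ℝ)) hw (ν := μ)
  conv_rhs => rw [← Measure.singularPart_add_rnDeriv ν (angleMeasure b)]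
  rw [integral_add_measure (hi _ inferInstance) (hi _ inferInstance)]
  congr 1
  · simp only [Function.comp]
    rw [integral_eq_lintegral_of_nonneg_ae
      (Eventually.of_forall fun s => poissonKernel_nonneg hw s)
      (continuous_poissonKernel_cis hw).aestronglyMeasurable]
  · rw [integral_withDensity_eq_integral_toReal_smul (Measure.measurable_rnDeriv _ _)
      (Measure.rnDeriv_lt_top _ _)]
    exact integral_congr_ae (Eventually.of_forall fun s => by simp [mul_comm])

end RatKhrushchev

end

/-! ### Boundary values of bounded analytic functions and of functions with positive real part. -/

noncomputable section

namespace RatKhrushchev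

/-- A sequence of radii increasing to `1`. -/
def radius (n : ℕ) : ℝ := 1 - 1 / ((n : ℝ) + 2)

theorem radius_pos (n : ℕ) : 0 < radius n := by
  have : 1 / ((n : ℝ) + 2) < 1 := by
    rw [div_lt_one (by positivity)]
    linarith [(n.cast_nonneg : (0 : ℝ) ≤ n)]
  unfold radius
  linarith

theorem radius_lt_one (n : ℕ) : radius n < 1 := by
  have : 0 < 1 / ((n : ℝ) + 2) := by positivity
  unfold radius
  linarith

theorem tendsto_radius : Tendsto radius atTop (𝓝 1) := by
  have h : Tendsto (fun n : ℕ => 1 / ((n : ℝ) + 2)) atTop (𝓝 0) := by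
    have := (tendsto_add_atTop_iff_nat 1).2 (tendsto_one_div_add_atTop_nhds_zero_nat (𝕜 := ℝ))
    refine this.congr fun n => ?_
    push_cast
    ring
  have h2 := h.const_sub 1
  rwa [sub_zero] at h2

theorem radius_mul_mem_ball (n : ℕ) {z : ℂ} (hz : ‖z‖ ≤ 1) :
    (radius n : ℂ) * z ∈ Metric.ball (0 : ℂ) 1 := by
  rw [mem_ball_zero_iff, norm_mul, Complex.norm_real, Real.norm_of_nonneg (radius_pos n).le]
  nlinarith [radius_pos n, radius_lt_one n, norm_nonneg z]

theorem diffContOnCl_dilate {f : ℂ → ℂ} (hf : DifferentiableOn ℂ f (Metric.ball 0 1)) (n : ℕ) :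
    DiffContOnCl ℂ (fun z => f (radius n * z)) (Metric.ball 0 1) := by
  apply DifferentiableOn.diffContOnCl
  rw [closure_ball _ one_ne_zero]
  refine hf.comp (by fun_prop) fun z hz => radius_mul_mem_ball n (by simpa using hz)

theorem continuous_dilate_cis {f : ℂ → ℂ} (hf : DifferentiableOn ℂ f (Metric.ball 0 1)) (n : ℕ) :
    Continuous fun s : ℝ => f (radius n * cis s) := by
  have h := hf.continuousOn.comp_continuous (f := fun s : ℝ => (radius n : ℂ) * cis s)
    (by fun_prop) fun s => radius_mul_mem_ball n (norm_cis s).le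
  exact h

/-- A bounded analytic function on the disk is the Poisson integral of an integrable function. -/
theorem exists_integrable_eq_integral_poissonKernel {f : ℂ → ℂ}
    (hf : DifferentiableOn ℂ f (Metric.ball 0 1)) (hb : ∀ w ∈ Metric.ball (0 : ℂ) 1, ‖f w‖ ≤ 1)
    (b : ℝ) :
    ∃ F : ℝ → ℂ, Integrable F (angleMeasure b) ∧ ∀ w : ℂ, ‖w‖ < 1 →
      ∫ s, poissonKernel 0 w (cis s) • F s ∂(angleMeasure b) = f w := by
  let H := Lp ℂ 2 (angleMeasure b)
  have hmem : ∀ n, MemLp (fun s : ℝ => f (radius n * cis s)) 2 (angleMeasure b) := fun n =>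
    MemLp.of_bound (continuous_dilate_cis hf n).aestronglyMeasurable 1
      (Eventually.of_forall fun s => hb _ (radius_mul_mem_ball n (norm_cis s).le))
  let G : ℕ → H := fun n => (hmem n).toLp
  obtain ⟨M, hM⟩ : ∃ M : ℝ, ∀ n, ‖G n‖ ≤ M := by
    refine ⟨_, fun n => Lp.norm_le_of_ae_bound (C := 1) zero_le_one ?_⟩
    filter_upwards [(hmem n).coeFn_toLp] with s hs
    rw [hs]
    exact hb _ (radius_mul_mem_ball n (norm_cis s).le)
  -- By Banach-Alaoglu the dilates `f(r_n ·)` have a weak limit in `L²`; a limit along an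
  -- ultrafilter makes extraction of a subsequence unnecessary.
  let T : ℕ → WeakDual ℂ H := fun n => StrongDual.toWeakDual (innerSL ℂ (G n))
  have hcomp := WeakDual.isCompact_closedBall (𝕜 := ℂ) (0 : StrongDual ℂ H) M
  obtain ⟨τ, -, hτ⟩ := hcomp.ultrafilter_le_nhds' ((hyperfilter ℕ).map T) (by
    refine Ultrafilter.mem_map.2 (Eventually.of_forall fun n => ?_)
    simp only [Set.mem_preimage, mem_closedBall_zero_iff]
    change ‖innerSL ℂ (G n)‖ ≤ M
    rw [innerSL_apply_norm]
    exact hM n)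
  have hτ' : Tendsto T (hyperfilter ℕ) (𝓝 τ) := hτ
  let F : H := (InnerProductSpace.toDual ℂ H).symm (WeakDual.toStrongDual τ)
  refine ⟨F, (Lp.memLp F).integrable (by norm_num), fun w hw => ?_⟩
  have hP : MemLp (fun s : ℝ => ((poissonKernel 0 w (cis s) : ℝ) : ℂ)) 2 (angleMeasure b) :=
    MemLp.of_bound (Complex.continuous_ofReal.comp
      (continuous_poissonKernel_cis hw)).aestronglyMeasurable (1 / (1 - ‖w‖) ^ 2)
      (Eventually.of_forall fun s => by
        rw [Complex.norm_real]; exact poissonKernel_cis_le hw s)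
  have hinner : ∀ g : H, inner ℂ g hP.toLp =
      conj (∫ s, poissonKernel 0 w (cis s) • g s ∂(angleMeasure b)) := fun g => by
    rw [L2.inner_def, ← integral_conj]
    refine integral_congr_ae ?_
    filter_upwards [hP.coeFn_toLp] with s hs
    rw [hs, RCLike.inner_apply]
    simp
  have h1 : Tendsto (fun n => T n hP.toLp) (hyperfilter ℕ) (𝓝 (τ hP.toLp)) :=
    ((WeakDual.eval_continuous (𝕜 := ℂ) hP.toLp).tendsto τ).comp hτ'
  -- Each dilate is continuous on the closed disk, so the Poisson formula holds for it; pairing with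
  -- the Poisson kernel, itself in `L²`, passes to the weak limit.
  have h2 : ∀ n, T n hP.toLp = conj (f (radius n * w)) := fun n => by
    change inner ℂ (G n) hP.toLp = _
    rw [hinner, ← integral_poissonKernel_smul b (diffContOnCl_dilate hf n) hw]
    congr 1
    refine integral_congr_ae ?_
    filter_upwards [(hmem n).coeFn_toLp] with s hs
    rw [hs]
  have h3 : τ hP.toLp = conj (∫ s, poissonKernel 0 w (cis s) • F s ∂(angleMeasure b)) := by
    rw [← hinner F]
    exact (InnerProductSpace.toDual_symm_apply (y := WeakDual.toStrongDual τ)).symm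
  have hwb : w ∈ Metric.ball (0 : ℂ) 1 := by simpa using hw
  have h4 : Tendsto (fun n => conj (f (radius n * w))) atTop (𝓝 (conj (f w))) := by
    have h5 : ContinuousAt f w := (hf.differentiableAt (Metric.isOpen_ball.mem_nhds hwb)).continuousAt
    have h6 : Tendsto (fun n => (radius n : ℂ) * w) atTop (𝓝 w) := by
      have := ((Complex.continuous_ofReal.tendsto 1).comp tendsto_radius).mul_const w
      simpa using this
    exact (Complex.continuous_conj.tendsto _).comp (h5.tendsto.comp h6)
  have h7 : Tendsto (fun n => T n hP.toLp) (hyperfilter ℕ) (𝓝 (conj (f w))) := by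
    simp only [h2]
    exact h4.mono_left (Nat.hyperfilter_le_atTop)
  have h8 := tendsto_nhds_unique h1 h7
  rw [h3] at h8
  exact (starRingEnd ℂ).injective h8

/-- Fatou's theorem for bounded analytic functions. -/
theorem ae_exists_tendsto_stolz {f : ℂ → ℂ} (hf : DifferentiableOn ℂ f (Metric.ball 0 1))
    (hb : ∀ w ∈ Metric.ball (0 : ℂ) 1, ‖f w‖ ≤ 1) (b : ℝ) :
    ∀ᵐ x ∂(angleMeasure b), ∃ g : ℂ, ∀ C : ℝ, 0 ≤ C → Tendsto f (stolz C (cis x)) (𝓝 g) := by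
  obtain ⟨F, hF, hFf⟩ := exists_integrable_eq_integral_poissonKernel hf hb b
  filter_upwards [ae_tendsto_integral_poissonKernel_smul hF] with x hx
  refine ⟨F x, fun C hC => (hx C hC).congr' ?_⟩
  filter_upwards [eventually_stolz_norm_lt C (cis x)] with w hw using hFf w hw

/-- An analytic function with real part at least `1` has finite boundary values. -/
theorem ae_not_tendsto_atTop_of_one_le_re {K : ℂ → ℂ}
    (hK : DifferentiableOn ℂ K (Metric.ball 0 1))
    (hre : ∀ w ∈ Metric.ball (0 : ℂ) 1, 1 ≤ (K w).re) (b : ℝ) :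
    ∀ᵐ x ∂(angleMeasure b), ¬ Tendsto (fun n => ‖K (radius n * cis x)‖) atTop atTop := by
  have hnorm : ∀ w ∈ Metric.ball (0 : ℂ) 1, 1 ≤ ‖K w‖ := fun w hw =>
    (hre w hw).trans (Complex.re_le_norm _)
  -- Since `Re K ≥ 1`, a branch of `log K` is analytic. Its real part `log ‖K‖ ≥ 0` has constant
  -- circular means, and Fatou's lemma makes its lower radial limit finite almost everywhere.
  have hlog : DifferentiableOn ℂ (fun w => Complex.log (K w)) (Metric.ball 0 1) :=
    hK.clog fun w hw => Or.inl (by linarith [hre w hw])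
  have hmean : ∀ n, ∫⁻ s, ENNReal.ofReal (Real.log ‖K (radius n * cis s)‖) ∂(angleMeasure b) =
      ENNReal.ofReal (Real.log ‖K 0‖) := fun n => by
    have h1 := integral_poissonKernel_smul b (diffContOnCl_dilate hlog n) (w := 0) (by simp)
    simp only [poissonKernel_def, sub_zero, norm_cis, norm_zero, mul_zero] at h1
    norm_num at h1
    have hint : Integrable (fun s => Complex.log (K (radius n * cis s))) (angleMeasure b) := by
      have hc := continuous_dilate_cis hlog n
      rw [angleMeasure]
      refine Integrable.smul_measure ?_ ENNReal.ofReal_ne_top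
      exact (hc.integrableOn_Icc).mono_set Set.Ioc_subset_Icc_self
    have h2 := congrArg Complex.re h1
    rw [← Complex.reCLM_apply, ← ContinuousLinearMap.integral_comp_comm _ hint] at h2
    simp only [Complex.reCLM_apply, Complex.log_re] at h2
    rw [← ofReal_integral_eq_lintegral_ofReal, h2]
    · have := hint.re
      simpa [Complex.log_re] using this
    · exact Eventually.of_forall fun s =>
        Real.log_nonneg (hnorm _ (radius_mul_mem_ball n (norm_cis s).le))
  have hmeas : ∀ n, Measurable fun s => ENNReal.ofReal (Real.log ‖K (radius n * cis s)‖) :=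
    fun n => (Real.measurable_log.comp
      (continuous_dilate_cis hK n).norm.measurable).ennreal_ofReal
  have hfatou := lintegral_liminf_le (μ := angleMeasure b) (u := atTop) hmeas
  simp only [hmean, liminf_const] at hfatou
  have hlim : Measurable fun s =>
      liminf (fun n => ENNReal.ofReal (Real.log ‖K (radius n * cis s)‖)) atTop := .liminf hmeas
  have hfin := ae_lt_top hlim (hfatou.trans_lt ENNReal.ofReal_lt_top).ne
  filter_upwards [hfin] with x hx ht
  have h3 : Tendsto (fun n => ENNReal.ofReal (Real.log ‖K (radius n * cis x)‖)) atTop (𝓝 ⊤) :=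
    ENNReal.tendsto_ofReal_atTop.comp (Real.tendsto_log_atTop.comp ht)
  rw [h3.liminf_eq] at hx
  exact lt_irrefl _ hx

end RatKhrushchev

end

/-! ### Cauchy integrals and the Cayley transform of a Herglotz transform. -/

noncomputable section

namespace RatKhrushchev

section CircleMeasure

variable {ν : Measure ℂ}

theorem ae_norm_eq_one (hν : ν (Metric.sphere 0 1)ᶜ = 0) : ∀ᵐ u ∂ν, ‖u‖ = 1 := by
  rw [ae_iff]
  convert hν using 2
  ext u
  simp

theorem integrable_of_continuousOn_sphere [IsFiniteMeasure ν] (hν : ν (Metric.sphere 0 1)ᶜ = 0)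
    {E : Type*} [NormedAddCommGroup E] {q : ℂ → E}
    (hq : ContinuousOn q (Metric.sphere 0 1)) : Integrable q ν := by
  have h := hq.integrableOn_compact (μ := ν) (isCompact_sphere 0 1)
  rwa [IntegrableOn, Measure.restrict_eq_self_of_ae_mem] at h
  filter_upwards [ae_norm_eq_one hν] with u hu
  simpa using hu

theorem sub_ne_zero_of_norm {u w : ℂ} (hu : ‖u‖ = 1) (hw : ‖w‖ < 1) : u - w ≠ 0 := by
  intro h
  rw [sub_eq_zero] at h
  rw [h] at hu
  linarith

theorem continuousOn_div_sub {q : ℂ → ℂ} (hq : ContinuousOn q (Metric.sphere 0 1)) {w : ℂ}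
    (hw : ‖w‖ < 1) : ContinuousOn (fun u => q u / (u - w)) (Metric.sphere 0 1) :=
  hq.div (by fun_prop) fun _ hu => sub_ne_zero_of_norm (by simpa using hu) hw

theorem differentiableOn_integral_div_sub [IsFiniteMeasure ν] (hν : ν (Metric.sphere 0 1)ᶜ = 0)
    {q : ℂ → ℂ} (hq : ContinuousOn q (Metric.sphere 0 1)) :
    DifferentiableOn ℂ (fun w => ∫ u, q u / (u - w) ∂ν) (Metric.ball 0 1) := by
  intro w₀ hw₀
  rw [mem_ball_zero_iff] at hw₀
  -- Half of the distance to the circle: on the ball of this radius all denominators stay above `δ`,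
  -- which gives a dominating function.
  set δ := (1 - ‖w₀‖) / 2 with hδ
  have hδ0 : 0 < δ := by rw [hδ]; linarith
  have hball : ∀ w ∈ Metric.ball w₀ δ, ‖w‖ < 1 ∧ ∀ u : ℂ, ‖u‖ = 1 → δ ≤ ‖u - w‖ := by
    intro w hw
    rw [mem_ball_iff_norm] at hw
    have h1 := norm_sub_norm_le w w₀
    have h2 : ‖w‖ < 1 - δ := by rw [hδ] at hw ⊢; linarith
    refine ⟨by linarith, fun u hu => ?_⟩
    have h3 := norm_sub_norm_le u w
    rw [hu] at h3
    linarith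
  have hd := hasDerivAt_integral_of_dominated_loc_of_deriv_le (μ := ν) (𝕜 := ℂ)
    (F := fun w u => q u / (u - w)) (F' := fun w u => q u / (u - w) ^ 2) (x₀ := w₀)
    (s := Metric.ball w₀ δ) (bound := fun u => ‖q u‖ / δ ^ 2) (Metric.ball_mem_nhds _ hδ0)
    (by
      filter_upwards [Metric.ball_mem_nhds w₀ hδ0] with w hw
      exact (integrable_of_continuousOn_sphere hν
        (continuousOn_div_sub hq (hball w hw).1)).aestronglyMeasurable)
    (integrable_of_continuousOn_sphere hν (continuousOn_div_sub hq hw₀))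
    (integrable_of_continuousOn_sphere hν (hq.div (by fun_prop) fun u hu =>
      pow_ne_zero 2 (sub_ne_zero_of_norm (by simpa using hu) hw₀))).aestronglyMeasurable
    (by
      filter_upwards [ae_norm_eq_one hν] with u hu w hw
      rw [norm_div, norm_pow]
      have := (hball w hw).2 u hu
      gcongr)
    (integrable_of_continuousOn_sphere hν (hq.norm.div_const _))
    (by
      filter_upwards [ae_norm_eq_one hν] with u hu w hw
      exact ((hasDerivAt_const w (q u)).div ((hasDerivAt_id w).const_sub u)
        (sub_ne_zero_of_norm hu (hball w hw).1)).congr_deriv (by simp))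
  exact hd.2.differentiableAt.differentiableWithinAt

end CircleMeasure

/-- The Herglotz transform of a measure on the angles. -/
def herglotz (ν : Measure ℝ) (w : ℂ) : ℂ :=
  ∫ s, (cis s + w) / (cis s - w) ∂ν

theorem herglotz_kernel_re {w : ℂ} (s : ℝ) :
    ((cis s + w) / (cis s - w)).re = poissonKernel 0 w (cis s) := by
  rw [poissonKernel_eq_re_herglotzRieszKernel]
  simp [herglotzRieszKernel_def]

section

variable {ν : Measure ℝ} [IsProbabilityMeasure ν]

theorem integrable_herglotz_kernel {w : ℂ} (hw : ‖w‖ < 1) :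
    Integrable (fun s => (cis s + w) / (cis s - w)) ν := by
  have hc : Continuous fun s => (cis s + w) / (cis s - w) :=
    Continuous.div (by fun_prop) (by fun_prop) fun s => sub_ne_zero_of_norm (norm_cis s) hw
  refine Integrable.of_bound hc.aestronglyMeasurable (2 / (1 - ‖w‖))
    (Eventually.of_forall fun s => ?_)
  rw [norm_div]
  have h1 := norm_sub_norm_le (cis s) w
  have h2 := norm_add_le (cis s) w
  rw [norm_cis] at h1 h2
  exact div_le_div₀ zero_le_two (by linarith) (by linarith) h1

theorem herglotz_re {w : ℂ} (hw : ‖w‖ < 1) :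
    (herglotz ν w).re = ∫ s, poissonKernel 0 w (cis s) ∂ν := by
  rw [herglotz, ← Complex.reCLM_apply,
    ← ContinuousLinearMap.integral_comp_comm _ (integrable_herglotz_kernel hw)]
  simp only [Complex.reCLM_apply, herglotz_kernel_re]

theorem herglotz_re_nonneg {w : ℂ} (hw : ‖w‖ < 1) : 0 ≤ (herglotz ν w).re := by
  rw [herglotz_re hw]
  exact integral_nonneg fun s => poissonKernel_nonneg hw s

theorem herglotz_add_one_ne_zero {w : ℂ} (hw : ‖w‖ < 1) : herglotz ν w + 1 ≠ 0 := by
  intro h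
  have h1 := congrArg Complex.re h
  have h2 := herglotz_re_nonneg (ν := ν) hw
  simp at h1
  linarith

/-- The kernel `(u + w) / (u - w) = 1 + 2w / (u - w)` reduces the claim to a Cauchy integral. -/
theorem differentiableOn_herglotz : DifferentiableOn ℂ (herglotz ν) (Metric.ball 0 1) := by
  have hsph : (ν.map cis) (Metric.sphere 0 1)ᶜ = 0 := by
    rw [Measure.map_apply continuous_cis.measurable Metric.isClosed_sphere.measurableSet.compl]
    convert measure_empty (μ := ν)
    ext s
    simp [norm_cis]
  have : IsProbabilityMeasure (ν.map cis) :=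
    Measure.isProbabilityMeasure_map continuous_cis.aemeasurable
  have h := differentiableOn_integral_div_sub hsph (q := fun _ => 1) continuousOn_const
  have h2 : DifferentiableOn ℂ (fun w => 1 + 2 * w * ∫ u, 1 / (u - w) ∂(ν.map cis))
      (Metric.ball 0 1) := (differentiableOn_const _).add ((by fun_prop : DifferentiableOn ℂ
        (fun w : ℂ => 2 * w) (Metric.ball 0 1)).mul h)
  refine h2.congr fun w hw => ?_
  rw [mem_ball_zero_iff] at hw
  have hi := integrable_of_continuousOn_sphere hsph (continuousOn_div_sub continuousOn_const hw)
    (q := fun u => (1 : ℂ) / (u - w))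
  rw [integral_map continuous_cis.aemeasurable hi.aestronglyMeasurable, ← integral_const_mul]
  have hi2 : Integrable (fun s => 2 * w * (1 / (cis s - w))) ν :=
    ((integrable_map_measure hi.aestronglyMeasurable continuous_cis.aemeasurable).1 hi).const_mul _
  have h3 : (1 : ℂ) = ∫ _, (1 : ℂ) ∂ν := by simp
  nth_rw 1 [h3]
  rw [herglotz, ← integral_add (integrable_const _) hi2]
  refine integral_congr_ae (Eventually.of_forall fun s => ?_)
  have := sub_ne_zero_of_norm (norm_cis s) hw
  field_simp
  ring

theorem norm_sub_one_le_norm_add_one {z : ℂ} (hz : 0 ≤ z.re) : ‖z - 1‖ ≤ ‖z + 1‖ := by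
  rw [← sq_le_sq₀ (norm_nonneg _) (norm_nonneg _), ← Complex.normSq_eq_norm_sq,
    ← Complex.normSq_eq_norm_sq, Complex.normSq_apply, Complex.normSq_apply]
  simp
  nlinarith

theorem tendsto_radius_stolz (x : ℝ) :
    Tendsto (fun n => (radius n : ℂ) * cis x) atTop (stolz 1 (cis x)) := by
  refine tendsto_nhdsWithin_iff.2 ⟨?_, Eventually.of_forall fun n => ?_⟩
  · have := ((Complex.continuous_ofReal.tendsto 1).comp tendsto_radius).mul_const (cis x)
    simpa using this
  · have h1 : ‖(radius n : ℂ) * cis x‖ = radius n := by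
      rw [norm_mul, norm_cis, mul_one, Complex.norm_real, Real.norm_of_nonneg (radius_pos n).le]
    refine ⟨by rw [h1]; exact radius_lt_one n, ?_⟩
    rw [h1, one_mul, show (radius n : ℂ) * cis x - cis x = ((radius n - 1 : ℝ) : ℂ) * cis x by
      push_cast; ring, norm_mul, norm_cis, mul_one, Complex.norm_real, Real.norm_eq_abs, abs_sub_comm,
      abs_of_pos (by linarith [radius_lt_one n])]

/-- Nontangential boundary values of the Cayley transform of a Herglotz transform. -/
theorem ae_exists_tendsto_cayley_herglotz {b : ℝ} (hν : ν (Set.Ioc b (b + 2 * Real.pi))ᶜ = 0) :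
    ∀ᵐ x ∂(angleMeasure b), ∃ g : ℂ, g ≠ 1 ∧
      (∀ C : ℝ, 0 ≤ C → Tendsto (fun w => (herglotz ν w - 1) / (herglotz ν w + 1))
        (stolz C (cis x)) (𝓝 g)) ∧
      (ν.rnDeriv (angleMeasure b) x).toReal * ‖1 - g‖ ^ 2 = 1 - ‖g‖ ^ 2 := by
  have hF := differentiableOn_herglotz (ν := ν)
  have hG : DifferentiableOn ℂ (fun w => (herglotz ν w - 1) / (herglotz ν w + 1))
      (Metric.ball 0 1) :=
    (hF.sub_const 1).div (hF.add_const 1) fun w hw => herglotz_add_one_ne_zero (by simpa using hw)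
  have hGb : ∀ w ∈ Metric.ball (0 : ℂ) 1, ‖(herglotz ν w - 1) / (herglotz ν w + 1)‖ ≤ 1 := by
    intro w hw
    rw [norm_div]
    exact div_le_one_of_le₀
      (norm_sub_one_le_norm_add_one (herglotz_re_nonneg (by simpa using hw))) (norm_nonneg _)
  have hK := ae_not_tendsto_atTop_of_one_le_re (hF.add_const 1) (fun w hw => by
    have := herglotz_re_nonneg (ν := ν) (w := w) (by simpa using hw)
    simpa using this) b
  filter_upwards [ae_exists_tendsto_stolz hG hGb b, hK,
    ae_tendsto_integral_poissonKernel_rnDeriv ν hν] with x hx hKx hP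
  obtain ⟨g, hg⟩ := hx
  have hsub : ∀ w : ℂ, ‖w‖ < 1 → 1 - (herglotz ν w - 1) / (herglotz ν w + 1) =
      2 / (herglotz ν w + 1) := fun w hw => by
    have := herglotz_add_one_ne_zero (ν := ν) hw
    field_simp
    ring
  -- As `1 - (F - 1) / (F + 1) = 2 / (F + 1)`, the limit `1` would force `‖F + 1‖ → ∞` along the
  -- radius.
  have hg1 : g ≠ 1 := by
    rintro rfl
    apply hKx
    have h1 := ((hg 1 zero_le_one).comp (tendsto_radius_stolz x)).const_sub 1
    rw [sub_self] at h1
    have h2 : Tendsto (fun n => ‖1 - (herglotz ν (radius n * cis x) - 1) /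
        (herglotz ν (radius n * cis x) + 1)‖) atTop (𝓝[>] 0) := by
      refine tendsto_nhdsWithin_iff.2 ⟨by simpa using h1.norm, Eventually.of_forall fun n => ?_⟩
      have hn : ‖(radius n : ℂ) * cis x‖ < 1 := by
        simpa using radius_mul_mem_ball n (norm_cis x).le
      rw [hsub _ hn]
      have := herglotz_add_one_ne_zero (ν := ν) hn
      simpa using this
    have h3 := (tendsto_inv_nhdsGT_zero.comp h2).const_mul_atTop (zero_lt_two (α := ℝ))
    refine h3.congr fun n => ?_
    have hn : ‖(radius n : ℂ) * cis x‖ < 1 := by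
      simpa using radius_mul_mem_ball n (norm_cis x).le
    simp only [Function.comp]
    rw [hsub _ hn, norm_div, inv_div]
    simp
    ring
  refine ⟨g, hg1, hg, ?_⟩
  have hg1' : 1 - g ≠ 0 := sub_ne_zero.2 hg1.symm
  -- The limit of `Re F` is computed twice: as `Re ((1 + g) / (1 - g))` by inverting the Cayley
  -- transform, and as the density by Fatou's theorem.
  have hlim : Tendsto (fun w => (herglotz ν w).re) (stolz 1 (cis x)) (𝓝 ((1 + g) / (1 - g)).re) := by
    have h1 := ((hg 1 zero_le_one).const_add 1).div ((hg 1 zero_le_one).const_sub 1) hg1'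
    refine ((Complex.continuous_re.tendsto _).comp h1).congr' ?_
    filter_upwards [eventually_stolz_norm_lt 1 (cis x)] with w hw
    simp only [Function.comp, Pi.div_apply]
    congr 1
    rw [hsub w hw]
    have := herglotz_add_one_ne_zero (ν := ν) hw
    field_simp
    ring
  have hlim2 : Tendsto (fun w => (herglotz ν w).re) (stolz 1 (cis x))
      (𝓝 (ν.rnDeriv (angleMeasure b) x).toReal) := by
    refine (hP 1 zero_le_one).congr' ?_
    filter_upwards [eventually_stolz_norm_lt 1 (cis x)] with w hw using (herglotz_re hw).symm
  have hne : (stolz 1 (cis x)).NeBot := (tendsto_radius_stolz x).neBot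
  rw [tendsto_nhds_unique hlim2 hlim]
  have h5 : ((1 + g) / (1 - g)).re = (1 - ‖g‖ ^ 2) / ‖1 - g‖ ^ 2 := by
    have := poissonKernel_eq_re_herglotzRieszKernel (c := 0) (w := g)
    have h6 := congrFun this 1
    simpa [poissonKernel_def, herglotzRieszKernel_def] using h6.symm
  rw [h5]
  have : ‖1 - g‖ ≠ 0 := norm_ne_zero_iff.2 hg1'
  field_simp

end

end RatKhrushchev

end

noncomputable section

namespace RatKhrushchev

/-! ### Blaschke factors of the disk -/

/-- The denominator `1 - conj a * u` of a Blaschke factor. -/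
def vp (a u : ℂ) : ℂ := 1 - conj a * u

/-- The normalized Blaschke factor of the unit disk with zero `a`. -/
def bf (a u : ℂ) : ℂ := zfac .disk a * ((u - a) / vp a u)

/-- Finite Blaschke products. -/
def bp (a : ℕ → ℂ) (n : ℕ) (u : ℂ) : ℂ := ∏ j ∈ Finset.Ioc 0 n, bf (a j) u

/-- Linear combinations of the Blaschke products `B_0, …, B_n`. -/
def cb (a : ℕ → ℂ) (n : ℕ) (c : ℕ → ℂ) (u : ℂ) : ℂ := ∑ k ∈ Finset.range (n + 1), c k * bp a k u

/-- The reversed combination `B_n (cb a n c)_*`. -/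
def cbs (a : ℕ → ℂ) (n : ℕ) (c : ℕ → ℂ) (u : ℂ) : ℂ :=
  ∑ k ∈ Finset.range (n + 1), conj (c k) * ∏ j ∈ Finset.Ioc k n, bf (a j) u

/-- On the closed disk, `g` is a linear combination of `B_0, …, B_{n-1}`. -/
def Lsp (a : ℕ → ℂ) (n : ℕ) (g : ℂ → ℂ) : Prop :=
  ∃ c : ℕ → ℂ, ∀ u : ℂ, ‖u‖ ≤ 1 → g u = ∑ k ∈ Finset.range n, c k * bp a k u

theorem vp_ne_zero {a u : ℂ} (ha : ‖a‖ < 1) (hu : ‖u‖ ≤ 1) : vp a u ≠ 0 := by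
  intro h
  have h1 : conj a * u = 1 := (sub_eq_zero.1 h).symm
  have h2 := congrArg norm h1
  rw [norm_mul, RCLike.norm_conj, norm_one] at h2
  nlinarith [norm_nonneg a, norm_nonneg u]

theorem zfac_disk_mul_conj {a : ℂ} (ha : ‖a‖ < 1) :
    zfac .disk a * conj (zfac .disk a) = 1 := zfac_mul_conj .disk ha

theorem zfac_disk_ne_zero {a : ℂ} (ha : ‖a‖ < 1) : zfac .disk a ≠ 0 := by
  intro h
  have := zfac_disk_mul_conj ha
  simp [h] at this

theorem norm_zfac_disk {a : ℂ} (ha : ‖a‖ < 1) : ‖zfac .disk a‖ = 1 := by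
  have h := zfac_disk_mul_conj ha
  rw [Complex.mul_conj, Complex.normSq_eq_norm_sq] at h
  have h2 : ‖zfac .disk a‖ ^ 2 = 1 := by exact_mod_cast h
  nlinarith [norm_nonneg (zfac .disk a)]

theorem one_sub_norm_sq_ne_zero {a : ℂ} (ha : ‖a‖ < 1) : (1 : ℂ) - conj a * a ≠ 0 :=
  vp_ne_zero ha ha.le

theorem conj_vp_of_norm_eq_one {a u : ℂ} (hu : ‖u‖ = 1) : conj (vp a u) = (u - a) * conj u := by
  have h : u * conj u = 1 := by
    rw [Complex.mul_conj, Complex.normSq_eq_norm_sq, hu]; simp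
  simp only [vp, map_sub, map_one, map_mul, Complex.conj_conj]
  linear_combination -h

theorem mul_conj_of_norm_eq_one {u : ℂ} (hu : ‖u‖ = 1) : u * conj u = 1 := by
  rw [Complex.mul_conj, Complex.normSq_eq_norm_sq, hu]; simp

theorem norm_bf_of_norm_eq_one {a u : ℂ} (ha : ‖a‖ < 1) (hu : ‖u‖ = 1) : ‖bf a u‖ = 1 := by
  have h1 : ‖vp a u‖ = ‖u - a‖ := by
    rw [← RCLike.norm_conj (vp a u), conj_vp_of_norm_eq_one hu, norm_mul, RCLike.norm_conj, hu,
      mul_one]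
  rw [bf, norm_mul, norm_zfac_disk ha, one_mul, norm_div, h1, div_self]
  rw [← h1]
  exact norm_ne_zero_iff.2 (vp_ne_zero ha hu.le)

theorem bf_mul_conj {a u : ℂ} (ha : ‖a‖ < 1) (hu : ‖u‖ = 1) : bf a u * conj (bf a u) = 1 :=
  mul_conj_of_norm_eq_one (norm_bf_of_norm_eq_one ha hu)

theorem bf_self (a : ℂ) : bf a a = 0 := by simp [bf]

theorem bf_zero (u : ℂ) : bf 0 u = u := by simp [bf, vp, zfac, base]

theorem differentiableOn_bf {a : ℂ} (ha : ‖a‖ < 1) :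
    DifferentiableOn ℂ (bf a) (Metric.ball 0 1) := by
  unfold bf vp
  refine (DifferentiableOn.div (by fun_prop) (by fun_prop) fun u hu => ?_).const_mul _
  exact vp_ne_zero ha (by simpa using (mem_ball_zero_iff.1 hu).le)

theorem continuousOn_bf {a : ℂ} (ha : ‖a‖ < 1) :
    ContinuousOn (bf a) (Metric.closedBall 0 1) := by
  unfold bf vp
  refine continuousOn_const.mul (ContinuousOn.div (by fun_prop) (by fun_prop) fun u hu => ?_)
  exact vp_ne_zero ha (by simpa using hu)

/-- Affine functions over the denominator of a Blaschke factor. -/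
theorem affine_div_vp {b : ℂ} (hb : ‖b‖ < 1) (α β : ℂ) {u : ℂ} (hu : ‖u‖ ≤ 1) :
    (α + β * u) / vp b u = (α + β * b) / (1 - conj b * b) +
      (β + conj b * ((α + β * b) / (1 - conj b * b))) * conj (zfac .disk b) * bf b u := by
  have h1 := vp_ne_zero hb hu
  have h2 := one_sub_norm_sq_ne_zero hb
  have h3 := zfac_disk_mul_conj hb
  have hP := div_mul_cancel₀ (α + β * b) h2
  set P := (α + β * b) / (1 - conj b * b)
  rw [div_eq_iff h1]
  have h4 : bf b u * vp b u = zfac .disk b * (u - b) := by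
    rw [bf, mul_assoc, div_mul_cancel₀ _ h1]
  rw [add_mul, mul_assoc _ (bf b u), h4]
  unfold vp
  linear_combination -hP - (β + conj b * P) * (u - b) * h3

/-- `ζ_b - ζ_b(a)` vanishes at `a`. Its quotient by `ζ_a` is a multiple of `vp a / vp b`, an affine
function over `vp b`, hence in the span of `1` and `ζ_b`. The identity trades `ζ_b` against `ζ_a` in
products of Blaschke factors. -/
theorem exists_bf_eq {a b : ℂ} (ha : ‖a‖ < 1) (hb : ‖b‖ < 1) :
    ∃ A p q : ℂ, ∀ u : ℂ, ‖u‖ ≤ 1 → bf b u = A + bf a u * (p + q * bf b u) := by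
  have hz := zfac_disk_mul_conj ha
  -- The constant in `ζ_b(u) - ζ_b(a) = κ ζ_a(u) vp a u / vp b u`.
  set κ := conj (zfac .disk a) * zfac .disk b * (1 - conj b * b) / vp b a
  refine ⟨bf b a, (κ + -conj a * κ * b) / (1 - conj b * b), (-conj a * κ + conj b *
    ((κ + -conj a * κ * b) / (1 - conj b * b))) * conj (zfac .disk b), fun u hu => ?_⟩
  · have h := affine_div_vp hb κ (-conj a * κ) hu
    rw [← h]
    have h1 := vp_ne_zero hb hu
    have h2 := vp_ne_zero ha hu
    have h3 := vp_ne_zero hb ha.le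
    rw [show κ + -conj a * κ * u = κ * vp a u by unfold vp; ring]
    have h4 : bf a u * (κ * vp a u / vp b u) =
        (zfac .disk a * conj (zfac .disk a)) * (zfac .disk b * (1 - conj b * b) * (u - a) /
          (vp b a * vp b u)) := by
      unfold bf
      simp only [κ]
      field_simp
    rw [h4, hz, one_mul]
    unfold bf
    field_simp
    unfold vp
    ring

/-! ### The spaces spanned by Blaschke products -/

section Lsp

variable {a : ℕ → ℂ}

theorem Lsp.add {n : ℕ} {g h : ℂ → ℂ} (hg : Lsp a n g) (hh : Lsp a n h) :
    Lsp a n fun u => g u + h u := by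
  obtain ⟨c, hc⟩ := hg
  obtain ⟨d, hd⟩ := hh
  exact ⟨c + d, fun u hu => by
    simp only [hc u hu, hd u hu, Pi.add_apply, add_mul, Finset.sum_add_distrib]⟩

theorem Lsp.const_mul {n : ℕ} {g : ℂ → ℂ} (hg : Lsp a n g) (r : ℂ) : Lsp a n fun u => r * g u := by
  obtain ⟨c, hc⟩ := hg
  exact ⟨fun k => r * c k, fun u hu => by simp only [hc u hu, Finset.mul_sum, mul_assoc]⟩

theorem Lsp.congr {n : ℕ} {g h : ℂ → ℂ} (hg : Lsp a n g) (hgh : ∀ u, ‖u‖ ≤ 1 → h u = g u) :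
    Lsp a n h := by
  obtain ⟨c, hc⟩ := hg
  exact ⟨c, fun u hu => (hgh u hu).trans (hc u hu)⟩

theorem Lsp.zero (n : ℕ) : Lsp a n fun _ => 0 := ⟨0, fun u _ => by simp⟩

theorem Lsp.mono {m n : ℕ} (hmn : m ≤ n) {g : ℂ → ℂ} (hg : Lsp a m g) : Lsp a n g := by
  obtain ⟨c, hc⟩ := hg
  refine ⟨fun k => if k < m then c k else 0, fun u hu => ?_⟩
  rw [hc u hu, ← Finset.sum_subset (Finset.range_mono hmn)]
  · exact Finset.sum_congr rfl fun k hk => by simp [Finset.mem_range.1 hk]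
  · intro k _ hk
    rw [Finset.mem_range, not_lt] at hk
    simp [hk.not_gt]

theorem Lsp.bp {k n : ℕ} (hk : k < n) : Lsp a n (bp a k) :=
  ⟨Pi.single k 1, fun u _ => by
    rw [Finset.sum_eq_single_of_mem k (Finset.mem_range.2 hk)]
    · simp
    · intro j _ hj
      simp [Pi.single_eq_of_ne hj]⟩

theorem Lsp.cb (n : ℕ) (c : ℕ → ℂ) : Lsp a (n + 1) (cb a n c) := ⟨c, fun _ _ => rfl⟩

theorem Lsp.sum {n : ℕ} {ι : Type*} (s : Finset ι) {g : ι → ℂ → ℂ} (hg : ∀ i ∈ s, Lsp a n (g i)) :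
    Lsp a n fun u => ∑ i ∈ s, g i u := by
  classical
  induction s using Finset.induction_on with
  | empty => simpa using Lsp.zero n
  | insert i s hi ih =>
    simp only [Finset.sum_insert hi]
    exact (hg i (Finset.mem_insert_self i s)).add
      (ih fun j hj => hg j (Finset.mem_insert_of_mem hj))

/-- Linear operations that respect the generators. -/
theorem Lsp.mul_of_forall {m n : ℕ} {g h : ℂ → ℂ} (hg : Lsp a m g)
    (hh : ∀ k < m, Lsp a n fun u => h u * RatKhrushchev.bp a k u) : Lsp a n fun u => h u * g u := by
  obtain ⟨c, hc⟩ := hg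
  refine (Lsp.sum (Finset.range m) fun k hk =>
    (hh k (Finset.mem_range.1 hk)).const_mul (c k)).congr fun u hu => ?_
  rw [hc u hu, Finset.mul_sum]
  exact Finset.sum_congr rfl fun k _ => by ring

theorem bp_succ (n : ℕ) (u : ℂ) : bp a (n + 1) u = bp a n u * bf (a (n + 1)) u := by
  simp [RatKhrushchev.bp, Finset.prod_Ioc_succ_top]

theorem bp_zero (u : ℂ) : bp a 0 u = 1 := by simp [RatKhrushchev.bp]

variable (ha : ∀ k, ‖a k‖ < 1)
include ha

/-- Descending induction on `k`. At the top, `ζ_n B_{n-1} = B_n`; below it, `exists_bf_eq` writes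
`ζ_n B_j` through `B_j`, `B_{j+1}` and `ζ_n B_{j+1}`. -/
theorem Lsp.bf_mul_bp {n k : ℕ} (hk : k < n) :
    Lsp a (n + 1) fun u => bf (a n) u * RatKhrushchev.bp a k u := by
  obtain ⟨m, rfl⟩ : ∃ m, n = m + 1 := ⟨n - 1, by omega⟩
  refine Nat.decreasingInduction' (m := k) (n := m)
    (P := fun k => Lsp a (m + 1 + 1) fun u => bf (a (m + 1)) u * RatKhrushchev.bp a k u)
    (fun j hj _ ih => ?_) (by omega) ?_
  · obtain ⟨A, p, q, h⟩ := exists_bf_eq (ha (j + 1)) (ha (m + 1))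
    refine (((Lsp.bp (k := j) (by omega)).const_mul A).add
      (((Lsp.bp (k := j + 1) (by omega)).const_mul p).add (ih.const_mul q))).congr fun u hu => ?_
    rw [bp_succ]
    linear_combination RatKhrushchev.bp a j u * h u hu
  · refine (Lsp.bp (k := m + 1) (by omega)).congr fun u _ => ?_
    rw [bp_succ, mul_comm]

end Lsp

end RatKhrushchev

end

/-! ### Reversal, divided differences and the zeros of elements of the span. -/

noncomputable section

namespace RatKhrushchev

section Lsp

variable {a : ℕ → ℂ} (ha : ∀ k, ‖a k‖ < 1)
include ha

theorem Lsp.bf_mul {n : ℕ} {g : ℂ → ℂ} (hg : Lsp a n g) :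
    Lsp a (n + 1) fun u => bf (a n) u * g u :=
  hg.mul_of_forall fun _ hk => Lsp.bf_mul_bp ha hk

theorem Lsp.affine_div_mul {n : ℕ} {g : ℂ → ℂ} (hg : Lsp a n g) (α β : ℂ) :
    Lsp a (n + 1) fun u => (α + β * u) / vp (a n) u * g u := by
  refine ((hg.mono n.le_succ).const_mul ((α + β * a n) / (1 - conj (a n) * a n))).add
    ((hg.bf_mul ha).const_mul ((β + conj (a n) * ((α + β * a n) / (1 - conj (a n) * a n))) *
      conj (zfac .disk (a n)))) |>.congr fun u hu => ?_
  rw [affine_div_vp (ha n) α β hu]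
  ring

/-- The products of trailing factors are the building blocks of `Φ^*`, which is why reversal stays
in the span. -/
theorem Lsp.prod_Ioc (k n : ℕ) : Lsp a (n + 1) fun u => ∏ j ∈ Finset.Ioc k n, bf (a j) u := by
  rcases le_or_gt n k with h | h
  · rw [Finset.Ioc_eq_empty (by omega)]
    simpa using (Lsp.bp (a := a) (k := 0) (n := n + 1) (by omega)).congr (h := fun _ => 1)
      fun u _ => (bp_zero u).symm
  · induction n, h using Nat.le_induction with
    | base =>
      refine ((Lsp.bp (a := a) (k := 0) (n := k + 1) (by omega)).bf_mul ha).congr fun u _ => ?_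
      rw [bp_zero, mul_one, Nat.succ_eq_add_one, Nat.Ioc_succ_singleton, Finset.prod_singleton]
    | succ n hn ih =>
      refine (ih.bf_mul ha).congr fun u _ => ?_
      rw [Finset.prod_Ioc_succ_top (by omega), mul_comm]

theorem Lsp.cbs (n : ℕ) (c : ℕ → ℂ) : Lsp a (n + 1) (cbs a n c) :=
  Lsp.sum _ fun k _ => (Lsp.prod_Ioc ha k n).const_mul _

theorem bp_mul_conj {u : ℂ} (hu : ‖u‖ = 1) (n : ℕ) : bp a n u * conj (bp a n u) = 1 := by
  rw [bp, map_prod, ← Finset.prod_mul_distrib]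
  exact Finset.prod_eq_one fun j _ => bf_mul_conj (ha j) hu

theorem norm_bp {u : ℂ} (hu : ‖u‖ = 1) (n : ℕ) : ‖bp a n u‖ = 1 := by
  rw [bp, norm_prod]
  exact Finset.prod_eq_one fun j _ => norm_bf_of_norm_eq_one (ha j) hu

theorem cbs_eq_of_norm_eq_one {u : ℂ} (hu : ‖u‖ = 1) (n : ℕ) (c : ℕ → ℂ) :
    RatKhrushchev.cbs a n c u = bp a n u * conj (cb a n c u) := by
  simp only [RatKhrushchev.cbs, RatKhrushchev.cb, map_sum, Finset.mul_sum]
  refine Finset.sum_congr rfl fun k hk => ?_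
  have hk' : k ≤ n := Nat.lt_succ_iff.1 (Finset.mem_range.1 hk)
  have h1 : bp a n u = bp a k u * ∏ j ∈ Finset.Ioc k n, bf (a j) u :=
    (Finset.prod_Ioc_consecutive _ (Nat.zero_le k) hk').symm
  rw [map_mul, h1]
  linear_combination (-(conj (c k)) * ∏ j ∈ Finset.Ioc k n, bf (a j) u) * bp_mul_conj ha hu k

/-- Multiplication by `B_{n-1}` maps the conjugates of the span of `B_0, …, B_{n-1}` into it. -/
theorem Lsp.exists_star {n : ℕ} {g : ℂ → ℂ} (hg : Lsp a n g) :
    ∃ h, Lsp a n h ∧ ∀ u, ‖u‖ = 1 → bf (a n) u * conj (RatKhrushchev.bp a n u) * g u = conj (h u) := by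
  obtain ⟨c, hc⟩ := hg
  rcases n with _ | m
  · exact ⟨fun _ => 0, Lsp.zero 0, fun u hu => by simp [hc u hu.le]⟩
  · refine ⟨RatKhrushchev.cbs a m c, Lsp.cbs ha m c, fun u hu => ?_⟩
    rw [cbs_eq_of_norm_eq_one ha hu, hc u hu.le, bp_succ, map_mul, map_mul, Complex.conj_conj]
    change _ * RatKhrushchev.cb a m c u = _
    linear_combination (conj (RatKhrushchev.bp a m u) * RatKhrushchev.cb a m c u) * bf_mul_conj (ha (m + 1)) hu

/-- Divided differences of Blaschke products. -/
theorem exists_bp_eq_add {b : ℂ} (hb : ‖b‖ < 1) (k : ℕ) :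
    ∃ r, Lsp a (k + 1) r ∧ ∀ u, ‖u‖ ≤ 1 → bp a k u = bp a k b + (u - b) * r u := by
  induction k with
  | zero => exact ⟨fun _ => 0, Lsp.zero _, fun u _ => by simp [bp_zero]⟩
  | succ k ih =>
    obtain ⟨r, hr, h⟩ := ih
    set A := a (k + 1) with hA
    have hAn : ‖A‖ < 1 := ha _
    refine ⟨fun u => zfac .disk A * (1 - conj A * A) / vp A b * ((1 + 0 * u) / vp A u * bp a k u) +
      bf A b * r u, (((Lsp.bp (Nat.lt_succ_self k)).affine_div_mul ha 1 0).const_mul _).add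
        ((hr.mono (Nat.le_succ _)).const_mul _), fun u hu => ?_⟩
    have h1 := vp_ne_zero hAn hu
    have h2 := vp_ne_zero hAn hb.le
    have h3 : bf A u - bf A b =
        (u - b) * (zfac .disk A * (1 - conj A * A) / vp A b * ((1 + 0 * u) / vp A u)) := by
      unfold bf
      field_simp
      unfold vp
      ring
    rw [bp_succ, bp_succ, ← hA]
    linear_combination bf A b * h u hu + bp a k u * h3

theorem exists_affine_mul_bp_eq_add {b : ℂ} (hb : ‖b‖ < 1) (α β : ℂ) (k : ℕ) :
    ∃ r, Lsp a (k + 1) r ∧ ∀ u, ‖u‖ ≤ 1 →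
      (α + β * u) * bp a k u = (α + β * b) * bp a k b + (u - b) * r u := by
  obtain ⟨r, hr, h⟩ := exists_bp_eq_add ha hb k
  refine ⟨fun u => β * bp a k u + (α + β * b) * r u,
    ((Lsp.bp (Nat.lt_succ_self k)).const_mul _).add (hr.const_mul _), fun u hu => ?_⟩
  linear_combination (α + β * b) * h u hu

/-- The gain is that `r` lies in the span of `B_0, …, B_{n-1}` even when `k = n`, so `Φ_n` is
orthogonal to it: `ϖ_n` cancels the pole of the last factor of `B_n` and leaves an affine multiple
of `B_{n-1}`. For `n = 0` the function is constant because `a 0 = 0`. -/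
theorem exists_vp_mul_bp_eq_add (ha0 : a 0 = 0) {b : ℂ} (hb : ‖b‖ < 1) {k n : ℕ} (hk : k ≤ n) :
    ∃ r, Lsp a n r ∧ ∀ u, ‖u‖ ≤ 1 →
      vp (a n) u * bp a k u = vp (a n) b * bp a k b + (u - b) * r u := by
  rcases hk.lt_or_eq with h | rfl
  · obtain ⟨r, hr, h1⟩ := exists_affine_mul_bp_eq_add ha hb 1 (-conj (a n)) k
    refine ⟨r, hr.mono h, fun u hu => ?_⟩
    have := h1 u hu
    unfold vp
    linear_combination this
  · rcases k with _ | m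
    · exact ⟨fun _ => 0, Lsp.zero 0, fun u _ => by simp [ha0, vp, bp_zero]⟩
    · set A := a (m + 1) with hA
      have hAn : ‖A‖ < 1 := ha _
      obtain ⟨r, hr, h1⟩ := exists_affine_mul_bp_eq_add ha hb (-zfac .disk A * A) (zfac .disk A) m
      refine ⟨r, hr, fun u hu => ?_⟩
      have h2 : ∀ v, ‖v‖ ≤ 1 → vp A v * bp a (m + 1) v =
          (-zfac .disk A * A + zfac .disk A * v) * bp a m v := fun v hv => by
        have h3 := vp_ne_zero hAn hv
        rw [bp_succ, ← hA, bf]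
        field_simp
        ring
      rw [h2 u hu, h2 b hb.le, h1 u hu]

theorem Lsp.continuousOn {n : ℕ} {g : ℂ → ℂ} (hg : Lsp a n g) :
    ContinuousOn g (Metric.closedBall 0 1) := by
  obtain ⟨c, hc⟩ := hg
  refine ContinuousOn.congr (f := fun u => ∑ k ∈ Finset.range n, c k * RatKhrushchev.bp a k u) ?_
    fun u hu => hc u (by simpa using hu)
  exact continuousOn_finsetSum _ fun k _ => continuousOn_const.mul
    (continuousOn_finsetProd _ fun j _ => continuousOn_bf (ha j))

theorem Lsp.continuousOn_sphere {n : ℕ} {g : ℂ → ℂ} (hg : Lsp a n g) :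
    ContinuousOn g (Metric.sphere 0 1) :=
  (hg.continuousOn ha).mono Metric.sphere_subset_closedBall

theorem Lsp.differentiableOn {n : ℕ} {g : ℂ → ℂ} (hg : Lsp a n g) :
    DifferentiableOn ℂ g (Metric.ball 0 1) := by
  obtain ⟨c, hc⟩ := hg
  refine DifferentiableOn.congr (f := fun u => ∑ k ∈ Finset.range n, c k * RatKhrushchev.bp a k u) ?_
    fun u hu => hc u (mem_ball_zero_iff.1 hu).le
  exact DifferentiableOn.fun_sum fun k _ => (differentiableOn_const _).mul
    (DifferentiableOn.fun_finsetProd fun j _ => differentiableOn_bf (ha j))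

theorem Lsp.diffContOnCl {n : ℕ} {g : ℂ → ℂ} (hg : Lsp a n g) :
    DiffContOnCl ℂ g (Metric.ball 0 1) :=
  ⟨hg.differentiableOn ha, by rw [closure_ball _ one_ne_zero]; exact hg.continuousOn ha⟩

omit ha in
theorem eq_on_closedBall_of_eq_on_sphere {f g : ℂ → ℂ} (hf : DiffContOnCl ℂ f (Metric.ball 0 1))
    (hg : DiffContOnCl ℂ g (Metric.ball 0 1)) (h : ∀ u, ‖u‖ = 1 → f u = g u) {u : ℂ}
    (hu : ‖u‖ ≤ 1) : f u = g u := by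
  have h1 := Complex.eqOn_closure_of_eqOn_frontier Metric.isBounded_ball hf hg (by
    rw [frontier_ball _ one_ne_zero]
    exact fun v hv => h v (by simpa using hv))
  rw [closure_ball _ one_ne_zero] at h1
  exact h1 (by simpa using hu)

/-- Multiplied by the denominators, elements of the span are polynomials. -/
theorem Lsp.exists_polynomial {n : ℕ} {g : ℂ → ℂ} (hg : Lsp a (n + 1) g) :
    ∃ p : Polynomial ℂ, p.natDegree ≤ n ∧ ∀ u, ‖u‖ ≤ 1 →
      p.eval u = g u * ∏ j ∈ Finset.Ioc 0 n, vp (a j) u := by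
  obtain ⟨c, hc⟩ := hg
  refine ⟨∑ k ∈ Finset.range (n + 1), Polynomial.C (c k) *
    ((∏ j ∈ Finset.Ioc 0 k, Polynomial.C (zfac .disk (a j)) * (Polynomial.X - Polynomial.C (a j))) *
      ∏ j ∈ Finset.Ioc k n, (1 - Polynomial.C (conj (a j)) * Polynomial.X)), ?_, fun u hu => ?_⟩
  · refine Polynomial.natDegree_sum_le_of_forall_le _ _ fun k hk => ?_
    have hk' : k ≤ n := Nat.lt_succ_iff.1 (Finset.mem_range.1 hk)
    refine (Polynomial.natDegree_C_mul_le _ _).trans (Polynomial.natDegree_mul_le.trans ?_)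
    have h1 : (∏ j ∈ Finset.Ioc 0 k, Polynomial.C (zfac .disk (a j)) *
        (Polynomial.X - Polynomial.C (a j))).natDegree ≤ k := by
      refine (Polynomial.natDegree_prod_le _ _).trans ?_
      refine (Finset.sum_le_card_nsmul _ _ 1 fun j _ => ?_).trans (by simp)
      exact (Polynomial.natDegree_C_mul_le _ _).trans (by simp)
    have h2 : (∏ j ∈ Finset.Ioc k n,
        (1 - Polynomial.C (conj (a j)) * Polynomial.X)).natDegree ≤ n - k := by
      refine (Polynomial.natDegree_prod_le _ _).trans ?_
      refine (Finset.sum_le_card_nsmul _ _ 1 fun j _ => ?_).trans (by simp)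
      exact (Polynomial.natDegree_sub_le _ _).trans (by
        simpa using Polynomial.natDegree_C_mul_X_pow_le (conj (a j)) 1)
    omega
  · rw [hc u hu, Polynomial.eval_finsetSum, Finset.sum_mul]
    refine Finset.sum_congr rfl fun k hk => ?_
    have hk' : k ≤ n := Nat.lt_succ_iff.1 (Finset.mem_range.1 hk)
    rw [← Finset.prod_Ioc_consecutive (fun j => vp (a j) u) (Nat.zero_le k) hk',
      Polynomial.eval_mul, Polynomial.eval_mul, Polynomial.eval_prod, Polynomial.eval_prod,
      RatKhrushchev.bp, mul_assoc (c k), ← mul_assoc (∏ j ∈ Finset.Ioc 0 k, bf (a j) u),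
      ← Finset.prod_mul_distrib, Polynomial.eval_C]
    congr 2
    · refine Finset.prod_congr rfl fun j _ => ?_
      have := vp_ne_zero (ha j) hu
      rw [bf]
      field_simp
      simp
    · refine Finset.prod_congr rfl fun j _ => ?_
      simp [vp]

/-- A combination that vanishes almost everywhere vanishes identically, if the measure is not
concentrated on few points. -/
theorem Lsp.eq_zero_of_ae {ν : Measure ℂ} (hν : ν (Metric.sphere 0 1)ᶜ = 0) {n : ℕ}
    (hn : ∀ s : Finset ℂ, s.card ≤ n → ν (s : Set ℂ)ᶜ ≠ 0) {g : ℂ → ℂ} (hg : Lsp a (n + 1) g)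
    (h0 : ∀ᵐ u ∂ν, g u = 0) {u : ℂ} (hu : ‖u‖ ≤ 1) : g u = 0 := by
  obtain ⟨p, hp, hpe⟩ := hg.exists_polynomial ha
  have hp0 : p = 0 := by
    by_contra hp0
    -- A nonzero numerator of degree at most `n` would confine the measure to at most `n` roots.
    refine hn p.roots.toFinset ((Multiset.toFinset_card_le _).trans
      ((Polynomial.card_roots' p).trans hp)) ?_
    rw [← mem_ae_iff]
    filter_upwards [h0, ae_norm_eq_one hν] with v hv hv1
    rw [Finset.mem_coe, Multiset.mem_toFinset, Polynomial.mem_roots hp0, Polynomial.IsRoot,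
      hpe v hv1.le, hv, zero_mul]
  have h1 := hpe u hu
  rw [hp0, Polynomial.eval_zero] at h1
  exact (mul_eq_zero.1 h1.symm).resolve_right
    (Finset.prod_ne_zero_iff.2 fun j _ => vp_ne_zero (ha j) hu)

end Lsp

end RatKhrushchev

end

noncomputable section

namespace RatKhrushchev

/-! ### Orthonormal rational functions on the circle and their Cauchy transforms -/

section CircleORF

variable {a : ℕ → ℂ} {ν : Measure ℂ}

theorem integral_congr_of_norm_eq_one (hν : ν (Metric.sphere 0 1)ᶜ = 0) {f g : ℂ → ℂ}
    (h : ∀ u, ‖u‖ = 1 → f u = g u) : ∫ u, f u ∂ν = ∫ u, g u ∂ν :=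
  integral_congr_ae ((ae_norm_eq_one hν).mono h)

theorem continuousOn_conj {f : ℂ → ℂ} {s : Set ℂ} (hf : ContinuousOn f s) :
    ContinuousOn (fun u => conj (f u)) s :=
  Complex.continuous_conj.comp_continuousOn hf

theorem integral_lincomb_two {f g : ℂ → ℂ} (hf : Integrable f ν) (hg : Integrable g ν)
    (A B : ℂ) : ∫ u, (A * f u + B * g u) ∂ν = A * ∫ u, f u ∂ν + B * ∫ u, g u ∂ν := by
  rw [integral_add (hf.const_mul A) (hg.const_mul B), integral_const_mul, integral_const_mul]

theorem integral_lincomb_four {f g h k : ℂ → ℂ} (hf : Integrable f ν) (hg : Integrable g ν)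
    (hh : Integrable h ν) (hk : Integrable k ν) (A B C D : ℂ) :
    ∫ u, (A * f u + B * g u + (C * h u + D * k u)) ∂ν =
      A * ∫ u, f u ∂ν + B * ∫ u, g u ∂ν + (C * ∫ u, h u ∂ν + D * ∫ u, k u ∂ν) := by
  refine (integral_add ((hf.const_mul A).add (hg.const_mul B))
    ((hh.const_mul C).add (hk.const_mul D))).trans ?_
  exact congrArg₂ (· + ·) (integral_lincomb_two hf hg A B) (integral_lincomb_two hh hk C D)

/-- The functions `cb a n c` are the `n`-th orthonormal rational functions. -/
structure IsORF (a : ℕ → ℂ) (ν : Measure ℂ) (n : ℕ) (c : ℕ → ℂ) : Prop where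
  supp : ∀ k, n < k → c k = 0
  orth : ∀ g, Lsp a n g → ∫ u, cb a n c u * conj (g u) ∂ν = 0
  norm : ∫ u, cb a n c u * conj (cb a n c u) ∂ν = 1

/-- The Cauchy transform of `2 ζ_n Φ_n conj B_n`. -/
def xT (a : ℕ → ℂ) (ν : Measure ℂ) (n : ℕ) (c : ℕ → ℂ) (z : ℂ) : ℂ :=
  ∫ u, 2 * bf (a n) u * cb a n c u * conj (bp a n u) / (u - z) ∂ν

/-- The Cauchy transform of `2 conj Φ_n`. -/
def yT (a : ℕ → ℂ) (ν : Measure ℂ) (n : ℕ) (c : ℕ → ℂ) (z : ℂ) : ℂ :=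
  ∫ u, 2 * conj (cb a n c u) / (u - z) ∂ν

/-- Every other term contains the factor `ζ_n`. Thus `Φ_n^*(a_n)` is nonzero exactly when the
leading coefficient is. -/
theorem cbs_self (n : ℕ) (c : ℕ → ℂ) : cbs a n c (a n) = conj (c n) := by
  rw [cbs, Finset.sum_eq_single_of_mem n (Finset.self_mem_range_succ n)]
  · simp
  · intro k hk hkn
    have hk' : k < n := by
      have := Finset.mem_range.1 hk
      omega
    rw [Finset.prod_eq_zero (Finset.right_mem_Ioc.2 hk') (bf_self _), mul_zero]

theorem cb_eq_add {n : ℕ} (c : ℕ → ℂ) :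
    ∃ g, Lsp a n g ∧ ∀ u, cb a n c u = c n * bp a n u + g u :=
  ⟨fun u => ∑ k ∈ Finset.range n, c k * bp a k u, ⟨c, fun _ _ => rfl⟩, fun u => by
    rw [cb, Finset.sum_range_succ, add_comm]⟩

variable (ha : ∀ k, ‖a k‖ < 1)
include ha

theorem continuousOn_bf_sphere (n : ℕ) : ContinuousOn (bf (a n)) (Metric.sphere 0 1) :=
  (continuousOn_bf (ha n)).mono Metric.sphere_subset_closedBall

theorem continuousOn_bp_sphere (n : ℕ) : ContinuousOn (bp a n) (Metric.sphere 0 1) :=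
  (Lsp.bp (Nat.lt_succ_self n)).continuousOn_sphere ha

theorem continuousOn_cb_sphere (n : ℕ) (c : ℕ → ℂ) :
    ContinuousOn (cb a n c) (Metric.sphere 0 1) :=
  (Lsp.cb n c).continuousOn_sphere ha

theorem continuousOn_xT_density (n : ℕ) (c : ℕ → ℂ) :
    ContinuousOn (fun u => 2 * bf (a n) u * cb a n c u * conj (bp a n u)) (Metric.sphere 0 1) :=
  ((continuousOn_const.mul (continuousOn_bf_sphere ha n)).mul (continuousOn_cb_sphere ha n c)).mul
    (continuousOn_conj (continuousOn_bp_sphere ha n))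

theorem continuousOn_yT_density (n : ℕ) (c : ℕ → ℂ) :
    ContinuousOn (fun u => 2 * conj (cb a n c u)) (Metric.sphere 0 1) :=
  continuousOn_const.mul (continuousOn_conj (continuousOn_cb_sphere ha n c))

theorem bp_mul_conj_cbs {u : ℂ} (hu : ‖u‖ = 1) (n : ℕ) (c : ℕ → ℂ) :
    bp a n u * conj (cbs a n c u) = cb a n c u := by
  rw [cbs_eq_of_norm_eq_one ha hu, map_mul, Complex.conj_conj]
  linear_combination cb a n c u * bp_mul_conj ha hu n

theorem conj_bp_mul_cbs {u : ℂ} (hu : ‖u‖ = 1) (n : ℕ) (c : ℕ → ℂ) :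
    conj (bp a n u) * cbs a n c u = conj (cb a n c u) := by
  rw [cbs_eq_of_norm_eq_one ha hu]
  linear_combination conj (cb a n c u) * bp_mul_conj ha hu n

theorem vp_mul_bf {u : ℂ} (hu : ‖u‖ ≤ 1) (n : ℕ) :
    vp (a n) u * bf (a n) u = zfac .disk (a n) * (u - a n) := by
  have := vp_ne_zero (ha n) hu
  rw [bf]
  field_simp

/-- The recurrence candidate for the next orthogonal rational function and its reversal. -/
theorem exists_coeff_recurrence (n : ℕ) (c : ℕ → ℂ) (Λ : ℂ) :
    ∃ d : ℕ → ℂ, (∀ k, n + 1 < k → d k = 0) ∧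
      (∀ u, ‖u‖ ≤ 1 → cb a (n + 1) d u = vp (a n) u / vp (a (n + 1)) u *
        (zfac .disk (a (n + 1)) * conj (zfac .disk (a n)) * bf (a n) u * cb a n c u +
          conj Λ * cbs a n c u)) ∧
      (∀ u, ‖u‖ ≤ 1 → cbs a (n + 1) d u = vp (a n) u / vp (a (n + 1)) u *
        (Λ * (zfac .disk (a (n + 1)) * conj (zfac .disk (a n)) * bf (a n) u * cb a n c u) +
          cbs a n c u)) := by
  set zN := zfac .disk (a (n + 1)) with hzN
  set zn := zfac .disk (a n) with hzn
  have hzN1 : zN * conj zN = 1 := zfac_disk_mul_conj (ha _)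
  have hzn1 : zn * conj zn = 1 := zfac_disk_mul_conj (ha _)
  have hA := (Lsp.cb (a := a) n c).affine_div_mul ha (-a n) 1
  have hB := (Lsp.cbs ha n c).affine_div_mul ha 1 (-conj (a n))
  -- The factor `ϖ_n` removes the pole of `ζ_n`, so both sides of the recurrence have only the new
  -- denominator `ϖ_{n+1}`.
  have hbfv : ∀ u, ‖u‖ ≤ 1 → vp (a n) u / vp (a (n + 1)) u * (conj zn * bf (a n) u) =
      (-a n + 1 * u) / vp (a (n + 1)) u := fun u hu => by
    have h1 := vp_mul_bf ha hu n
    rw [div_mul_eq_mul_div]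
    congr 1
    linear_combination conj zn * h1 + (u - a n) * hzn1
  obtain ⟨d, hd⟩ : Lsp a (n + 2) fun u => vp (a n) u / vp (a (n + 1)) u *
        (zN * conj zn * bf (a n) u * cb a n c u + conj Λ * cbs a n c u) := by
    refine ((hA.const_mul zN).add (hB.const_mul (conj Λ))).congr fun u hu => ?_
    rw [← hbfv u hu, vp, vp]
    ring
  have hG : Lsp a (n + 2) fun u => vp (a n) u / vp (a (n + 1)) u *
        (Λ * (zN * conj zn * bf (a n) u * cb a n c u) + cbs a n c u) := by
    refine ((hA.const_mul (Λ * zN)).add hB).congr fun u hu => ?_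
    rw [← hbfv u hu, vp, vp]
    ring
  -- Membership in the span does not restrict the coefficients beyond `n + 1`, so they are cut off.
  have hcb : ∀ u, ‖u‖ ≤ 1 → cb a (n + 1) (fun k => if k < n + 2 then d k else 0) u =
      vp (a n) u / vp (a (n + 1)) u *
        (zN * conj zn * bf (a n) u * cb a n c u + conj Λ * cbs a n c u) := fun u hu => by
    refine Eq.trans ?_ (hd u hu).symm
    rw [cb]
    exact Finset.sum_congr rfl fun k hk => by simp only [if_pos (Finset.mem_range.1 hk)]
  refine ⟨fun k => if k < n + 2 then d k else 0, fun k hk => if_neg (by omega), hcb, fun u hu => ?_⟩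
  -- Reversal is conjugation followed by multiplication with `B_{n+1}` on the circle only; the
  -- maximum principle carries the identity inside.
  refine eq_on_closedBall_of_eq_on_sphere ((Lsp.cbs ha _ _).diffContOnCl ha)
    (hG.diffContOnCl ha) (fun v hv => ?_) hu
  rw [cbs_eq_of_norm_eq_one ha hv, hcb v hv.le, bp_succ]
  have h1 := vp_ne_zero (ha (n + 1)) hv.le
  have hv0 : v ≠ 0 := by rintro rfl; simp at hv
  have hcv : conj v ≠ 0 := by simpa using hv0
  have hva : v - a (n + 1) ≠ 0 := sub_ne_zero_of_norm hv (ha _)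
  have h2 : bf (a (n + 1)) v * (conj (vp (a n) v) / conj (vp (a (n + 1)) v)) =
      zN * conj zn * (vp (a n) v / vp (a (n + 1)) v) * bf (a n) v := by
    have h3 := hbfv v hv.le
    rw [conj_vp_of_norm_eq_one hv, conj_vp_of_norm_eq_one hv, mul_div_mul_right _ _ hcv, bf,
      ← hzN]
    have h4 : zN * ((v - a (n + 1)) / vp (a (n + 1)) v) * ((v - a n) / (v - a (n + 1))) =
        zN * ((-a n + 1 * v) / vp (a (n + 1)) v) := by
      field_simp
      ring
    rw [h4, ← h3]
    ring
  have h5 := bp_mul_conj_cbs ha hv n c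
  have h6 := cbs_eq_of_norm_eq_one ha hv n c
  have h7 := bf_mul_conj (ha n) hv
  simp only [map_mul, map_add, map_div₀, Complex.conj_conj]
  calc bp a n v * bf (a (n + 1)) v * (conj (vp (a n) v) / conj (vp (a (n + 1)) v) *
        (conj zN * zn * conj (bf (a n) v) * conj (cb a n c v) + Λ * conj (cbs a n c v)))
      = bf (a (n + 1)) v * (conj (vp (a n) v) / conj (vp (a (n + 1)) v)) *
        (conj zN * zn * conj (bf (a n) v) * (bp a n v * conj (cb a n c v)) +
          Λ * (bp a n v * conj (cbs a n c v))) := by ring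
    _ = _ := by
      rw [h2, h5, ← h6]
      linear_combination (vp (a n) v / vp (a (n + 1)) v) * cbs a n c v *
        (bf (a n) v * conj (bf (a n) v) * (zn * conj zn) * hzN1 +
          bf (a n) v * conj (bf (a n) v) * hzn1 + h7)

variable [IsProbabilityMeasure ν] (hν : ν (Metric.sphere 0 1)ᶜ = 0)
include hν

theorem integral_mul_conj_eq_zero_of_forall_bp {f : ℂ → ℂ} (hf : ContinuousOn f (Metric.sphere 0 1))
    {n : ℕ} (h : ∀ k < n, ∫ u, f u * conj (bp a k u) ∂ν = 0) {g : ℂ → ℂ} (hg : Lsp a n g) :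
    ∫ u, f u * conj (g u) ∂ν = 0 := by
  obtain ⟨c, hc⟩ := hg
  rw [integral_congr_of_norm_eq_one hν (g := fun u => ∑ k ∈ Finset.range n,
    conj (c k) * (f u * conj (bp a k u)))]
  · rw [integral_finsetSum]
    · refine Finset.sum_eq_zero fun k hk => ?_
      rw [integral_const_mul, h k (Finset.mem_range.1 hk), mul_zero]
    · intro k _
      exact (integrable_of_continuousOn_sphere hν
        (hf.mul (continuousOn_conj (continuousOn_bp_sphere ha k)))).const_mul _
  · intro u hu
    rw [hc u hu.le, map_sum, Finset.mul_sum]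
    exact Finset.sum_congr rfl fun k _ => by rw [map_mul]; ring

/-- The recurrence candidate is orthogonal to the previous span when `Λ` is chosen by the value of
the Cauchy transforms at the new point. -/
theorem recurrence_orthogonal (ha0 : a 0 = 0) {n : ℕ} {c : ℕ → ℂ} (hc : IsORF a ν n c) {Λ : ℂ}
    (hΛ : Λ * (zfac .disk (a (n + 1)) * conj (zfac .disk (a n))) * xT a ν n c (a (n + 1)) +
      yT a ν n c (a (n + 1)) = 0) {d : ℕ → ℂ}
    (hd : ∀ u, ‖u‖ ≤ 1 → cbs a (n + 1) d u = vp (a n) u / vp (a (n + 1)) u *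
        (Λ * (zfac .disk (a (n + 1)) * conj (zfac .disk (a n)) * bf (a n) u * cb a n c u) +
          cbs a n c u)) {g : ℂ → ℂ} (hg : Lsp a (n + 1) g) :
    ∫ u, cb a (n + 1) d u * conj (g u) ∂ν = 0 := by
  refine integral_mul_conj_eq_zero_of_forall_bp ha hν (continuousOn_cb_sphere ha _ d)
    (fun k hk => ?_) hg
  set zN := zfac .disk (a (n + 1)) with hzN
  set zn := zfac .disk (a n) with hzn
  have hzN1 : zN * conj zN = 1 := zfac_disk_mul_conj (ha _)
  set b := a (n + 1) with hb
  have hbn : ‖b‖ < 1 := ha _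
  obtain ⟨r, hr, hrK⟩ := exists_vp_mul_bp_eq_add ha ha0 hbn (Nat.lt_succ_iff.1 hk)
  obtain ⟨h, hh, hrh⟩ := hr.exists_star ha
  set K := vp (a n) b * bp a k b
  rw [← map_eq_zero (starRingEnd ℂ), ← integral_conj]
  -- Conjugation brings in `conj Φ_{n+1} = conj B_{n+1} Φ_{n+1}^*`, and `conj ζ_b / ϖ_b = conj z_b /
  -- (u - b)` produces a Cauchy kernel. With `ϖ_n B_k = K + (u - b) r`, the constant `K` yields the
  -- transforms at `b`, with `K / 2` because these carry a factor `2`. In the remainder the pole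
  -- cancels, leaving inner products with the span below `Φ_n`.
  have key : ∀ u, ‖u‖ = 1 → conj (cb a (n + 1) d u * conj (bp a k u)) =
      (conj zN * (K / 2) * (Λ * (zN * conj zn))) *
          (2 * bf (a n) u * cb a n c u * conj (bp a n u) / (u - b)) +
        (conj zN * (K / 2)) * (2 * conj (cb a n c u) / (u - b)) +
        ((conj zN * (Λ * (zN * conj zn))) * (cb a n c u * conj (h u)) +
        conj zN * conj (cb a n c u * conj (r u))) := by
    intro u hu
    have hub : u - b ≠ 0 := sub_ne_zero_of_norm hu hbn
    have hvN := vp_ne_zero hbn hu.le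
    have h1 := conj_bp_mul_cbs ha hu (n + 1) d
    have h2 := hrK u hu.le
    have h3 := conj_bp_mul_cbs ha hu n c
    have h4 := bf_mul_conj (ha (n + 1)) hu
    have h5 := vp_mul_bf ha hu.le (n + 1)
    have h6 := hrh u hu
    rw [← hb] at h4 h5
    have h7 : conj (bf b u) / vp b u = conj zN / (u - b) := by
      rw [div_eq_div_iff hvN hub]
      have h8 : zN * (conj (bf b u) * (u - b) - conj zN * vp b u) = 0 := by
        linear_combination -conj (bf b u) * h5 + vp b u * h4 - vp b u * hzN1
      have hz0 : zN ≠ 0 := zfac_disk_ne_zero hbn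
      exact sub_eq_zero.1 ((mul_eq_zero.1 h8).resolve_left hz0)
    rw [map_mul, Complex.conj_conj, ← h1, hd u hu.le, bp_succ, map_mul, ← hb]
    calc _ = (conj (bf b u) / vp b u) * (vp (a n) u * bp a k u) *
          (Λ * (zN * conj zn) * (bf (a n) u * cb a n c u * conj (bp a n u)) +
            conj (bp a n u) * cbs a n c u) := by ring
      _ = _ := by
        rw [h7, h2, h3, ← h6, map_mul, Complex.conj_conj]
        field_simp
  rw [integral_congr_of_norm_eq_one hν key]
  have i1 := integrable_of_continuousOn_sphere hν
    (continuousOn_div_sub (continuousOn_xT_density ha n c) hbn)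
  have i2 := integrable_of_continuousOn_sphere hν
    (continuousOn_div_sub (continuousOn_yT_density ha n c) hbn)
  have i3 := integrable_of_continuousOn_sphere hν ((continuousOn_cb_sphere ha n c).mul
    (continuousOn_conj (hh.continuousOn_sphere ha)))
  have i4 := integrable_of_continuousOn_sphere hν (continuousOn_conj
    ((continuousOn_cb_sphere ha n c).mul (continuousOn_conj (hr.continuousOn_sphere ha))))
  refine (integral_lincomb_four i1 i2 i3 i4 _ _ _ _).trans ?_
  simp only [Pi.mul_apply]
  rw [integral_conj, hc.orth h hh, hc.orth r hr]
  change _ * xT a ν n c b + _ * yT a ν n c b + _ = 0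
  rw [map_zero]
  linear_combination (conj zN * (K / 2)) * hΛ

end CircleORF

end RatKhrushchev

end

/-! ### Nondegeneracy of the recurrence, uniqueness, and Gram-Schmidt. -/

noncomputable section

namespace RatKhrushchev

section CircleORF

variable {a : ℕ → ℂ} {ν : Measure ℂ}

theorem integral_mul_conj_self (f : ℂ → ℂ) :
    ∫ u, f u * conj (f u) ∂ν = ((∫ u, ‖f u‖ ^ 2 ∂ν : ℝ) : ℂ) := by
  rw [← integral_complex_ofReal]
  refine integral_congr_ae (Eventually.of_forall fun u => ?_)
  simp only [Complex.mul_conj, Complex.normSq_eq_norm_sq]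

variable [IsProbabilityMeasure ν] (hν : ν (Metric.sphere 0 1)ᶜ = 0)
include hν

theorem ae_eq_zero_of_integral_mul_conj {f : ℂ → ℂ} (hf : ContinuousOn f (Metric.sphere 0 1))
    (h : ∫ u, f u * conj (f u) ∂ν = 0) : ∀ᵐ u ∂ν, f u = 0 := by
  have hi : Integrable (fun u => ‖f u‖ ^ 2) ν :=
    integrable_of_continuousOn_sphere hν (hf.norm.pow 2)
  rw [integral_mul_conj_self, Complex.ofReal_eq_zero, integral_eq_zero_iff_of_nonneg
    (fun u => by positivity) hi] at h
  filter_upwards [h] with u hu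
  simpa using hu

omit hν [IsProbabilityMeasure ν] in
-- Without its leading term `Φ_n` would lie in the previous span and be orthogonal to itself.
theorem IsORF.coeff_ne_zero {n : ℕ} {c : ℕ → ℂ} (hc : IsORF a ν n c) : c n ≠ 0 := by
  intro h0
  obtain ⟨g, hg, hcg⟩ := cb_eq_add (a := a) (n := n) c
  have h1 := hc.orth _ (hg.congr (h := cb a n c) fun u _ => by rw [hcg u, h0]; ring)
  rw [hc.norm] at h1
  exact one_ne_zero h1

variable (ha : ∀ k, ‖a k‖ < 1)
include ha

theorem integral_mul_conj_cb {f : ℂ → ℂ} (hf : ContinuousOn f (Metric.sphere 0 1)) {n : ℕ}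
    (hfo : ∀ g, Lsp a n g → ∫ u, f u * conj (g u) ∂ν = 0) (c : ℕ → ℂ) :
    ∫ u, f u * conj (cb a n c u) ∂ν = conj (c n) * ∫ u, f u * conj (bp a n u) ∂ν := by
  obtain ⟨g, hg, hcg⟩ := cb_eq_add (a := a) (n := n) c
  have i1 := integrable_of_continuousOn_sphere hν
    (hf.mul (continuousOn_conj (continuousOn_bp_sphere ha n)))
  have i2 := integrable_of_continuousOn_sphere hν
    (hf.mul (continuousOn_conj (hg.continuousOn_sphere ha)))
  have h := integral_lincomb_two i1 i2 (conj (c n)) 1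
  simp only [Pi.mul_apply] at h
  rw [hfo g hg, mul_zero, add_zero] at h
  rw [← h]
  refine integral_congr_ae (Eventually.of_forall fun u => ?_)
  simp only [hcg u, map_add, map_mul]
  ring

theorem IsORF.conj_coeff_mul_integral {n : ℕ} {c : ℕ → ℂ} (hc : IsORF a ν n c) :
    conj (c n) * ∫ u, cb a n c u * conj (bp a n u) ∂ν = 1 := by
  rw [← integral_mul_conj_cb hν ha (continuousOn_cb_sphere ha n c) hc.orth, hc.norm]

/-- The recurrence candidate does not vanish in `L²`. -/
theorem recurrence_ne_zero {n : ℕ} {c : ℕ → ℂ} (hc : IsORF a ν n c)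
    (hn : ∀ s : Finset ℂ, s.card ≤ n + 1 → ν (s : Set ℂ)ᶜ ≠ 0) {Λ : ℂ} {d : ℕ → ℂ}
    (hd : ∀ u, ‖u‖ ≤ 1 → cbs a (n + 1) d u = vp (a n) u / vp (a (n + 1)) u *
        (Λ * (zfac .disk (a (n + 1)) * conj (zfac .disk (a n)) * bf (a n) u * cb a n c u) +
          cbs a n c u)) :
    ∫ u, cb a (n + 1) d u * conj (cb a (n + 1) d u) ∂ν ≠ 0 := by
  intro h
  have h1 := ae_eq_zero_of_integral_mul_conj hν (continuousOn_cb_sphere ha (n + 1) d) h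
  have h2 : ∀ u, ‖u‖ ≤ 1 → cbs a (n + 1) d u = 0 := fun u hu =>
    eq_on_closedBall_of_eq_on_sphere (g := fun _ => 0) ((Lsp.cbs ha _ _).diffContOnCl ha)
      diffContOnCl_const (fun v hv => by
        rw [cbs_eq_of_norm_eq_one ha hv, (Lsp.cb (n + 1) d).eq_zero_of_ae ha hν hn h1 hv.le]
        simp) hu
  -- At `a n` the factor `ζ_n` vanishes and only the nonzero value of `Φ_n^*` remains.
  have h3 := hd (a n) (ha n).le
  rw [h2 _ (ha n).le, bf_self, cbs_self] at h3
  simp only [mul_zero, zero_mul, zero_add] at h3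
  have h4 := vp_ne_zero (ha n) (ha n).le
  have h5 := vp_ne_zero (ha (n + 1)) (ha n).le
  have h6 : conj (c n) ≠ 0 := by simpa using hc.coeff_ne_zero
  exact (mul_ne_zero (div_ne_zero h4 h5) h6) h3.symm

/-- If `|Λ| = 1`, the candidate `Φ` satisfies `Φ^* = Λ Φ`. Then its inner product with `B_{n+1}` is
a multiple of the conjugate of that with `1`, hence zero, and `Φ` is orthogonal to itself. This is
the source of `|γ_n| < 1`. -/
theorem recurrence_norm_ne_one {n : ℕ} {c : ℕ → ℂ} (hc : IsORF a ν n c)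
    (hn : ∀ s : Finset ℂ, s.card ≤ n + 1 → ν (s : Set ℂ)ᶜ ≠ 0) {Λ : ℂ} {d : ℕ → ℂ}
    (hdc : ∀ u, ‖u‖ ≤ 1 → cb a (n + 1) d u = vp (a n) u / vp (a (n + 1)) u *
        (zfac .disk (a (n + 1)) * conj (zfac .disk (a n)) * bf (a n) u * cb a n c u +
          conj Λ * cbs a n c u))
    (hd : ∀ u, ‖u‖ ≤ 1 → cbs a (n + 1) d u = vp (a n) u / vp (a (n + 1)) u *
        (Λ * (zfac .disk (a (n + 1)) * conj (zfac .disk (a n)) * bf (a n) u * cb a n c u) +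
          cbs a n c u))
    (ho : ∀ g, Lsp a (n + 1) g → ∫ u, cb a (n + 1) d u * conj (g u) ∂ν = 0) : ‖Λ‖ ≠ 1 := by
  intro hΛ
  have hΛ1 := mul_conj_of_norm_eq_one hΛ
  apply recurrence_ne_zero hν ha hc hn hd
  rw [integral_mul_conj_cb hν ha (continuousOn_cb_sphere ha _ _) ho]
  have h1 : ∀ u, ‖u‖ = 1 → cb a (n + 1) d u * conj (bp a (n + 1) u) =
      conj Λ * conj (cb a (n + 1) d u * conj 1) := fun u hu => by
    rw [map_one, mul_one, ← conj_bp_mul_cbs ha hu, hd u hu.le, hdc u hu.le]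
    linear_combination (-(vp (a n) u / vp (a (n + 1)) u) * conj (bp a (n + 1) u) *
      (zfac .disk (a (n + 1)) * conj (zfac .disk (a n)) * bf (a n) u * cb a n c u)) * hΛ1
  have h2 : Lsp a (n + 1) fun _ => 1 :=
    (Lsp.bp (k := 0) (Nat.succ_pos n)).congr fun u _ => (bp_zero u).symm
  rw [integral_congr_of_norm_eq_one hν h1, integral_const_mul, integral_conj, ho _ h2]
  simp

/-- Two elements of the same span orthogonal to the previous span are proportional. -/
theorem eq_coeff_mul_of_orthogonal {n : ℕ}
    (hn : ∀ s : Finset ℂ, s.card ≤ n + 1 → ν (s : Set ℂ)ᶜ ≠ 0) {φ d : ℕ → ℂ} (hφ : φ (n + 1) = 1)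
    (hφo : ∀ g, Lsp a (n + 1) g → ∫ u, cb a (n + 1) φ u * conj (g u) ∂ν = 0)
    (hdo : ∀ g, Lsp a (n + 1) g → ∫ u, cb a (n + 1) d u * conj (g u) ∂ν = 0)
    {u : ℂ} (hu : ‖u‖ ≤ 1) : cb a (n + 1) d u = d (n + 1) * cb a (n + 1) φ u := by
  obtain ⟨g, hg, hgd⟩ := cb_eq_add (a := a) (n := n + 1) d
  obtain ⟨h, hh, hhφ⟩ := cb_eq_add (a := a) (n := n + 1) φ
  set f : ℂ → ℂ := fun u => cb a (n + 1) d u + -d (n + 1) * cb a (n + 1) φ u with hf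
  have hfL : Lsp a (n + 1) f := (hg.add (hh.const_mul (-d (n + 1)))).congr fun v _ => by
    simp only [hf, hgd, hhφ, hφ]
    ring
  have hfc := hfL.continuousOn_sphere ha
  have h0 : ∫ u, f u * conj (f u) ∂ν = 0 := by
    have i1 := integrable_of_continuousOn_sphere hν
      ((continuousOn_cb_sphere ha (n + 1) d).mul (continuousOn_conj hfc))
    have i2 := integrable_of_continuousOn_sphere hν
      ((continuousOn_cb_sphere ha (n + 1) φ).mul (continuousOn_conj hfc))
    have h := integral_lincomb_two i1 i2 1 (-d (n + 1))
    simp only [Pi.mul_apply] at h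
    rw [hφo f hfL, hdo f hfL, mul_zero, mul_zero, add_zero] at h
    rw [← h]
    refine integral_congr_ae (Eventually.of_forall fun u => ?_)
    simp only [hf]
    ring
  have h1 := (hfL.mono (Nat.le_succ _)).eq_zero_of_ae ha hν hn
    (ae_eq_zero_of_integral_mul_conj hν hfc h0) hu
  simp only [hf] at h1
  linear_combination h1

omit hν ha [IsProbabilityMeasure ν]

theorem cb_of_supp {m n : ℕ} (hmn : m ≤ n) {c : ℕ → ℂ} (hc : ∀ k, m < k → c k = 0) (u : ℂ) :
    cb a n c u = cb a m c u := by
  rw [cb, cb]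
  refine (Finset.sum_subset (Finset.range_mono (by omega)) fun k _ hk => ?_).symm
  rw [Finset.mem_range, not_lt] at hk
  rw [hc k (by omega), zero_mul]

theorem cb_smul (n : ℕ) (r : ℂ) (c : ℕ → ℂ) (u : ℂ) : cb a n (r • c) u = r * cb a n c u := by
  simp only [cb, Pi.smul_apply, smul_eq_mul, Finset.mul_sum, mul_assoc]

theorem cbs_smul (n : ℕ) (r : ℂ) (c : ℕ → ℂ) (u : ℂ) :
    cbs a n (r • c) u = conj r * cbs a n c u := by
  simp only [cbs, Pi.smul_apply, smul_eq_mul, Finset.mul_sum, mul_assoc, map_mul]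

theorem cb_single (n : ℕ) (u : ℂ) : cb a n (Pi.single n 1) u = bp a n u := by
  rw [cb, Finset.sum_eq_single_of_mem n (Finset.self_mem_range_succ n)]
  · simp
  · intro k _ hk
    simp [Pi.single_eq_of_ne hk]

/-- Coefficients obtained by orthogonalization of `B_0, B_1, …` in `L²(ν)`. -/
def gsPoly (a : ℕ → ℂ) (ν : Measure ℂ) (n : ℕ) (q : ℕ → ℕ → ℂ) : ℕ → ℂ :=
  Pi.single (n + 1) 1 - ∑ k : Fin (n + 1),
    (∫ t, conj (cb a k (q k) t) * bp a (n + 1) t ∂ν) • q k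

theorem gsPoly_apply_of_lt {n : ℕ} {q : ℕ → ℕ → ℂ} (hq : ∀ k ≤ n, ∀ j, k < j → q k j = 0) {j : ℕ}
    (hj : n < j) : gsPoly a ν n q j = (Pi.single (n + 1) 1 : ℕ → ℂ) j := by
  rw [gsPoly, Pi.sub_apply, Finset.sum_apply, Finset.sum_eq_zero, sub_zero]
  intro k _
  rw [Pi.smul_apply, hq k (Nat.lt_succ_iff.1 k.2) j (by omega), smul_zero]

theorem cb_gsPoly {n : ℕ} {q : ℕ → ℕ → ℂ} (hq : ∀ k ≤ n, ∀ j, k < j → q k j = 0) (u : ℂ) :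
    cb a (n + 1) (gsPoly a ν n q) u = bp a (n + 1) u - ∑ k : Fin (n + 1),
      (∫ t, conj (cb a k (q k) t) * bp a (n + 1) t ∂ν) * cb a k (q k) u := by
  have h : ∀ k : Fin (n + 1), cb a k (q k) u = cb a (n + 1) (q k) u := fun k =>
    (cb_of_supp (by omega) (hq k (Nat.lt_succ_iff.1 k.2)) u).symm
  simp only [h]
  rw [← cb_single, gsPoly]
  simp only [cb, Pi.sub_apply, Finset.sum_apply, Pi.smul_apply, smul_eq_mul, sub_mul,
    Finset.sum_sub_distrib, Finset.sum_mul, Finset.mul_sum]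
  congr 1
  rw [Finset.sum_comm]
  simp only [mul_assoc]

variable [IsProbabilityMeasure ν] (hν : ν (Metric.sphere 0 1)ᶜ = 0) (ha : ∀ k, ‖a k‖ < 1)
include hν ha

omit hν ha [IsProbabilityMeasure ν] in
theorem IsORF.integral_mul_conj {j k : ℕ} {c d : ℕ → ℂ} (hc : IsORF a ν j c) (hd : IsORF a ν k d)
    (hjk : j ≠ k) : ∫ u, cb a j c u * conj (cb a k d u) ∂ν = 0 := by
  rcases lt_or_gt_of_ne hjk with h | h
  · have h1 := hd.orth _ ((Lsp.cb j c).mono h)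
    rw [← map_eq_zero (starRingEnd ℂ), ← integral_conj] at h1
    rw [← h1]
    refine integral_congr_ae (Eventually.of_forall fun u => ?_)
    simp [mul_comm]
  · exact hc.orth _ ((Lsp.cb k d).mono h)

/-- Orthogonality to the orthonormal functions implies orthogonality to their span. -/
theorem orthogonal_of_forall_cb {n : ℕ} {q : ℕ → ℕ → ℂ} (hq : ∀ k ≤ n, IsORF a ν k (q k))
    {f : ℂ → ℂ} (hf : ContinuousOn f (Metric.sphere 0 1))
    (h : ∀ k ≤ n, ∫ u, f u * conj (cb a k (q k) u) ∂ν = 0) {g : ℂ → ℂ} (hg : Lsp a (n + 1) g) :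
    ∫ u, f u * conj (g u) ∂ν = 0 := by
  refine integral_mul_conj_eq_zero_of_forall_bp ha hν hf (fun k hk => ?_) hg
  induction k using Nat.strong_induction_on with
  | _ k ih =>
    have h1 := integral_mul_conj_cb hν ha hf (n := k) (fun g hg =>
      integral_mul_conj_eq_zero_of_forall_bp ha hν hf (fun j hj => ih j hj (by omega)) hg) (q k)
    rw [h k (by omega)] at h1
    refine (mul_eq_zero.1 h1.symm).resolve_left ?_
    simpa using (hq k (by omega)).coeff_ne_zero

theorem gsPoly_orthogonal {n : ℕ} {q : ℕ → ℕ → ℂ} (hq : ∀ k ≤ n, IsORF a ν k (q k)) {g : ℂ → ℂ}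
    (hg : Lsp a (n + 1) g) :
    ∫ u, cb a (n + 1) (gsPoly a ν n q) u * conj (g u) ∂ν = 0 := by
  refine orthogonal_of_forall_cb hν ha hq (continuousOn_cb_sphere ha _ _) (fun j hj => ?_) hg
  have hcj := continuousOn_conj (continuousOn_cb_sphere ha j (q j))
  have i0 : Integrable (fun u => bp a (n + 1) u * conj (cb a j (q j) u)) ν :=
    integrable_of_continuousOn_sphere hν ((continuousOn_bp_sphere ha (n + 1)).mul hcj)
  have i1 : ∀ k, Integrable (fun u => cb a k (q k) u * conj (cb a j (q j) u)) ν := fun k =>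
    integrable_of_continuousOn_sphere hν ((continuousOn_cb_sphere ha k (q k)).mul hcj)
  have h1 : ∀ u, cb a (n + 1) (gsPoly a ν n q) u * conj (cb a j (q j) u) =
      bp a (n + 1) u * conj (cb a j (q j) u) - ∑ k : Fin (n + 1),
        (∫ t, conj (cb a k (q k) t) * bp a (n + 1) t ∂ν) *
          (cb a k (q k) u * conj (cb a j (q j) u)) := fun u => by
    rw [cb_gsPoly fun k hk => (hq k hk).supp, sub_mul, Finset.sum_mul]
    simp only [mul_assoc]
  simp only [h1]
  have i2 : Integrable (fun u => ∑ k : Fin (n + 1),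
      (∫ t, conj (cb a k (q k) t) * bp a (n + 1) t ∂ν) *
        (cb a k (q k) u * conj (cb a j (q j) u))) ν :=
    integrable_finsetSum _ fun k _ => (i1 k).const_mul _
  have i3 : ∀ k : Fin (n + 1), Integrable (fun u =>
      (∫ t, conj (cb a k (q k) t) * bp a (n + 1) t ∂ν) *
        (cb a k (q k) u * conj (cb a j (q j) u))) ν := fun k => (i1 k).const_mul _
  rw [integral_sub i0 i2, integral_finsetSum _ fun k _ => i3 k]
  simp only [integral_const_mul]
  rw [Finset.sum_eq_single ⟨j, by omega⟩]
  · simp only [(hq j hj).norm, mul_one]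
    rw [sub_eq_zero]
    exact integral_congr_ae (Eventually.of_forall fun u => mul_comm _ _)
  · intro k _ hk
    rw [(hq k (Nat.lt_succ_iff.1 k.2)).integral_mul_conj (hq j hj) fun h => hk (Fin.ext h),
      mul_zero]
  · simp

end CircleORF

end RatKhrushchev

end

/-! ### The normalized functions, and recurrences for their Cauchy transforms. -/

noncomputable section

namespace RatKhrushchev

/-- Coefficients of the orthonormal rational functions on the disk, normalized so that
`Φ_{n+1}^*(a_n) ϖ_{n+1}(a_n) / (ϖ_n(a_n) Φ_n^*(a_n)) > 0`. -/
def diskCoeff (a : ℕ → ℂ) (ν : Measure ℂ) : ℕ → ℕ → ℂ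
  | 0 => Pi.single 0 1
  | n + 1 =>
    let φ : ℕ → ℂ := Pi.single (n + 1) 1 - ∑ k : Fin (n + 1),
      (∫ t, conj (cb a k (diskCoeff a ν k) t) * bp a (n + 1) t ∂ν) • diskCoeff a ν k
    let w : ℂ := cbs a (n + 1) φ (a n) * vp (a (n + 1)) (a n) /
      (vp (a n) (a n) * cbs a n (diskCoeff a ν n) (a n))
    (w / ‖w‖ / (Real.sqrt (∫ t, ‖cb a (n + 1) φ t‖ ^ 2 ∂ν) : ℂ)) • φ

section CircleORF

variable {a : ℕ → ℂ} {ν : Measure ℂ}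

theorem diskCoeff_succ (n : ℕ) : diskCoeff a ν (n + 1) =
    ((cbs a (n + 1) (gsPoly a ν n (diskCoeff a ν)) (a n) * vp (a (n + 1)) (a n) /
      (vp (a n) (a n) * cbs a n (diskCoeff a ν n) (a n))) /
      ‖cbs a (n + 1) (gsPoly a ν n (diskCoeff a ν)) (a n) * vp (a (n + 1)) (a n) /
        (vp (a n) (a n) * cbs a n (diskCoeff a ν n) (a n))‖ /
      (Real.sqrt (∫ t, ‖cb a (n + 1) (gsPoly a ν n (diskCoeff a ν)) t‖ ^ 2 ∂ν) : ℂ)) •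
      gsPoly a ν n (diskCoeff a ν) := by
  rw [diskCoeff]
  rfl

variable (ha : ∀ k, ‖a k‖ < 1)
include ha

theorem cbs_eq_conj_mul_of_cb_eq {n : ℕ} {c d : ℕ → ℂ} {r : ℂ}
    (h : ∀ u, ‖u‖ ≤ 1 → cb a n c u = r * cb a n d u) {u : ℂ} (hu : ‖u‖ ≤ 1) :
    cbs a n c u = conj r * cbs a n d u := by
  refine eq_on_closedBall_of_eq_on_sphere (g := fun u => conj r * cbs a n d u)
    ((Lsp.cbs ha _ _).diffContOnCl ha) (((Lsp.cbs ha n d).const_mul _).diffContOnCl ha)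
    (fun v hv => ?_) hu
  rw [cbs_eq_of_norm_eq_one ha hv, cbs_eq_of_norm_eq_one ha hv, h v hv.le, map_mul]
  ring

variable [IsProbabilityMeasure ν] (hν : ν (Metric.sphere 0 1)ᶜ = 0)
include hν

omit ha in
theorem isORF_diskCoeff_zero : IsORF a ν 0 (diskCoeff a ν 0) := by
  have h : ∀ u, cb a 0 (diskCoeff a ν 0) u = 1 := fun u => by simp [cb, diskCoeff, bp]
  refine ⟨fun k hk => ?_, fun g hg => ?_, ?_⟩
  · rw [diskCoeff, Pi.single_eq_of_ne (by omega)]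
  · rw [integral_congr_of_norm_eq_one hν (g := fun _ => 0) fun u hu => ?_]
    · simp
    · obtain ⟨c, hc⟩ := hg
      rw [hc u hu.le]
      simp
  · simp [h]

/-- The recurrence relation of the orthonormal rational functions, up to a positive factor. -/
theorem diskCoeff_succ_eq {n : ℕ} (hq : ∀ k ≤ n, IsORF a ν k (diskCoeff a ν k))
    (hn : ∀ s : Finset ℂ, s.card ≤ n + 1 → ν (s : Set ℂ)ᶜ ≠ 0) {Λ : ℂ} {d : ℕ → ℂ}
    (hd : ∀ u, ‖u‖ ≤ 1 → cbs a (n + 1) d u = vp (a n) u / vp (a (n + 1)) u *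
        (Λ * (zfac .disk (a (n + 1)) * conj (zfac .disk (a n)) * bf (a n) u *
          cb a n (diskCoeff a ν n) u) + cbs a n (diskCoeff a ν n) u))
    (ho : ∀ g, Lsp a (n + 1) g → ∫ u, cb a (n + 1) d u * conj (g u) ∂ν = 0) :
    ∃ e : ℝ, 0 < e ∧ IsORF a ν (n + 1) (diskCoeff a ν (n + 1)) ∧
      (∀ u, ‖u‖ ≤ 1 → cb a (n + 1) (diskCoeff a ν (n + 1)) u = e * cb a (n + 1) d u) ∧
      (∀ u, ‖u‖ ≤ 1 → cbs a (n + 1) (diskCoeff a ν (n + 1)) u = e * cbs a (n + 1) d u) := by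
  set φ := gsPoly a ν n (diskCoeff a ν) with hφ
  set D := d (n + 1) with hD
  set I : ℝ := ∫ u, ‖cb a (n + 1) d u‖ ^ 2 ∂ν with hI
  have hII := integral_mul_conj_self (ν := ν) (cb a (n + 1) d)
  have hne := recurrence_ne_zero hν ha (hq n le_rfl) hn hd
  rw [hII] at hne
  have hI0 : 0 < I := lt_of_le_of_ne (integral_nonneg fun u => by positivity)
    fun h => hne (by rw [← hI, ← h]; simp)
  have hφ1 : φ (n + 1) = 1 := by
    rw [hφ, gsPoly_apply_of_lt (fun k hk => (hq k hk).supp) (Nat.lt_succ_self n)]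
    simp
  -- The Gram-Schmidt vector and the recurrence candidate are orthogonal to the same span, so they
  -- are proportional; `φ` has leading coefficient `1`.
  have hdD : ∀ u, ‖u‖ ≤ 1 → cb a (n + 1) d u = D * cb a (n + 1) φ u := fun u hu =>
    eq_coeff_mul_of_orthogonal hν ha hn hφ1 (fun g hg => gsPoly_orthogonal hν ha hq hg) ho hu
  have hD0 : D ≠ 0 := by
    intro h0
    apply hI0.ne'
    rw [hI, integral_congr_ae (g := fun _ => 0)]
    · simp
    · filter_upwards [ae_norm_eq_one hν] with u hu
      rw [hdD u hu.le, h0]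
      simp
  have hφd : ∀ u, ‖u‖ ≤ 1 → cb a (n + 1) φ u = D⁻¹ * cb a (n + 1) d u := fun u hu => by
    rw [hdD u hu]
    field_simp
  have hφds := fun u hu => cbs_eq_conj_mul_of_cb_eq ha hφd (u := u) hu
  -- For the candidate itself the normalizing quotient is exactly `1`. Hence the phase `w / ‖w‖`
  -- cancels that of `D⁻¹`, and a positive factor is left.
  have hw : cbs a (n + 1) φ (a n) * vp (a (n + 1)) (a n) /
      (vp (a n) (a n) * cbs a n (diskCoeff a ν n) (a n)) = conj D⁻¹ := by
    have h4 := vp_ne_zero (ha n) (ha n).le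
    have h5 := vp_ne_zero (ha (n + 1)) (ha n).le
    have h6 : conj (diskCoeff a ν n n) ≠ 0 := by simpa using (hq n le_rfl).coeff_ne_zero
    rw [hφds _ (ha n).le, hd _ (ha n).le, bf_self, cbs_self]
    field_simp
    ring
  have hsqrt : Real.sqrt (∫ t, ‖cb a (n + 1) φ t‖ ^ 2 ∂ν) = ‖D‖⁻¹ * Real.sqrt I := by
    have h1 : ∫ t, ‖cb a (n + 1) φ t‖ ^ 2 ∂ν = ‖D‖⁻¹ ^ 2 * I := by
      rw [hI, ← integral_const_mul]
      refine integral_congr_ae ?_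
      filter_upwards [ae_norm_eq_one hν] with u hu
      rw [hφd u hu.le, norm_mul, norm_inv, mul_pow]
    rw [h1, Real.sqrt_mul (by positivity), Real.sqrt_sq (by positivity)]
  have hDn : (‖D‖ : ℂ) ≠ 0 := by simpa using hD0
  have hsI : (Real.sqrt I : ℂ) ≠ 0 := by
    rw [Complex.ofReal_ne_zero]
    exact (Real.sqrt_pos.2 hI0).ne'
  obtain ⟨l, hl, hlD⟩ : ∃ l : ℂ, diskCoeff a ν (n + 1) = l • φ ∧
      l * D⁻¹ = ((1 / Real.sqrt I : ℝ) : ℂ) := by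
    refine ⟨_, diskCoeff_succ n, ?_⟩
    rw [← hφ, hw, hsqrt, RCLike.norm_conj, norm_inv]
    have h1 : conj D⁻¹ * D⁻¹ = (‖D‖ : ℂ)⁻¹ * (‖D‖ : ℂ)⁻¹ := by
      rw [mul_comm, Complex.mul_conj, Complex.normSq_eq_norm_sq, norm_inv]
      push_cast
      ring
    rw [div_mul_eq_mul_div, div_mul_eq_mul_div, h1]
    push_cast
    field_simp
  have hcb : ∀ u, ‖u‖ ≤ 1 → cb a (n + 1) (diskCoeff a ν (n + 1)) u =
      ((1 / Real.sqrt I : ℝ) : ℂ) * cb a (n + 1) d u := fun u hu => by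
    rw [hl, cb_smul, hφd u hu, ← mul_assoc, hlD]
  refine ⟨1 / Real.sqrt I, by positivity, ⟨fun k hk => ?_, fun g hg => ?_, ?_⟩, hcb,
    fun u hu => ?_⟩
  · rw [hl, Pi.smul_apply, hφ, gsPoly_apply_of_lt (fun k hk => (hq k hk).supp) (by omega),
      Pi.single_eq_of_ne (by omega), smul_zero]
  · rw [integral_congr_of_norm_eq_one hν (g := fun u => ((1 / Real.sqrt I : ℝ) : ℂ) *
      (cb a (n + 1) d u * conj (g u))) (fun u hu => by rw [hcb u hu.le, mul_assoc]),
      integral_const_mul, ho g hg, mul_zero]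
  · rw [integral_congr_of_norm_eq_one hν (g := fun u => ((1 / Real.sqrt I : ℝ) : ℂ) ^ 2 *
      (cb a (n + 1) d u * conj (cb a (n + 1) d u))) (fun u hu => by
        rw [hcb u hu.le, map_mul, Complex.conj_ofReal]; ring),
      integral_const_mul, hII, ← hI]
    norm_cast
    rw [div_pow, Real.sq_sqrt hI0.le]
    field_simp
  · rw [cbs_eq_conj_mul_of_cb_eq ha hcb hu, Complex.conj_ofReal]

/-- Recurrence of the first Cauchy transform. -/
theorem xT_recurrence (ha0 : a 0 = 0) {n : ℕ} {c c' : ℕ → ℂ} {Λ : ℂ} {e : ℝ} (he : 0 < e)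
    (hc' : IsORF a ν (n + 1) c')
    (h : ∀ u, ‖u‖ ≤ 1 → cb a (n + 1) c' u = e * (vp (a n) u / vp (a (n + 1)) u *
        (zfac .disk (a (n + 1)) * conj (zfac .disk (a n)) * bf (a n) u * cb a n c u +
          conj Λ * cbs a n c u))) {z : ℂ} (hz : ‖z‖ < 1) :
    xT a ν (n + 1) c' z = e * (vp (a n) z / vp (a (n + 1)) z *
      (zfac .disk (a (n + 1)) * conj (zfac .disk (a n)) * xT a ν n c z +
        conj Λ * yT a ν n c z)) := by
  set zN := zfac .disk (a (n + 1)) with hzN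
  set zn := zfac .disk (a n) with hzn
  have he0 : (e : ℂ) ≠ 0 := by simpa using he.ne'
  have hvz := vp_ne_zero (ha (n + 1)) hz.le
  -- On the circle `conj B_n / ϖ_n` is the conjugate of `z_n u / ϖ_n * B_{n-1}`, or of `1` when `n =
  -- 0`, where `a 0 = 0` gives `ϖ_0 = 1`.
  obtain ⟨g, hg, hgu⟩ : ∃ g, Lsp a (n + 1) g ∧ ∀ u, ‖u‖ = 1 →
      conj (g u) = conj (bp a n u) / vp (a n) u := by
    rcases n with _ | m
    · refine ⟨_, Lsp.bp (Nat.lt_succ_self 0), fun u _ => by simp [ha0, vp]⟩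
    · refine ⟨_, ((Lsp.bp (Nat.lt_succ_self m)).affine_div_mul ha 0 1).const_mul
        (zfac .disk (a (m + 1))), fun u hu => ?_⟩
      have h1 := vp_ne_zero (ha (m + 1)) hu.le
      have h2 : u - a (m + 1) ≠ 0 := sub_ne_zero_of_norm hu (ha _)
      have hu0 : u ≠ 0 := by rintro rfl; simp at hu
      have h3 : (starRingEnd ℂ) (vp (a (m + 1)) u) / conj u = u - a (m + 1) := by
        rw [conj_vp_of_norm_eq_one hu]
        have : conj u ≠ 0 := by simpa using hu0
        field_simp
      rw [← Complex.conj_conj (vp (a (m + 1)) u), ← map_div₀, Complex.conj_conj]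
      congr 1
      rw [conj_vp_of_norm_eq_one hu, bp_succ, bf]
      have h4 := mul_conj_of_norm_eq_one hu
      have hcu : conj u ≠ 0 := by simpa using hu0
      field_simp
      linear_combination (zfac .disk (a (m + 1)) * bp a m u) * h4
  -- Replacing `ϖ_n / ϖ_{n+1}` at `u` by its value at `z` costs a multiple of `u - z`. This cancels
  -- the Cauchy kernel and leaves an inner product of `Φ_{n+1}` with `g`, which is zero. The term `0
  -- * 0` only fits the shape of `integral_lincomb_four`.
  have key : ∀ u, ‖u‖ = 1 →
      2 * bf (a (n + 1)) u * cb a (n + 1) c' u * conj (bp a (n + 1) u) / (u - z) =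
      (e * (vp (a n) z / vp (a (n + 1)) z) * (zN * conj zn)) *
          (2 * bf (a n) u * cb a n c u * conj (bp a n u) / (u - z)) +
        (e * (vp (a n) z / vp (a (n + 1)) z) * conj Λ) * (2 * conj (cb a n c u) / (u - z)) +
        ((2 * (conj (a (n + 1)) - conj (a n)) / vp (a (n + 1)) z) *
          (cb a (n + 1) c' u * conj (g u)) + 0 * 0) := by
    intro u hu
    have hv0 := vp_ne_zero (ha n) hu.le
    have hv1 := vp_ne_zero (ha (n + 1)) hu.le
    have huz : u - z ≠ 0 := sub_ne_zero_of_norm hu hz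
    rw [hgu u hu, ← conj_bp_mul_cbs ha hu n c, bp_succ, map_mul]
    have h1 := bf_mul_conj (ha (n + 1)) hu
    have h2 : vp (a n) u * vp (a (n + 1)) z - vp (a n) z * vp (a (n + 1)) u =
      (u - z) * (conj (a (n + 1)) - conj (a n)) := by
      unfold vp
      ring
    have h3 : 2 * bf (a (n + 1)) u * cb a (n + 1) c' u *
        (conj (bp a n u) * conj (bf (a (n + 1)) u)) / (u - z) =
        2 * cb a (n + 1) c' u * conj (bp a n u) / (u - z) := by
      congr 1
      linear_combination (2 * cb a (n + 1) c' u * conj (bp a n u)) * h1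
    rw [h3, h u hu.le]
    field_simp
    linear_combination (2 * e * conj (bp a n u)) *
      (zN * conj zn * bf (a n) u * cb a n c u + conj Λ * cbs a n c u) * h2
  have i1 := integrable_of_continuousOn_sphere hν
    (continuousOn_div_sub (continuousOn_xT_density ha n c) hz)
  have i2 := integrable_of_continuousOn_sphere hν
    (continuousOn_div_sub (continuousOn_yT_density ha n c) hz)
  have i3 := integrable_of_continuousOn_sphere hν ((continuousOn_cb_sphere ha (n + 1) c').mul
    (continuousOn_conj (hg.continuousOn_sphere ha)))
  rw [xT, integral_congr_of_norm_eq_one hν key]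
  refine (integral_lincomb_four i1 i2 i3 (integrable_zero ℂ ℂ ν) _ _ _ _).trans ?_
  simp only [Pi.mul_apply]
  rw [hc'.orth g hg]
  change _ * xT a ν n c z + _ * yT a ν n c z + _ = _
  ring

/-- Recurrence of the second Cauchy transform. -/
theorem yT_recurrence {n : ℕ} {c c' : ℕ → ℂ} {Λ : ℂ} {e : ℝ}
    (hΛ : Λ * (zfac .disk (a (n + 1)) * conj (zfac .disk (a n))) * xT a ν n c (a (n + 1)) +
      yT a ν n c (a (n + 1)) = 0)
    (h : ∀ u, ‖u‖ ≤ 1 → cbs a (n + 1) c' u = e * (vp (a n) u / vp (a (n + 1)) u *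
        (Λ * (zfac .disk (a (n + 1)) * conj (zfac .disk (a n)) * bf (a n) u * cb a n c u) +
          cbs a n c u))) {z : ℂ} (hz : ‖z‖ < 1) :
    bf (a (n + 1)) z * yT a ν (n + 1) c' z = e * (vp (a n) z / vp (a (n + 1)) z *
      (Λ * (zfac .disk (a (n + 1)) * conj (zfac .disk (a n))) * xT a ν n c z +
        yT a ν n c z)) := by
  set zN := zfac .disk (a (n + 1)) with hzN
  set zn := zfac .disk (a n) with hzn
  have hzN1 : zN * conj zN = 1 := zfac_disk_mul_conj (ha _)
  set b := a (n + 1) with hb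
  have hbn : ‖b‖ < 1 := ha _
  have hvz := vp_ne_zero hbn hz.le
  -- Here `conj ζ_b / ϖ_b` supplies the pole `1 / (u - b)`. Partial fractions split the product with
  -- `1 / (u - z)` into transforms at `z` and at `b`, and the latter cancel by the choice of `Λ`.
  have key : ∀ u, ‖u‖ = 1 → bf b z * (2 * conj (cb a (n + 1) c' u) / (u - z)) =
      (e * (vp (a n) z / vp b z) * (Λ * (zN * conj zn))) *
          (2 * bf (a n) u * cb a n c u * conj (bp a n u) / (u - z)) +
        (e * (vp (a n) z / vp b z)) * (2 * conj (cb a n c u) / (u - z)) +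
      ((-e * vp (a n) b / vp b z * (Λ * (zN * conj zn))) *
          (2 * bf (a n) u * cb a n c u * conj (bp a n u) / (u - b)) +
        (-e * vp (a n) b / vp b z) * (2 * conj (cb a n c u) / (u - b))) := by
    intro u hu
    have hv0 := vp_ne_zero (ha n) hu.le
    have hv1 := vp_ne_zero hbn hu.le
    have huz : u - z ≠ 0 := sub_ne_zero_of_norm hu hz
    have hub : u - b ≠ 0 := sub_ne_zero_of_norm hu hbn
    have h4 := bf_mul_conj (ha (n + 1)) hu
    have h5 := vp_mul_bf ha hu.le (n + 1)
    rw [← hb] at h4 h5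
    have h7 : conj (bf b u) / vp b u = conj zN / (u - b) := by
      rw [div_eq_div_iff hv1 hub]
      have h8 : zN * (conj (bf b u) * (u - b) - conj zN * vp b u) = 0 := by
        linear_combination -conj (bf b u) * h5 + vp b u * h4 - vp b u * hzN1
      have hz0 : zN ≠ 0 := zfac_disk_ne_zero hbn
      exact sub_eq_zero.1 ((mul_eq_zero.1 h8).resolve_left hz0)
    have h9 : (z - b) * vp (a n) u - (u - b) * vp (a n) z = -(u - z) * vp (a n) b := by
      unfold vp
      ring
    rw [← conj_bp_mul_cbs ha hu (n + 1) c', h u hu.le, ← conj_bp_mul_cbs ha hu n c, bp_succ,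
      map_mul, ← hb]
    calc _ = e * 2 * bf b z * (conj (bf b u) / vp b u) * vp (a n) u * conj (bp a n u) *
          (Λ * (zN * conj zn * bf (a n) u * cb a n c u) + cbs a n c u) / (u - z) := by
          field_simp
      _ = e * 2 * (zN * conj zN) * (z - b) * vp (a n) u / (vp b z * (u - b)) * conj (bp a n u) *
          (Λ * (zN * conj zn * bf (a n) u * cb a n c u) + cbs a n c u) / (u - z) := by
          rw [h7, bf, ← hzN]
          field_simp
      _ = _ := by
          rw [hzN1]
          field_simp
          linear_combination (e * conj (bp a n u)) *
            (Λ * (zN * conj zn * bf (a n) u * cb a n c u) + cbs a n c u) * h9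
  have i1 := integrable_of_continuousOn_sphere hν
    (continuousOn_div_sub (continuousOn_xT_density ha n c) hz)
  have i2 := integrable_of_continuousOn_sphere hν
    (continuousOn_div_sub (continuousOn_yT_density ha n c) hz)
  have i3 := integrable_of_continuousOn_sphere hν
    (continuousOn_div_sub (continuousOn_xT_density ha n c) hbn)
  have i4 := integrable_of_continuousOn_sphere hν
    (continuousOn_div_sub (continuousOn_yT_density ha n c) hbn)
  rw [yT, ← integral_const_mul, integral_congr_of_norm_eq_one hν key]
  refine (integral_lincomb_four i1 i2 i3 i4 _ _ _ _).trans ?_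
  change _ * xT a ν n c z + _ * yT a ν n c z + (_ * xT a ν n c b + _ * yT a ν n c b) = _
  linear_combination (-e * vp (a n) b / vp b z) * hΛ

end CircleORF

end RatKhrushchev

end

/-! ### The Schwarz lemma and the induction step for iterates and orthogonal functions. -/

noncomputable section

namespace RatKhrushchev

/-- A Blaschke factor is unimodular on the circle, so the set where its modulus is at most `c < 1`
is a compact part of the open disk. -/
theorem exists_le_norm_bf {a : ℂ} (ha : ‖a‖ < 1) {c : ℝ} (hc : c < 1) :
    ∃ r < 1, ∀ w : ℂ, r < ‖w‖ → ‖w‖ ≤ 1 → c < ‖bf a w‖ := by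
  set K := {w ∈ Metric.closedBall (0 : ℂ) 1 | ‖bf a w‖ ≤ c} with hK
  have hKc : IsCompact K :=
    (isCompact_closedBall (0 : ℂ) 1).of_isClosed_subset
      ((continuousOn_bf ha).norm.preimage_isClosed_of_isClosed Metric.isClosed_closedBall
        isClosed_Iic) fun w hw => hw.1
  rcases K.eq_empty_or_nonempty with h | h
  · refine ⟨0, zero_lt_one, fun w _ hw => ?_⟩
    by_contra hcw
    exact Set.notMem_empty w (h ▸ ⟨by simpa using hw, not_lt.1 hcw⟩)
  · obtain ⟨w₀, hw₀, hmax⟩ := hKc.exists_isMaxOn h continuous_norm.continuousOn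
    refine ⟨‖w₀‖, lt_of_le_of_ne (by simpa using hw₀.1) fun h1 => ?_, fun w hw1 hw => ?_⟩
    · have := hw₀.2
      rw [norm_bf_of_norm_eq_one ha h1] at this
      linarith
    · by_contra hcw
      exact absurd (hmax (show w ∈ K from ⟨by simpa using hw, not_lt.1 hcw⟩)) (not_le.2 hw1)

/-- The Schwarz lemma for a Blaschke factor. -/
theorem norm_le_one_of_norm_bf_mul_le {a : ℂ} (ha : ‖a‖ < 1) {g : ℂ → ℂ}
    (hg : DifferentiableOn ℂ g (Metric.ball 0 1))
    (h : ∀ z, ‖z‖ < 1 → ‖bf a z * g z‖ ≤ 1) {z : ℂ} (hz : ‖z‖ < 1) : ‖g z‖ ≤ 1 := by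
  -- On a circle close to the boundary `‖bf a‖ > c`, so the maximum principle bounds `g` by `1 / c`
  -- inside; then `c` tends to `1`.
  have key : ∀ c : ℝ, 0 < c → c < 1 → c * ‖g z‖ ≤ 1 := by
    intro c hc0 hc
    obtain ⟨r, hr, hrw⟩ := exists_le_norm_bf ha hc
    obtain ⟨s, hs, hs1⟩ := exists_between (max_lt hr hz)
    have hzs : ‖z‖ < s := (le_max_right _ _).trans_lt hs
    have hs0 : s ≠ 0 := ((norm_nonneg z).trans_lt hzs).ne'
    have hsub : Metric.closedBall (0 : ℂ) s ⊆ Metric.ball 0 1 := Metric.closedBall_subset_ball hs1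
    have h1 : ‖g z‖ ≤ 1 / c := by
      refine Complex.norm_le_of_forall_mem_frontier_norm_le (U := Metric.ball 0 s)
        Metric.isBounded_ball ⟨hg.mono (Metric.ball_subset_closedBall.trans hsub), ?_⟩
        (fun w hw => ?_) (subset_closure (by simpa using hzs))
      · rw [closure_ball _ hs0]
        exact hg.continuousOn.mono hsub
      · rw [frontier_ball _ hs0, mem_sphere_zero_iff_norm] at hw
        have h2 := h w (by rw [hw]; exact hs1)
        have h3 := hrw w (by rw [hw]; exact (le_max_left _ _).trans_lt hs) (by rw [hw]; exact hs1.le)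
        rw [norm_mul] at h2
        rw [le_div_iff₀ hc0]
        nlinarith [norm_nonneg (g w)]
    rwa [le_div_iff₀ hc0, mul_comm] at h1
  have ht : Tendsto (fun c : ℝ => c * ‖g z‖) (𝓝[<] 1) (𝓝 (1 * ‖g z‖)) :=
    (tendsto_id.mono_left nhdsWithin_le_nhds).mul_const _
  rw [one_mul] at ht
  refine le_of_tendsto ht ?_
  filter_upwards [Ioo_mem_nhdsLT (zero_lt_one' ℝ)] with c hc using key c hc.1 hc.2

theorem norm_sub_sq_sub_norm_sub_sq (x y γ : ℂ) :
    ‖x - conj γ * y‖ ^ 2 - ‖y - γ * x‖ ^ 2 = (1 - ‖γ‖ ^ 2) * (‖x‖ ^ 2 - ‖y‖ ^ 2) := by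
  simp only [← Complex.normSq_eq_norm_sq, Complex.normSq_apply, Complex.sub_re, Complex.sub_im,
    Complex.mul_re, Complex.mul_im, Complex.conj_re, Complex.conj_im]
  ring

/-- A disk automorphism is bounded by one. -/
theorem norm_sub_mul_le {x y γ : ℂ} (hγ : ‖γ‖ ≤ 1) (h : ‖y‖ ≤ ‖x‖) :
    ‖y - γ * x‖ ≤ ‖x - conj γ * y‖ := by
  have key := norm_sub_sq_sub_norm_sub_sq x y γ
  have h1 : 0 ≤ (1 - ‖γ‖ ^ 2) * (‖x‖ ^ 2 - ‖y‖ ^ 2) :=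
    mul_nonneg (by nlinarith [norm_nonneg γ]) (by nlinarith [norm_nonneg y])
  exact (pow_le_pow_iff_left₀ (norm_nonneg _) (norm_nonneg _) two_ne_zero).1 (by linarith)

theorem sub_conj_mul_ne_zero {x y γ : ℂ} (hγ : ‖γ‖ < 1) (h : ‖y‖ ≤ ‖x‖) (hx : x ≠ 0) :
    x - conj γ * y ≠ 0 := by
  intro h0
  have h1 := congrArg norm (sub_eq_zero.1 h0)
  rw [norm_mul, RCLike.norm_conj] at h1
  nlinarith [norm_nonneg y, norm_pos_iff.2 hx, norm_nonneg γ]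

section CircleORF

variable {a : ℕ → ℂ} {ν : Measure ℂ}

/-- The iterates on the disk, as quotients of Cauchy transforms. -/
def diskIterate (a : ℕ → ℂ) (ν : Measure ℂ) (n : ℕ) (z : ℂ) : ℂ :=
  zfac .disk (a n) * yT a ν n (diskCoeff a ν n) z / xT a ν n (diskCoeff a ν n) z

/-- The facts about the orthonormal rational functions proved by induction. -/
structure OrfData (a : ℕ → ℂ) (ν : Measure ℂ) (n : ℕ) : Prop where
  isORF : ∀ k ≤ n, IsORF a ν k (diskCoeff a ν k)
  xT_ne_zero : ∀ z, ‖z‖ < 1 → xT a ν n (diskCoeff a ν n) z ≠ 0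
  norm_diskIterate_le : ∀ z, ‖z‖ < 1 → ‖diskIterate a ν n z‖ ≤ 1
  wronskian : ∀ z, ‖z‖ < 1 → xT a ν n (diskCoeff a ν n) z * cbs a n (diskCoeff a ν n) z -
    bf (a n) z * yT a ν n (diskCoeff a ν n) z * cb a n (diskCoeff a ν n) z =
      2 * zfac .disk (a n) * (1 - conj (a n) * a n) / vp (a n) z ^ 2

variable (ha : ∀ k, ‖a k‖ < 1)
variable [IsProbabilityMeasure ν] (hν : ν (Metric.sphere 0 1)ᶜ = 0)
include ha hν

theorem differentiableOn_xT (n : ℕ) (c : ℕ → ℂ) :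
    DifferentiableOn ℂ (xT a ν n c) (Metric.ball 0 1) :=
  differentiableOn_integral_div_sub hν (continuousOn_xT_density ha n c)

theorem differentiableOn_yT (n : ℕ) (c : ℕ → ℂ) :
    DifferentiableOn ℂ (yT a ν n c) (Metric.ball 0 1) :=
  differentiableOn_integral_div_sub hν (continuousOn_yT_density ha n c)

theorem OrfData.differentiableOn {n : ℕ} (h : OrfData a ν n) :
    DifferentiableOn ℂ (diskIterate a ν n) (Metric.ball 0 1) :=
  ((differentiableOn_yT ha hν n _).const_mul _).div (differentiableOn_xT ha hν n _)
    fun z hz => h.xT_ne_zero z (by simpa using hz)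

/-- At `z = a_n` the kernel `ζ_n / (u - a_n)` is `z_n / ϖ_n`. Modulo conjugates of the previous
span, `conj B_n / ϖ_n` equals `conj B_n / (1 - |a_n|²)`, so orthonormality gives the value. It
determines the constant in the Wronskian identity, and hence `e`. -/
theorem conj_coeff_mul_xT_self (ha0 : a 0 = 0) {n : ℕ} {c : ℕ → ℂ} (hc : IsORF a ν n c) :
    conj (c n) * xT a ν n c (a n) = 2 * zfac .disk (a n) / (1 - conj (a n) * a n) := by
  have han := one_sub_norm_sq_ne_zero (ha n)
  obtain ⟨g, hg, hgu⟩ : ∃ g, Lsp a n g ∧ ∀ u, ‖u‖ = 1 →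
      conj (bp a n u) / vp (a n) u = conj (bp a n u) / (1 - conj (a n) * a n) + conj (g u) := by
    rcases n with _ | m
    · exact ⟨_, Lsp.zero 0, fun u _ => by simp [ha0, vp]⟩
    · set b := a (m + 1) with hb
      set z := zfac .disk b with hz
      have hzz : z * conj z = 1 := zfac_disk_mul_conj (ha _)
      refine ⟨_, (Lsp.bp (Nat.lt_succ_self m)).const_mul (z * (b / (1 - conj b * b))),
        fun u hu => ?_⟩
      have h1 := vp_ne_zero (ha (m + 1)) hu.le
      have h2 : u - b ≠ 0 := sub_ne_zero_of_norm hu (ha _)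
      have hu0 : conj u ≠ 0 := by
        intro h
        rw [map_eq_zero] at h
        simp [h] at hu
      have h3 := affine_div_vp (ha (m + 1)) 0 1 hu.le
      rw [← hb] at h1 h3
      have h4 : bf b u / conj (vp b u) = z * ((0 + 1 * u) / vp b u) := by
        rw [conj_vp_of_norm_eq_one hu, bf, ← hz]
        have h5 := mul_conj_of_norm_eq_one hu
        field_simp
        linear_combination -z * h5
      have hbb : conj (1 - conj b * b) = 1 - conj b * b := by simp [mul_comm]
      rw [← Complex.conj_conj (vp b u), ← map_div₀, ← hbb, ← map_div₀, ← map_add]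
      congr 1
      rw [hbb, bp_succ, ← hb, mul_div_assoc, h4, h3, ← hz]
      have h6 : (1 : ℂ) + conj b * (b / (1 - conj b * b)) = 1 / (1 - conj b * b) := by
        field_simp
        ring
      rw [zero_add, one_mul, h6]
      linear_combination (bp a m u * bf b u / (1 - conj b * b)) * hzz
  have key : ∀ u, ‖u‖ = 1 → 2 * bf (a n) u * cb a n c u * conj (bp a n u) / (u - a n) =
      2 * zfac .disk (a n) / (1 - conj (a n) * a n) * (cb a n c u * conj (bp a n u)) +
        2 * zfac .disk (a n) * (cb a n c u * conj (g u)) := by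
    intro u hu
    have h1 := vp_ne_zero (ha n) hu.le
    have h2 : u - a n ≠ 0 := sub_ne_zero_of_norm hu (ha _)
    calc _ = 2 * zfac .disk (a n) * cb a n c u * (conj (bp a n u) / vp (a n) u) := by
          rw [bf]
          field_simp
      _ = _ := by
          rw [hgu u hu]
          ring
  have i1 := integrable_of_continuousOn_sphere hν ((continuousOn_cb_sphere ha n c).mul
    (continuousOn_conj (continuousOn_bp_sphere ha n)))
  have i2 := integrable_of_continuousOn_sphere hν ((continuousOn_cb_sphere ha n c).mul
    (continuousOn_conj (hg.continuousOn_sphere ha)))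
  have h1 : xT a ν n c (a n) = 2 * zfac .disk (a n) / (1 - conj (a n) * a n) *
      ∫ u, cb a n c u * conj (bp a n u) ∂ν := by
    rw [xT, integral_congr_of_norm_eq_one hν key]
    refine (integral_lincomb_two i1 i2 _ _).trans ?_
    simp only [Pi.mul_apply]
    rw [hc.orth g hg, mul_zero, add_zero]
  rw [h1]
  linear_combination 2 * zfac .disk (a n) / (1 - conj (a n) * a n) *
    hc.conj_coeff_mul_integral hν ha

/-- The data of one step of the recurrence, with parameter `γ`. -/
structure OrfStep (a : ℕ → ℂ) (ν : Measure ℂ) (n : ℕ) (γ : ℂ) (e : ℝ) : Prop where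
  norm_lt : ‖γ‖ < 1
  pos : 0 < e
  sq_mul : e ^ 2 * (1 - ‖γ‖ ^ 2) = (1 - ‖a (n + 1)‖ ^ 2) / (1 - ‖a n‖ ^ 2)
  cb_eq : ∀ u, ‖u‖ ≤ 1 → cb a (n + 1) (diskCoeff a ν (n + 1)) u =
    e * (vp (a n) u / vp (a (n + 1)) u) * zfac .disk (a (n + 1)) *
      (conj (zfac .disk (a n)) * bf (a n) u * cb a n (diskCoeff a ν n) u -
        conj γ * cbs a n (diskCoeff a ν n) u)
  cbs_eq : ∀ u, ‖u‖ ≤ 1 → cbs a (n + 1) (diskCoeff a ν (n + 1)) u =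
    e * (vp (a n) u / vp (a (n + 1)) u) * (cbs a n (diskCoeff a ν n) u -
      γ * (conj (zfac .disk (a n)) * bf (a n) u * cb a n (diskCoeff a ν n) u))

/-- One choice of `Λ` makes the candidate orthogonal, cancels the zero of `ζ_{n+1} Y_{n+1}` at
`a_{n+1}`, and turns the quotient `Y / X` into the next iterate. -/
theorem exists_orfStep (ha0 : a 0 = 0) {n : ℕ} (h : OrfData a ν n)
    (hn : ∀ s : Finset ℂ, s.card ≤ n + 1 → ν (s : Set ℂ)ᶜ ≠ 0) :
    OrfData a ν (n + 1) ∧ ∃ e, OrfStep a ν n (diskIterate a ν n (a (n + 1))) e ∧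
      ∀ z, ‖z‖ < 1 → bf (a (n + 1)) z * diskIterate a ν (n + 1) z =
        (diskIterate a ν n z - diskIterate a ν n (a (n + 1))) /
          (1 - conj (diskIterate a ν n (a (n + 1))) * diskIterate a ν n z) := by
  set c := diskCoeff a ν n with hc
  set c' := diskCoeff a ν (n + 1) with hc'
  set γ := diskIterate a ν n (a (n + 1)) with hγ
  set zN := zfac .disk (a (n + 1)) with hzN
  set zn := zfac .disk (a n) with hzn
  have hzN1 : zN * conj zN = 1 := zfac_disk_mul_conj (ha _)
  have hzn1 : zn * conj zn = 1 := zfac_disk_mul_conj (ha _)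
  have hzN0 : zN ≠ 0 := zfac_disk_ne_zero (ha _)
  have hzn0 : zn ≠ 0 := zfac_disk_ne_zero (ha _)
  have hczn0 : conj zn ≠ 0 := by simpa using hzn0
  set Λ := -conj zN * γ with hΛdef
  have hcΛ : conj Λ = -zN * conj γ := by simp [hΛdef]
  have hxN := h.xT_ne_zero _ (ha (n + 1))
  have hγy : zn * yT a ν n c (a (n + 1)) = γ * xT a ν n c (a (n + 1)) := by
    rw [hγ, diskIterate, div_mul_cancel₀ _ hxN]
  have hΛ : Λ * (zN * conj zn) * xT a ν n c (a (n + 1)) + yT a ν n c (a (n + 1)) = 0 := by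
    rw [hΛdef]
    linear_combination -γ * conj zn * xT a ν n c (a (n + 1)) * hzN1 + conj zn * hγy -
      yT a ν n c (a (n + 1)) * hzn1
  obtain ⟨d, -, hdc, hds⟩ := exists_coeff_recurrence ha n c Λ
  have ho := fun g hg => recurrence_orthogonal ha hν ha0 (h.isORF n le_rfl) hΛ hds (g := g) hg
  have hΛ1 := recurrence_norm_ne_one hν ha (h.isORF n le_rfl) hn hdc hds ho
  have hγ1 : ‖γ‖ < 1 := by
    refine lt_of_le_of_ne (h.norm_diskIterate_le _ (ha _)) fun h1 => hΛ1 ?_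
    rw [hΛdef, norm_mul, norm_neg, RCLike.norm_conj, norm_zfac_disk (ha _), one_mul, h1]
  obtain ⟨e, he, hN, hcb, hcbs⟩ := diskCoeff_succ_eq ha hν h.isORF hn hds ho
  have hcb' := fun u hu => (hcb u hu).trans (congrArg _ (hdc u hu))
  have hcbs' := fun u hu => (hcbs u hu).trans (congrArg _ (hds u hu))
  have hX := fun z hz => xT_recurrence ha hν ha0 he hN hcb' (z := z) hz
  have hY := fun z hz => yT_recurrence ha hν hΛ hcbs' (z := z) hz
  rw [← hzN, ← hzn] at hcb' hcbs' hX hY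
  have he0 : (e : ℂ) ≠ 0 := by simpa using he.ne'
  have hvn : ∀ z, ‖z‖ ≤ 1 → vp (a n) z ≠ 0 := fun z hz => vp_ne_zero (ha n) hz
  have hvN : ∀ z, ‖z‖ ≤ 1 → vp (a (n + 1)) z ≠ 0 := fun z hz => vp_ne_zero (ha (n + 1)) hz
  have hgn : ∀ z, ‖z‖ < 1 → zn * yT a ν n c z = diskIterate a ν n z * xT a ν n c z := fun z hz => by
    rw [diskIterate, div_mul_cancel₀ _ (h.xT_ne_zero z hz)]
  have hden : ∀ z, ‖z‖ < 1 → 1 - conj γ * diskIterate a ν n z ≠ 0 := fun z hz =>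
    sub_conj_mul_ne_zero hγ1 (by simpa using h.norm_diskIterate_le z hz) one_ne_zero
  have hX' : ∀ z, ‖z‖ < 1 → xT a ν (n + 1) c' z = e * (vp (a n) z / vp (a (n + 1)) z) *
      (zN * conj zn) * xT a ν n c z * (1 - conj γ * diskIterate a ν n z) := fun z hz => by
    rw [hX z hz, hcΛ]
    linear_combination (e * (vp (a n) z / vp (a (n + 1)) z) * zN * conj γ) *
      (-conj zn * hgn z hz + yT a ν n c z * hzn1)
  have hY' : ∀ z, ‖z‖ < 1 → zN * (bf (a (n + 1)) z * yT a ν (n + 1) c' z) =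
      e * (vp (a n) z / vp (a (n + 1)) z) *
      (zN * conj zn) * xT a ν n c z * (diskIterate a ν n z - γ) := fun z hz => by
    rw [hY z hz, hΛdef]
    linear_combination (e * (vp (a n) z / vp (a (n + 1)) z)) * zN *
      (conj zn * hgn z hz - yT a ν n c z * hzn1 - γ * conj zn * xT a ν n c z * hzN1)
  have hX0 : ∀ z, ‖z‖ < 1 → xT a ν (n + 1) c' z ≠ 0 := fun z hz => by
    rw [hX' z hz]
    have h1 := hvn z hz.le
    have h2 := hvN z hz.le
    have h3 := h.xT_ne_zero z hz
    have h4 := hden z hz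
    positivity
  have hit : ∀ z, ‖z‖ < 1 → bf (a (n + 1)) z * diskIterate a ν (n + 1) z =
      (diskIterate a ν n z - γ) / (1 - conj γ * diskIterate a ν n z) := fun z hz => by
    have h1 := hvn z hz.le
    have h2 := hvN z hz.le
    have h3 := h.xT_ne_zero z hz
    have h4 := hden z hz
    rw [← hc] at h3
    have h5 : bf (a (n + 1)) z * diskIterate a ν (n + 1) z =
        zN * (bf (a (n + 1)) z * yT a ν (n + 1) c' z) / xT a ν (n + 1) c' z := by
      rw [diskIterate]
      ring
    rw [h5, hY' z hz, hX' z hz]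
    field_simp
  have hle : ∀ z, ‖z‖ < 1 → ‖diskIterate a ν (n + 1) z‖ ≤ 1 := by
    refine fun z hz => norm_le_one_of_norm_bf_mul_le (ha (n + 1))
      (((differentiableOn_yT ha hν (n + 1) _).const_mul _).div
        (differentiableOn_xT ha hν (n + 1) _) fun z hz => hX0 z (by simpa using hz))
      (fun w hw => ?_) hz
    change ‖bf (a (n + 1)) w * diskIterate a ν (n + 1) w‖ ≤ 1
    rw [hit w hw, norm_div]
    refine div_le_one_of_le₀ ?_ (norm_nonneg _)
    simpa using norm_sub_mul_le hγ1.le (show ‖diskIterate a ν n w‖ ≤ ‖(1 : ℂ)‖ by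
      simpa using h.norm_diskIterate_le w hw)
  -- The recurrence matrix multiplies the Wronskian by its determinant, which contains `1 - |Λ|² = 1
  -- - |γ|²`.
  have hW : ∀ z, ‖z‖ < 1 → xT a ν (n + 1) c' z * cbs a (n + 1) c' z -
      bf (a (n + 1)) z * yT a ν (n + 1) c' z * cb a (n + 1) c' z =
      e ^ 2 * (1 - γ * conj γ) * (2 * zN * (1 - conj (a n) * a n) / vp (a (n + 1)) z ^ 2) :=
    fun z hz => by
    have h1 := hvn z hz.le
    have h2 := hvN z hz.le
    have h3 : 2 * zN * (1 - conj (a n) * a n) / vp (a (n + 1)) z ^ 2 =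
        (vp (a n) z / vp (a (n + 1)) z) ^ 2 * (zN * conj zn) *
        (xT a ν n c z * cbs a n c z - bf (a n) z * yT a ν n c z * cb a n c z) := by
      rw [h.wronskian z hz, ← hzn]
      field_simp
      linear_combination -(1 - conj (a n) * a n) * hzn1
    rw [hX z hz, hY z hz, hcb' z hz.le, hcbs' z hz.le, h3, hcΛ, hΛdef]
    linear_combination (e * (vp (a n) z / vp (a (n + 1)) z)) ^ 2 * (zN * conj zn) * γ * conj γ *
      (xT a ν n c z * cbs a n c z - bf (a n) z * yT a ν n c z * cb a n c z) * (-hzN1)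
  have hna := one_sub_norm_sq_ne_zero (ha n)
  have hNa := one_sub_norm_sq_ne_zero (ha (n + 1))
  -- At `a_{n+1}` the second term of the Wronskian vanishes, and `conj_coeff_mul_xT_self` evaluates
  -- the first one independently.
  have hsq : (e : ℂ) ^ 2 * (1 - γ * conj γ) * (1 - conj (a n) * a n) =
      1 - conj (a (n + 1)) * a (n + 1) := by
    have h1 := hW _ (ha (n + 1))
    rw [bf_self, zero_mul, zero_mul, sub_zero, cbs_self, mul_comm,
      conj_coeff_mul_xT_self ha hν ha0 hN, vp, ← hzN] at h1
    field_simp at h1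
    linear_combination -h1
  refine ⟨⟨fun k hk => ?_, hX0, hle, fun z hz => ?_⟩, e, ⟨hγ1, he, ?_, fun u hu => ?_,
    fun u hu => ?_⟩, hit⟩
  · rcases Nat.lt_or_ge k (n + 1) with h1 | h1
    · exact h.isORF k (by omega)
    · obtain rfl : k = n + 1 := by omega
      exact hN
  · rw [hW z hz, ← hsq, ← hzN]
    ring
  · have h1 : (1 - ‖a n‖ ^ 2) ≠ 0 := by nlinarith [norm_nonneg (a n), ha n]
    rw [eq_div_iff h1]
    rw [Complex.mul_conj, Complex.normSq_eq_norm_sq, mul_comm (conj (a n)), Complex.mul_conj,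
      Complex.normSq_eq_norm_sq, mul_comm (conj (a (n + 1))), Complex.mul_conj,
      Complex.normSq_eq_norm_sq] at hsq
    exact_mod_cast hsq
  · rw [hcb' u hu, hcΛ]
    ring
  · rw [hcbs' u hu, hΛdef]
    linear_combination (-e * (vp (a n) u / vp (a (n + 1)) u)) * γ * conj zn * bf (a n) u *
      cb a n c u * hzN1

end CircleORF

end RatKhrushchev

end

/-! ### The boundary identity on the circle. -/

noncomputable section

namespace RatKhrushchev

/-- The boundary value of an iterate at a boundary point, and its relation to the density `m`. -/
structure BdryData (a : ℕ → ℂ) (ν : Measure ℂ) (n : ℕ) (u : ℂ) (m : ℝ) (w : ℂ) : Prop where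
  tendsto : ∀ C, 0 ≤ C → Tendsto (diskIterate a ν n) (stolz C u) (𝓝 w)
  ne_zero : cbs a n (diskCoeff a ν n) u -
    conj (zfac .disk (a n)) * bf (a n) u * cb a n (diskCoeff a ν n) u * w ≠ 0
  eq : m * ‖cbs a n (diskCoeff a ν n) u -
    conj (zfac .disk (a n)) * bf (a n) u * cb a n (diskCoeff a ν n) u * w‖ ^ 2 =
      (1 - ‖w‖ ^ 2) * ((1 - ‖a n‖ ^ 2) / ‖vp (a n) u‖ ^ 2)

theorem one_sub_norm_sq_pos {a : ℂ} (ha : ‖a‖ < 1) : 0 < 1 - ‖a‖ ^ 2 := by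
  nlinarith [norm_nonneg a]

theorem tendsto_stolz_of_continuousOn {C : ℝ} {u : ℂ} (hu : ‖u‖ = 1) {f : ℂ → ℂ}
    (hf : ContinuousOn f (Metric.closedBall 0 1)) : Tendsto f (stolz C u) (𝓝 (f u)) :=
  ((hf u (by simp [hu])).tendsto).mono_left
    (nhdsWithin_mono _ fun w hw => by simpa using hw.1.le)

section CircleORF

variable {a : ℕ → ℂ} {ν : Measure ℂ}

theorem BdryData.norm_le {n : ℕ} (ha : ‖a n‖ < 1) {u : ℂ} (hu : ‖u‖ = 1) {m : ℝ} (hm : 0 ≤ m)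
    {w : ℂ} (h : BdryData a ν n u m w) : ‖w‖ ≤ 1 := by
  have h1 : 0 ≤ (1 - ‖w‖ ^ 2) * ((1 - ‖a n‖ ^ 2) / ‖vp (a n) u‖ ^ 2) := by
    rw [← h.eq]
    positivity
  have h2 : 0 < (1 - ‖a n‖ ^ 2) / ‖vp (a n) u‖ ^ 2 := by
    have := one_sub_norm_sq_pos ha
    have := norm_pos_iff.2 (vp_ne_zero ha hu.le)
    positivity
  have h3 := nonneg_of_mul_nonneg_left h1 h2
  nlinarith [norm_nonneg w]

/-- The new boundary value is the disk automorphism of `w` divided by the unimodular `ζ_{n+1}(u)`.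
The linear form gains the factor `e (ϖ_n / ϖ_{n+1}) (1 - |γ|²) / (1 - conj γ w)`, and `1 - |w|²`
gains `(1 - |γ|²) / |1 - conj γ w|²`; `OrfStep.sq_mul` balances the two. -/
theorem BdryData.succ (ha : ∀ k, ‖a k‖ < 1) {n : ℕ} {e : ℝ}
    (hs : OrfStep a ν n (diskIterate a ν n (a (n + 1))) e)
    (hit : ∀ z, ‖z‖ < 1 → bf (a (n + 1)) z * diskIterate a ν (n + 1) z =
        (diskIterate a ν n z - diskIterate a ν n (a (n + 1))) /
          (1 - conj (diskIterate a ν n (a (n + 1))) * diskIterate a ν n z))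
    {u : ℂ} (hu : ‖u‖ = 1) {m : ℝ} (hm : 0 ≤ m) {w : ℂ} (h : BdryData a ν n u m w) :
    ∃ w', BdryData a ν (n + 1) u m w' := by
  have hw := h.norm_le (ha n) hu hm
  set γ := diskIterate a ν n (a (n + 1)) with hγ
  set zN := zfac .disk (a (n + 1)) with hzN
  set zn := zfac .disk (a n) with hzn
  have hzN1 : zN * conj zN = 1 := zfac_disk_mul_conj (ha _)
  set S := cbs a n (diskCoeff a ν n) u with hS
  set P := conj zn * bf (a n) u * cb a n (diskCoeff a ν n) u with hP
  have hden : 1 - conj γ * w ≠ 0 :=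
    sub_conj_mul_ne_zero hs.norm_lt (by simpa using hw) one_ne_zero
  have hb0 : bf (a (n + 1)) u ≠ 0 := by
    rw [← norm_ne_zero_iff, norm_bf_of_norm_eq_one (ha _) hu]
    exact one_ne_zero
  have hvn := vp_ne_zero (ha n) hu.le
  have hvN := vp_ne_zero (ha (n + 1)) hu.le
  have he : (e : ℂ) ≠ 0 := by simpa using hs.pos.ne'
  set W := (w - γ) / (1 - conj γ * w) with hW
  have hγ2 : (1 - γ * conj γ) = ((1 - ‖γ‖ ^ 2 : ℝ) : ℂ) := by
    rw [Complex.mul_conj, Complex.normSq_eq_norm_sq]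
    push_cast
    ring
  have hγ3 := one_sub_norm_sq_pos hs.norm_lt
  have hbW : bf (a (n + 1)) u * (W / bf (a (n + 1)) u) = W := mul_div_cancel₀ _ hb0
  have hnew : cbs a (n + 1) (diskCoeff a ν (n + 1)) u - conj zN * bf (a (n + 1)) u *
      cb a (n + 1) (diskCoeff a ν (n + 1)) u * (W / bf (a (n + 1)) u) =
      e * (vp (a n) u / vp (a (n + 1)) u) * ((1 - ‖γ‖ ^ 2 : ℝ) / (1 - conj γ * w)) *
        (S - P * w) := by
    rw [hs.cb_eq u hu.le, hs.cbs_eq u hu.le, ← hS, ← hzN, ← hzn, ← hP, ← hγ2]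
    have h1 : (1 - γ * conj γ) / (1 - conj γ * w) * (S - P * w) =
        (S - γ * P) - W * (P - conj γ * S) := by
      rw [hW]
      field_simp
      ring
    rw [mul_assoc _ (_ / _) (S - P * w), h1]
    linear_combination -e * (vp (a n) u / vp (a (n + 1)) u) * (P - conj γ * S) *
      (zN * conj zN * hbW + W * hzN1)
  refine ⟨W / bf (a (n + 1)) u, fun C hC => ?_, ?_, ?_⟩
  · have h1 : Tendsto (fun z => (diskIterate a ν n z - γ) / (1 - conj γ * diskIterate a ν n z) /
        bf (a (n + 1)) z) (stolz C u) (𝓝 (W / bf (a (n + 1)) u)) :=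
      (((h.tendsto C hC).sub_const γ).div (((h.tendsto C hC).const_mul _).const_sub 1) hden).div
        (tendsto_stolz_of_continuousOn hu (continuousOn_bf (ha _))) hb0
    refine h1.congr' ?_
    have h2 : ∀ᶠ z in stolz C u, bf (a (n + 1)) z ≠ 0 :=
      (tendsto_stolz_of_continuousOn hu (continuousOn_bf (ha _))).eventually_ne hb0
    filter_upwards [h2, eventually_stolz_norm_lt C u] with z hz hz1
    rw [← hit z hz1, mul_div_cancel_left₀ _ hz]
  · rw [hnew]
    have h1 : ((1 - ‖γ‖ ^ 2 : ℝ) : ℂ) ≠ 0 := by exact_mod_cast hγ3.ne'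
    exact mul_ne_zero (mul_ne_zero (mul_ne_zero he (div_ne_zero hvn hvN)) (div_ne_zero h1 hden))
      h.ne_zero
  · rw [hnew]
    have h1 : 1 - ‖W / bf (a (n + 1)) u‖ ^ 2 =
        (1 - ‖γ‖ ^ 2) * (1 - ‖w‖ ^ 2) / ‖1 - conj γ * w‖ ^ 2 := by
      have h2 := norm_sub_sq_sub_norm_sub_sq 1 w γ
      have h3 := norm_ne_zero_iff.2 hden
      rw [norm_one, mul_one] at h2
      rw [norm_div, norm_bf_of_norm_eq_one (ha _) hu, div_one, hW, norm_div, div_pow,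
        one_sub_div (pow_ne_zero 2 h3)]
      congr 1
      linarith
    have h4 := h.eq
    rw [← hS, ← hzn, ← hP] at h4
    have h5 : ‖((1 - ‖γ‖ ^ 2 : ℝ) : ℂ)‖ = 1 - ‖γ‖ ^ 2 := by
      rw [Complex.norm_real, Real.norm_of_nonneg hγ3.le]
    have h6 : ‖(e : ℂ)‖ = e := by rw [Complex.norm_real, Real.norm_of_nonneg hs.pos.le]
    rw [h1]
    simp only [norm_mul, norm_div, h5, h6]
    have h7 := hs.sq_mul
    have h8 := norm_ne_zero_iff.2 hden
    have h9 := norm_ne_zero_iff.2 hvn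
    have h10 := norm_ne_zero_iff.2 hvN
    have h11 := one_sub_norm_sq_pos (ha n)
    calc _ = (e ^ 2 * (1 - ‖γ‖ ^ 2)) * (‖vp (a n) u‖ / ‖vp (a (n + 1)) u‖) ^ 2 * (1 - ‖γ‖ ^ 2) /
          ‖1 - conj γ * w‖ ^ 2 * (m * ‖S - P * w‖ ^ 2) := by
          ring
      _ = _ := by
          rw [h7, h4]
          field_simp

/-- On the circle `|Φ_n^*| = |Φ_n|`. A zero of `Φ_n^*` there would be one of `Φ_n` too and would
contradict `ne_zero`, so division is allowed. -/
theorem BdryData.formula (ha : ∀ k, ‖a k‖ < 1) {n : ℕ} {u : ℂ} (hu : ‖u‖ = 1) {m : ℝ} {w : ℂ}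
    (h : BdryData a ν n u m w) :
    1 - bf (a n) u * (conj (zfac .disk (a n)) * cb a n (diskCoeff a ν n) u /
        cbs a n (diskCoeff a ν n) u) * w ≠ 0 ∧
      ‖cb a n (diskCoeff a ν n) u‖ ^ 2 / ((1 - ‖a n‖ ^ 2) / ‖vp (a n) u‖ ^ 2) * m =
        (1 - ‖w‖ ^ 2) / ‖1 - bf (a n) u * (conj (zfac .disk (a n)) * cb a n (diskCoeff a ν n) u /
          cbs a n (diskCoeff a ν n) u) * w‖ ^ 2 := by
  have h1 : ‖cbs a n (diskCoeff a ν n) u‖ = ‖cb a n (diskCoeff a ν n) u‖ := by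
    rw [cbs_eq_of_norm_eq_one ha hu, norm_mul, norm_bp ha hu, one_mul, RCLike.norm_conj]
  have hS : cbs a n (diskCoeff a ν n) u ≠ 0 := by
    intro h0
    apply h.ne_zero
    rw [h0, norm_zero, eq_comm, norm_eq_zero] at h1
    rw [h0, h1]
    ring
  have h2 : 1 - bf (a n) u * (conj (zfac .disk (a n)) * cb a n (diskCoeff a ν n) u /
      cbs a n (diskCoeff a ν n) u) * w = (cbs a n (diskCoeff a ν n) u -
        conj (zfac .disk (a n)) * bf (a n) u * cb a n (diskCoeff a ν n) u * w) /
        cbs a n (diskCoeff a ν n) u := by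
    field_simp
  have h3 := one_sub_norm_sq_pos (ha n)
  have h4 := norm_ne_zero_iff.2 (vp_ne_zero (ha n) hu.le)
  have h5 := norm_ne_zero_iff.2 h.ne_zero
  have h6 := h.eq
  rw [h2]
  refine ⟨div_ne_zero h.ne_zero hS, ?_⟩
  rw [← h1, norm_div]
  field_simp at h6 ⊢
  linear_combination h6

theorem cb_diskCoeff_zero (u : ℂ) : cb a 0 (diskCoeff a ν 0) u = 1 := by
  simp [cb, diskCoeff, bp]

theorem cbs_diskCoeff_zero (u : ℂ) : cbs a 0 (diskCoeff a ν 0) u = 1 := by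
  simp [cbs, diskCoeff]

end CircleORF

section Angle

variable {a : ℕ → ℂ} {ρ : Measure ℝ} [IsProbabilityMeasure ρ]

omit [IsProbabilityMeasure ρ] in
theorem map_cis_compl_sphere : (ρ.map cis) (Metric.sphere 0 1)ᶜ = 0 := by
  rw [Measure.map_apply continuous_cis.measurable Metric.isClosed_sphere.measurableSet.compl]
  convert measure_empty (μ := ρ)
  ext s
  simp [norm_cis]

theorem herglotz_eq_integral_map {z : ℂ} (hz : ‖z‖ < 1) :
    herglotz ρ z = ∫ u, (u + z) / (u - z) ∂(ρ.map cis) := by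
  have : IsProbabilityMeasure (ρ.map cis) :=
    Measure.isProbabilityMeasure_map continuous_cis.aemeasurable
  rw [integral_map continuous_cis.aemeasurable (integrable_of_continuousOn_sphere
    map_cis_compl_sphere (continuousOn_div_sub (q := fun u => u + z) (by fun_prop)
      hz)).aestronglyMeasurable]
  rfl

/-- The kernel is `2u / (u - z) = (u + z) / (u - z) + 1`; in `yT_zero` it is `2z / (u - z) = (u + z)
/ (u - z) - 1`. -/
theorem xT_zero (ha0 : a 0 = 0) {z : ℂ} (hz : ‖z‖ < 1) :
    xT a (ρ.map cis) 0 (diskCoeff a (ρ.map cis) 0) z = herglotz ρ z + 1 := by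
  have : IsProbabilityMeasure (ρ.map cis) :=
    Measure.isProbabilityMeasure_map continuous_cis.aemeasurable
  have i1 := integrable_of_continuousOn_sphere (map_cis_compl_sphere (ρ := ρ))
    (continuousOn_div_sub (q := fun u => u + z) (by fun_prop) hz)
  rw [herglotz_eq_integral_map hz, xT, integral_congr_of_norm_eq_one map_cis_compl_sphere
    (g := fun u => (u + z) / (u - z) + 1) fun u hu => ?_,
    integral_add i1 (integrable_const _)]
  · simp
  · have := sub_ne_zero_of_norm hu hz
    rw [cb_diskCoeff_zero, ha0, bf_zero, bp_zero]
    field_simp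
    simp
    ring

theorem yT_zero {z : ℂ} (hz : ‖z‖ < 1) :
    z * yT a (ρ.map cis) 0 (diskCoeff a (ρ.map cis) 0) z = herglotz ρ z - 1 := by
  have : IsProbabilityMeasure (ρ.map cis) :=
    Measure.isProbabilityMeasure_map continuous_cis.aemeasurable
  have i1 := integrable_of_continuousOn_sphere (map_cis_compl_sphere (ρ := ρ))
    (continuousOn_div_sub (q := fun u => u + z) (by fun_prop) hz)
  rw [herglotz_eq_integral_map hz, yT, ← integral_const_mul,
    integral_congr_of_norm_eq_one map_cis_compl_sphere
    (g := fun u => (u + z) / (u - z) - 1) fun u hu => ?_,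
    integral_sub i1 (integrable_const _)]
  · simp
  · have := sub_ne_zero_of_norm hu hz
    rw [cb_diskCoeff_zero]
    field_simp
    simp
    ring

theorem mul_diskIterate_zero (ha0 : a 0 = 0) {z : ℂ} (hz : ‖z‖ < 1) :
    z * diskIterate a (ρ.map cis) 0 z = (herglotz ρ z - 1) / (herglotz ρ z + 1) := by
  rw [diskIterate, ← yT_zero (a := a) hz, ← xT_zero ha0 hz, ha0,
    show zfac .disk 0 = 1 from if_pos rfl, one_mul, mul_div_assoc]

theorem orfData (ha : ∀ k, ‖a k‖ < 1) (ha0 : a 0 = 0) {n : ℕ}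
    (hn : ∀ s : Finset ℂ, s.card ≤ n → (ρ.map cis) (s : Set ℂ)ᶜ ≠ 0) :
    OrfData a (ρ.map cis) n := by
  have : IsProbabilityMeasure (ρ.map cis) :=
    Measure.isProbabilityMeasure_map continuous_cis.aemeasurable
  have hν := map_cis_compl_sphere (ρ := ρ)
  induction n with
  | zero =>
    have hX : ∀ z, ‖z‖ < 1 → xT a (ρ.map cis) 0 (diskCoeff a (ρ.map cis) 0) z ≠ 0 := fun z hz => by
      rw [xT_zero ha0 hz]
      exact herglotz_add_one_ne_zero hz
    refine ⟨fun k hk => ?_, hX, fun z hz => ?_, fun z hz => ?_⟩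
    · rw [Nat.le_zero.1 hk]
      exact isORF_diskCoeff_zero hν
    · refine norm_le_one_of_norm_bf_mul_le (ha 0)
        (((differentiableOn_yT ha hν 0 _).const_mul _).div (differentiableOn_xT ha hν 0 _)
          fun z hz => hX z (by simpa using hz)) (fun w hw => ?_) hz
      change ‖bf (a 0) w * diskIterate a (ρ.map cis) 0 w‖ ≤ 1
      rw [ha0, bf_zero, mul_diskIterate_zero ha0 hw, norm_div]
      exact div_le_one_of_le₀ (norm_sub_one_le_norm_add_one (herglotz_re_nonneg hw)) (norm_nonneg _)
    · rw [cb_diskCoeff_zero, cbs_diskCoeff_zero, ha0, bf_zero, yT_zero hz, xT_zero ha0 hz,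
        show zfac .disk 0 = 1 from if_pos rfl]
      simp [vp]
      ring
  | succ n ih => exact (exists_orfStep ha hν ha0 (ih fun s hs => hn s (by omega)) hn).1

theorem mul_diskIterate_succ (ha : ∀ k, ‖a k‖ < 1) (ha0 : a 0 = 0) {n : ℕ}
    (hn : ∀ s : Finset ℂ, s.card ≤ n + 1 → (ρ.map cis) (s : Set ℂ)ᶜ ≠ 0) {z : ℂ} (hz : ‖z‖ < 1) :
    bf (a (n + 1)) z * diskIterate a (ρ.map cis) (n + 1) z =
      (diskIterate a (ρ.map cis) n z - diskIterate a (ρ.map cis) n (a (n + 1))) /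
        (1 - conj (diskIterate a (ρ.map cis) n (a (n + 1))) * diskIterate a (ρ.map cis) n z) := by
  have : IsProbabilityMeasure (ρ.map cis) :=
    Measure.isProbabilityMeasure_map continuous_cis.aemeasurable
  obtain ⟨-, e, -, h⟩ := exists_orfStep ha map_cis_compl_sphere ha0
    (orfData ha ha0 fun s hs => hn s (by omega)) hn
  exact h z hz

theorem differentiableOn_diskIterate (ha : ∀ k, ‖a k‖ < 1) (ha0 : a 0 = 0) {n : ℕ}
    (hn : ∀ s : Finset ℂ, s.card ≤ n → (ρ.map cis) (s : Set ℂ)ᶜ ≠ 0) :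
    DifferentiableOn ℂ (diskIterate a (ρ.map cis) n) (Metric.ball 0 1) :=
  have : IsProbabilityMeasure (ρ.map cis) :=
    Measure.isProbabilityMeasure_map continuous_cis.aemeasurable
  (orfData ha ha0 hn).differentiableOn ha map_cis_compl_sphere

/-- The exceptional null set is that of the Cayley transform of `F`. The induction on `n` runs at a
fixed boundary point. -/
theorem ae_exists_bdryData (ha : ∀ k, ‖a k‖ < 1) (ha0 : a 0 = 0) {b : ℝ}
    (hρ : ρ (Set.Ioc b (b + 2 * Real.pi))ᶜ = 0) {n : ℕ}
    (hn : ∀ s : Finset ℂ, s.card ≤ n → (ρ.map cis) (s : Set ℂ)ᶜ ≠ 0) :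
    ∀ᵐ x ∂(angleMeasure b), ∃ w, BdryData a (ρ.map cis) n (cis x)
      (ρ.rnDeriv (angleMeasure b) x).toReal w := by
  have : IsProbabilityMeasure (ρ.map cis) :=
    Measure.isProbabilityMeasure_map continuous_cis.aemeasurable
  have hν := map_cis_compl_sphere (ρ := ρ)
  filter_upwards [ae_exists_tendsto_cayley_herglotz hρ] with x hx
  induction n with
  | zero =>
    obtain ⟨g, hg1, hg, hm⟩ := hx
    have hu := norm_cis x
    have hu0 : cis x ≠ 0 := norm_ne_zero_iff.1 (by rw [hu]; exact one_ne_zero)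
    have h0 : cbs a 0 (diskCoeff a (ρ.map cis) 0) (cis x) - conj (zfac .disk (a 0)) *
        bf (a 0) (cis x) * cb a 0 (diskCoeff a (ρ.map cis) 0) (cis x) * (g / cis x) = 1 - g := by
      rw [cb_diskCoeff_zero, cbs_diskCoeff_zero, ha0, bf_zero,
        show zfac .disk 0 = 1 from if_pos rfl, map_one, one_mul, mul_one, mul_div_cancel₀ _ hu0]
    refine ⟨g / cis x, fun C hC => ?_, ?_, ?_⟩
    · have hid := tendsto_stolz_of_continuousOn (C := C) hu continuousOn_id
      refine ((hg C hC).div hid hu0).congr' ?_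
      filter_upwards [hid.eventually_ne hu0, eventually_stolz_norm_lt C (cis x)] with z hz hz1
      rw [Pi.div_apply, ← mul_diskIterate_zero ha0 hz1]
      exact mul_div_cancel_left₀ _ hz
    · rw [h0]
      exact sub_ne_zero.2 hg1.symm
    · rw [h0, hm, norm_div, hu, ha0]
      simp [vp]
  | succ n ih =>
    obtain ⟨w, hw⟩ := ih fun s hs => hn s (by omega)
    obtain ⟨-, e, he, h⟩ := exists_orfStep ha hν ha0 (orfData ha ha0 fun s hs => hn s (by omega)) hn
    exact hw.succ ha he h (norm_cis x) ENNReal.toReal_nonneg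

end Angle

end RatKhrushchev

end

noncomputable section

namespace RatKhrushchev

/-! ### Uniformization of the two settings by the disk -/

/-- The conformal map `ζ_{α₀}` of the domain onto the disk. -/
def unif (O : Setting) (t : Sphere) : ℂ := zeta O (base O) t

theorem zfac_base (O : Setting) : zfac O (base O) = 1 := if_pos rfl

theorem unif_disk (x : ℂ) : unif .disk (x : Sphere) = x := by
  simp [unif, zeta, zfac, base, varpi]

theorem unif_halfPlane (x : ℂ) :
    unif .halfPlane (x : Sphere) = (x - Complex.I) / (x + Complex.I) := by
  simp [unif, zeta, zfac, base, varpi]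

theorem unif_halfPlane_infty : unif .halfPlane OnePoint.infty = 1 := by
  simp [unif, zeta, zfac, base, mobiusInfty]

theorem unif_base (O : Setting) : unif O (base O : Sphere) = 0 := by
  simp [unif, zeta]

theorem base_mem_dom (O : Setting) : base O ∈ dom O := by
  cases O <;> simp [base, dom]

theorem add_I_ne_zero {x : ℂ} (hx : 0 ≤ x.im) : x + Complex.I ≠ 0 := by
  intro h
  have := congrArg Complex.im h
  simp at this
  linarith

theorem sub_conj_ne_zero {a x : ℂ} (ha : 0 < a.im) (hx : 0 ≤ x.im) : x - conj a ≠ 0 := by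
  intro h
  have := congrArg Complex.im h
  simp at this
  linarith

theorem norm_add_I_sq_sub (x : ℂ) : ‖x + Complex.I‖ ^ 2 - ‖x - Complex.I‖ ^ 2 = 4 * x.im := by
  simp only [← Complex.normSq_eq_norm_sq, Complex.normSq_apply, Complex.sub_re, Complex.sub_im,
    Complex.add_re, Complex.add_im, Complex.I_re, Complex.I_im]
  ring

theorem norm_unif_lt {O : Setting} {z : ℂ} (hz : z ∈ dom O) : ‖unif O (z : Sphere)‖ < 1 := by
  cases O with
  | disk => rwa [unif_disk]
  | halfPlane =>
    have hz' : 0 < z.im := hz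
    have h1 := norm_pos_iff.2 (add_I_ne_zero hz'.le)
    rw [unif_halfPlane, norm_div, div_lt_one h1]
    have h2 := norm_add_I_sq_sub z
    exact (pow_lt_pow_iff_left₀ (norm_nonneg _) (norm_nonneg _) two_ne_zero).1 (by linarith)

theorem norm_unif_eq {O : Setting} {t : Sphere} (ht : t ∈ bdry O) : ‖unif O t‖ = 1 := by
  cases O with
  | disk =>
    obtain ⟨x, hx, rfl⟩ := ht
    rwa [unif_disk]
  | halfPlane =>
    rcases ht with rfl | ⟨x, hx, rfl⟩
    · rw [unif_halfPlane_infty, norm_one]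
    · have hx' : x.im = 0 := hx
      have h1 := norm_pos_iff.2 (add_I_ne_zero hx'.ge)
      have h2 := norm_add_I_sq_sub x
      rw [unif_halfPlane, norm_div, div_eq_one_iff_eq h1.ne']
      rw [hx', mul_zero, sub_eq_zero] at h2
      exact ((pow_left_inj₀ (norm_nonneg _) (norm_nonneg _) two_ne_zero).1 h2).symm

theorem unif_injOn (O : Setting) : Set.InjOn (unif O) (bdry O) := by
  cases O with
  | disk =>
    rintro _ ⟨x, -, rfl⟩ _ ⟨y, -, rfl⟩ h
    simpa only [unif_disk] using congrArg ((↑) : ℂ → Sphere) h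
  | halfPlane =>
    have h1 : ∀ x : ℂ, x.im = 0 → unif .halfPlane (x : Sphere) ≠ 1 := fun x hx h => by
      rw [unif_halfPlane, div_eq_one_iff_eq (add_I_ne_zero hx.ge)] at h
      have := congrArg Complex.im h
      simp at this
      linarith
    rintro s (rfl | ⟨x, hx, rfl⟩) t (rfl | ⟨y, hy, rfl⟩) h
    · rfl
    · exact absurd (h.symm.trans unif_halfPlane_infty) (h1 y hy)
    · exact absurd (h.trans unif_halfPlane_infty) (h1 x hx)
    · have hx' : x.im = 0 := hx
      have hy' : y.im = 0 := hy
      simp only [unif_halfPlane] at h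
      rw [div_eq_div_iff (add_I_ne_zero hx'.ge) (add_I_ne_zero hy'.ge)] at h
      have h2 : 2 * Complex.I * (x - y) = 0 := by linear_combination h
      rw [sub_eq_zero.1 ((mul_eq_zero.1 h2).resolve_left (by simp))]

/-- The factor by which `ϖ_a` differs from its counterpart on the disk. -/
def unifFactor (O : Setting) (a : ℂ) : ℂ :=
  match O with
  | .disk => 1
  | .halfPlane => (Complex.I * conj a + 1) / 2

theorem unifFactor_base (O : Setting) : unifFactor O (base O) = 1 := by
  cases O <;> simp [unifFactor, base]

theorem unifFactor_halfPlane (a : ℂ) :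
    unifFactor .halfPlane a = Complex.I / 2 * conj (a + Complex.I) := by
  rw [unifFactor, map_add, Complex.conj_I]
  linear_combination Complex.I_mul_I / 2

theorem unifFactor_ne_zero {O : Setting} {a : ℂ} (ha : a ∈ dom O) : unifFactor O a ≠ 0 := by
  cases O with
  | disk => exact one_ne_zero
  | halfPlane =>
    have ha' : 0 < a.im := ha
    rw [unifFactor_halfPlane]
    exact mul_ne_zero (div_ne_zero Complex.I_ne_zero two_ne_zero)
      ((map_ne_zero _).2 (add_I_ne_zero ha'.le))

theorem norm_mul_norm_eq (z : ℂ) : (‖z‖ : ℂ) * ‖z‖ = z * conj z := by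
  rw [Complex.mul_conj, Complex.normSq_eq_norm_sq]
  push_cast
  ring

/-- The factors `ϖ_a` of the half plane and of the disk differ by `unifFactor`. The phases `z_a` are
such that they absorb the resulting quotient `η / conj η`, so Blaschke factors correspond exactly.
-/
theorem zfac_mul_conj_unifFactor {O : Setting} {a : ℂ} (ha : a ∈ dom O) :
    zfac O a * conj (unifFactor O a) = zfac .disk (unif O (a : Sphere)) * unifFactor O a := by
  by_cases h0 : a = base O
  · rw [h0, unif_base, unifFactor_base, zfac_base, show zfac .disk 0 = 1 from if_pos rfl, map_one]
  cases O with
  | disk => simp [unif_disk, unifFactor]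
  | halfPlane =>
    have ha' : 0 < a.im := ha
    have h1 := add_I_ne_zero ha'.le
    have h2 : a - Complex.I ≠ 0 := sub_ne_zero.2 h0
    have h3 : unif .halfPlane (a : Sphere) ≠ base .disk := by
      rw [unif_halfPlane]
      exact div_ne_zero h2 h1
    have h7 : zfac .halfPlane a = (‖1 + a ^ 2‖ : ℂ) / (1 + a ^ 2) := if_neg h0
    have h8 : zfac .disk (unif .halfPlane (a : Sphere)) =
        -(‖unif .halfPlane (a : Sphere)‖ : ℂ) / unif .halfPlane (a : Sphere) := if_neg h3
    rw [h7, h8, unif_halfPlane, unifFactor_halfPlane]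
    simp only [map_mul, map_div₀, Complex.conj_conj, Complex.conj_I, map_ofNat]
    have h4 : 1 + a ^ 2 = (a - Complex.I) * (a + Complex.I) := by
      linear_combination Complex.I_sq
    have h5 := norm_mul_norm_eq (a + Complex.I)
    have h6 : (‖a + Complex.I‖ : ℂ) ≠ 0 := by simpa using h1
    rw [h4, norm_mul, norm_div]
    push_cast
    field_simp
    linear_combination (-‖a - Complex.I‖ : ℂ) * h5

/-- The factor `s` does not depend on `a`, hence it drops out of the quotients `ϖ_{n+1} / ϖ_n` in
the normalization. -/
theorem varpi_eq {O : Setting} {z : ℂ} (hz : z ∈ dom O) : ∃ s : ℂ, s ≠ 0 ∧ ∀ a ∈ dom O,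
    varpi O a z = vp (unif O (a : Sphere)) (unif O (z : Sphere)) * unifFactor O a * s := by
  cases O with
  | disk => exact ⟨1, one_ne_zero, fun a _ => by simp [unif_disk, unifFactor, varpi, vp]⟩
  | halfPlane =>
    have hz' : 0 < z.im := hz
    refine ⟨z + Complex.I, add_I_ne_zero hz'.le, fun a ha => ?_⟩
    have ha' : 0 < a.im := ha
    have h1 := add_I_ne_zero ha'.le
    have h2 := add_I_ne_zero hz'.le
    have h3 : conj (a + Complex.I) ≠ 0 := (map_ne_zero _).2 h1
    rw [unif_halfPlane, unif_halfPlane, unifFactor_halfPlane, varpi, vp, map_div₀]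
    field_simp
    simp only [map_add, map_sub, Complex.conj_I]
    linear_combination 2 * (z - conj a) * Complex.I_mul_I

theorem zeta_eq_of_coe {O : Setting} {a x : ℂ} (ha : a ∈ dom O)
    (hx : x ∈ dom O ∨ (x : Sphere) ∈ bdry O) :
    zeta O a (x : Sphere) = bf (unif O (a : Sphere)) (unif O (x : Sphere)) := by
  cases O with
  | disk => simp only [unif_disk, zeta, OnePoint.elim_some, bf, varpi, vp]
  | halfPlane =>
    have hx' : 0 ≤ x.im := by
      rcases hx with hx | hx | ⟨y, hy, hyx⟩
      · exact le_of_lt hx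
      · exact absurd hx (OnePoint.coe_ne_infty x)
      · rw [← OnePoint.coe_injective hyx]
        exact ge_of_eq hy
    have ha' : 0 < a.im := ha
    have h1 := add_I_ne_zero ha'.le
    have h2 := add_I_ne_zero hx'
    have h3 : conj (a + Complex.I) ≠ 0 := (map_ne_zero _).2 h1
    have h4 := sub_conj_ne_zero ha' hx'
    have h5 := zfac_mul_conj_unifFactor ha
    have h6 : conj (unifFactor .halfPlane a) ≠ 0 := by simpa using unifFactor_ne_zero ha
    have h7 : zfac .halfPlane a = zfac .disk (unif .halfPlane (a : Sphere)) *
        unifFactor .halfPlane a / conj (unifFactor .halfPlane a) := by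
      rw [← h5, mul_div_cancel_right₀ _ h6]
    rw [zeta, h7, bf, OnePoint.elim_some, mul_div_assoc, mul_assoc]
    congr 1
    rw [unif_halfPlane, unif_halfPlane, unifFactor_halfPlane, varpi, vp]
    have h8 : (1 : ℂ) - conj ((a - Complex.I) / (a + Complex.I)) *
        ((x - Complex.I) / (x + Complex.I)) =
        -2 * Complex.I * (x - conj a) / (conj (a + Complex.I) * (x + Complex.I)) := by
      rw [map_div₀]
      field_simp
      simp only [map_add, map_sub, Complex.conj_I]
      ring
    rw [h8]
    simp only [map_mul, map_div₀, Complex.conj_conj, Complex.conj_I, map_ofNat]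
    field_simp
    ring

theorem zeta_eq_of_mem_bdry {O : Setting} {a : ℂ} (ha : a ∈ dom O) {t : Sphere} (ht : t ∈ bdry O) :
    zeta O a t = bf (unif O (a : Sphere)) (unif O t) := by
  cases O with
  | disk =>
    obtain ⟨x, hx, rfl⟩ := ht
    exact zeta_eq_of_coe ha (Or.inr ⟨x, hx, rfl⟩)
  | halfPlane =>
    have ht' := ht
    rcases ht with rfl | ⟨x, hx, rfl⟩
    · have ha' : 0 < a.im := ha
      have h1 := add_I_ne_zero ha'.le
      have h3 : conj (a + Complex.I) ≠ 0 := (map_ne_zero _).2 h1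
      have h5 := zfac_mul_conj_unifFactor ha
      have h6 : conj (unifFactor .halfPlane a) ≠ 0 := by simpa using unifFactor_ne_zero ha
      have h7 : zfac .halfPlane a = zfac .disk (unif .halfPlane (a : Sphere)) *
          unifFactor .halfPlane a / conj (unifFactor .halfPlane a) := by
        rw [← h5, mul_div_cancel_right₀ _ h6]
      rw [zeta, h7, bf, unif_halfPlane_infty, OnePoint.elim_infty, mobiusInfty, mul_one,
        mul_div_assoc]
      congr 1
      rw [unif_halfPlane, unifFactor_halfPlane, vp]
      have h8 : (1 : ℂ) - conj ((a - Complex.I) / (a + Complex.I)) * 1 =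
          -2 * Complex.I / conj (a + Complex.I) := by
        rw [map_div₀]
        field_simp
        simp only [map_add, map_sub, Complex.conj_I]
        ring
      rw [h8]
      simp only [map_mul, map_div₀, Complex.conj_conj, Complex.conj_I, map_ofNat]
      field_simp
      ring
    · exact zeta_eq_of_coe ha (Or.inr ht')

theorem kernelDR_eq {O : Setting} {t : Sphere} (ht : t ∈ bdry O) (z : ℂ) :
    kernelDR O t z = (1 - ‖unif O (z : Sphere)‖ ^ 2) /
      ‖vp (unif O (z : Sphere)) (unif O t)‖ ^ 2 := by
  have hu := norm_unif_eq ht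
  have h1 : ‖vp (unif O (z : Sphere)) (unif O t)‖ = ‖unif O t - unif O (z : Sphere)‖ := by
    rw [← RCLike.norm_conj (vp _ _), conj_vp_of_norm_eq_one hu, norm_mul, RCLike.norm_conj, hu,
      mul_one]
  have h2 := congrFun (poissonKernel_eq_re_herglotzRieszKernel (c := 0)
    (w := unif O (z : Sphere))) (unif O t)
  rw [kernelDR, kernelD]
  change ((unif O t + unif O (z : Sphere)) / (unif O t - unif O (z : Sphere))).re = _
  rw [h1]
  simpa [poissonKernel_def, herglotzRieszKernel_def, hu] using h2.symm

theorem differentiableAt_unif {O : Setting} {z : ℂ} (hz : z ∈ dom O) :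
    DifferentiableAt ℂ (fun x : ℂ => unif O (x : Sphere)) z := by
  cases O with
  | disk =>
    simp only [unif_disk]
    fun_prop
  | halfPlane =>
    have hz' : 0 < z.im := hz
    simp only [unif_halfPlane]
    exact DifferentiableAt.div (by fun_prop) (by fun_prop) (add_I_ne_zero hz'.le)

theorem isOpen_dom (O : Setting) : IsOpen (dom O) := by
  cases O with
  | disk => exact isOpen_lt continuous_norm continuous_const
  | halfPlane => exact isOpen_lt continuous_const Complex.continuous_im

theorem varpi_ne_zero {O : Setting} {a z : ℂ} (ha : a ∈ dom O) (hz : z ∈ dom O) :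
    varpi O a z ≠ 0 := by
  obtain ⟨s, hs, h⟩ := varpi_eq hz
  rw [h a ha]
  exact mul_ne_zero (mul_ne_zero (vp_ne_zero (norm_unif_lt ha) (norm_unif_lt hz).le)
    (unifFactor_ne_zero ha)) hs

/-- Removal of the zero of a Blaschke factor. -/
theorem divZeta_eq_of_forall {O : Setting} {a : ℂ} (ha : a ∈ dom O) {h k : ℂ → ℂ}
    (hk : ContinuousAt k a) (hh : ∀ y ∈ dom O, h y = zeta O a (y : Sphere) * k y) {z : ℂ}
    (hz : z ∈ dom O) : divZeta O a h z = k z := by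
  have hz0 : zfac O a ≠ 0 := left_ne_zero_of_mul_eq_one (zfac_mul_conj O ha)
  have hya : h a = 0 := by rw [hh a ha]; simp [zeta]
  have hzv := varpi_ne_zero ha hz
  rcases eq_or_ne z a with rfl | hne
  · have hd : HasDerivAt h (zfac O z / varpi O z z * k z) z := by
      rw [hasDerivAt_iff_tendsto_slope]
      have hv : ContinuousAt (varpi O z) z := by
        cases O <;> (unfold varpi; fun_prop)
      have hc : ContinuousAt (fun y => zfac O z / varpi O z y * k y) z :=
        (continuousAt_const.div hv hzv).mul hk
      refine (hc.tendsto.mono_left nhdsWithin_le_nhds).congr' ?_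
      filter_upwards [self_mem_nhdsWithin, mem_nhdsWithin_of_mem_nhds
        ((isOpen_dom O).mem_nhds ha)] with y hy hyd
      have h1 : y - z ≠ 0 := sub_ne_zero.2 hy
      have h2 := varpi_ne_zero ha hyd
      rw [slope_def_field, hya, hh y hyd, sub_zero, zeta, OnePoint.elim_some]
      field_simp
    rw [divZeta, dslope_same, hd.deriv]
    field_simp
  · have h1 : z - a ≠ 0 := sub_ne_zero.2 hne
    have h2 : zeta O a (z : Sphere) ≠ 0 := by
      rw [zeta, OnePoint.elim_some]
      exact mul_ne_zero hz0 (div_ne_zero h1 hzv)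
    rw [divZeta_eq O a h hya hne, hh z hz, mul_div_cancel_left₀ _ h2]

end RatKhrushchev

end

noncomputable section

namespace RatKhrushchev

/-! ### Boundary angles -/

theorem measurableEmbedding_coe_sphere : MeasurableEmbedding ((↑) : ℂ → Sphere) :=
  OnePoint.isOpenEmbedding_coe.measurableEmbedding

theorem measurable_sphere_elim {β : Type*} [MeasurableSpace β] (c : β) {g : ℂ → β}
    (hg : Measurable g) : Measurable fun t : Sphere => t.elim c g := by
  have h := measurableEmbedding_coe_sphere.measurable_extend hg (measurable_const (a := c))
  convert h using 1
  funext t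
  induction t using OnePoint.rec with
  | infty =>
    rw [Function.extend_apply' _ _ _ fun ⟨x, hx⟩ => OnePoint.coe_ne_infty x hx]
    rfl
  | coe x => rw [OnePoint.coe_injective.extend_apply, OnePoint.elim_some]

theorem measurableSet_bdry (O : Setting) : MeasurableSet (bdry O) := by
  cases O with
  | disk =>
    exact measurableEmbedding_coe_sphere.measurableSet_image.2
      (isClosed_eq continuous_norm continuous_const).measurableSet
  | halfPlane =>
    exact (measurableEmbedding_coe_sphere.measurableSet_image.2
      (isClosed_eq Complex.continuous_im continuous_const).measurableSet).insert _

theorem measurable_coe_real_sphere : Measurable fun t : ℝ => (((t : ℂ)) : Sphere) :=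
  measurableEmbedding_coe_sphere.measurable.comp Complex.measurable_ofReal

theorem measurable_coe_cis_sphere : Measurable fun θ : ℝ => (cis θ : Sphere) :=
  measurableEmbedding_coe_sphere.measurable.comp continuous_cis.measurable

theorem ae_refMeasure {O : Setting} {p : Sphere → Prop} (hp : MeasurableSet {t | p t})
    (h : ∀ x : ℂ, (x : Sphere) ∈ bdry O → p x) : ∀ᵐ t ∂(refMeasure O), p t := by
  cases O with
  | disk =>
    refine Measure.ae_smul_measure ?_ _
    refine (ae_map_iff measurable_coe_cis_sphere.aemeasurable hp).2 (Eventually.of_forall fun θ => ?_)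
    exact h _ ⟨_, norm_cis θ, rfl⟩
  | halfPlane =>
    refine (ae_map_iff measurable_coe_real_sphere.aemeasurable hp).2 (Eventually.of_forall fun x => ?_)
    exact h _ (Or.inr ⟨_, Complex.ofReal_im x, rfl⟩)

theorem ae_refMeasure_mem_bdry (O : Setting) : ∀ᵐ t ∂(refMeasure O), t ∈ bdry O :=
  ae_refMeasure (measurableSet_bdry O) fun _ hx => hx

theorem ae_refMeasure_ne_infty (O : Setting) : ∀ᵐ t ∂(refMeasure O), t ≠ OnePoint.infty :=
  ae_refMeasure (measurableSet_singleton _).compl fun x _ => OnePoint.coe_ne_infty x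

/-- A measurable parametrization of the boundary by the angle of its image on the circle. -/
structure IsAngle (O : Setting) (b : ℝ) (A : Sphere → ℝ) (E : ℝ → Sphere) : Prop where
  measurable : Measurable A
  measurable_symm : Measurable E
  mem_Ioc : ∀ t ∈ bdry O, A t ∈ Set.Ioc b (b + 2 * Real.pi)
  cis_eq : ∀ t ∈ bdry O, cis (A t) = unif O t
  left_inv : ∀ t ∈ bdry O, E (A t) = t
  map_eq : (refMeasure O).map A = angleMeasure b

theorem isAngle_disk : IsAngle .disk (-Real.pi) (fun t => t.elim 0 Complex.arg)
    (fun θ => (cis θ : Sphere)) := by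
  have hcis : ∀ x : ℂ, ‖x‖ = 1 → cis (Complex.arg x) = x := fun x hx => by
    have := Complex.norm_mul_exp_arg_mul_I x
    rwa [hx, Complex.ofReal_one, one_mul] at this
  have hA : Measurable fun t : Sphere => t.elim 0 Complex.arg :=
    measurable_sphere_elim 0 Complex.measurable_arg
  refine ⟨hA, measurable_coe_cis_sphere, ?_, ?_, ?_, ?_⟩
  · rintro _ ⟨x, -, rfl⟩
    rw [show -Real.pi + 2 * Real.pi = Real.pi by ring]
    exact Complex.arg_mem_Ioc x
  · rintro _ ⟨x, hx, rfl⟩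
    rw [unif_disk]
    exact hcis x hx
  · rintro _ ⟨x, hx, rfl⟩
    exact congrArg _ (hcis x hx)
  · change Measure.map _ (_ • Measure.map (fun θ : ℝ => (cis θ : Sphere)) _) = _
    rw [Measure.map_smul, Measure.map_map hA measurable_coe_cis_sphere, angleMeasure,
      show -Real.pi + 2 * Real.pi = Real.pi by ring]
    congr 1
    refine (Measure.map_congr (g := id) ?_).trans Measure.map_id
    filter_upwards [ae_restrict_mem measurableSet_Ioc] with θ hθ
    change Complex.arg (Complex.exp (θ * Complex.I)) = θ
    rw [Complex.exp_mul_I]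
    exact Complex.arg_cos_add_sin_mul_I hθ

theorem cis_two_mul_arctan_add_pi (x : ℝ) :
    cis (2 * Real.arctan x + Real.pi) = (x - Complex.I) / (x + Complex.I) := by
  have h0 : (0 : ℝ) < 1 + x ^ 2 := by positivity
  have hs : Real.sqrt (1 + x ^ 2) ≠ 0 := (Real.sqrt_pos.2 h0).ne'
  have h1 : cis (Real.arctan x) = (1 + x * Complex.I) / (Real.sqrt (1 + x ^ 2) : ℝ) := by
    rw [cis, Complex.exp_mul_I, ← Complex.ofReal_cos, ← Complex.ofReal_sin, Real.cos_arctan,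
      Real.sin_arctan]
    push_cast
    ring
  have h2 : cis (2 * Real.arctan x + Real.pi) = -(cis (Real.arctan x)) ^ 2 := by
    simp only [cis]
    rw [← Complex.exp_nat_mul, Complex.ofReal_add, add_mul, Complex.exp_add, Complex.exp_pi_mul_I]
    push_cast
    ring_nf
  have h3 : (x : ℂ) + Complex.I ≠ 0 := add_I_ne_zero (by simp)
  have h4 : ((Real.sqrt (1 + x ^ 2) : ℝ) : ℂ) ^ 2 = 1 + x ^ 2 := by
    rw [← Complex.ofReal_pow, Real.sq_sqrt h0.le]
    push_cast
    rfl
  have h5 : (1 : ℂ) + x ^ 2 ≠ 0 := by exact_mod_cast h0.ne'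
  rw [h2, h1, div_pow, h4, ← neg_div, div_eq_div_iff h5 h3]
  linear_combination (-(x : ℂ) ^ 3 - x ^ 2 * Complex.I - 2 * x) * Complex.I_mul_I

/-- Change of variables with `dθ = 2 dx / (1 + x²)`, from `ℝ` onto `(0, 2π)`; the endpoint `2π` is a
null set. -/
theorem map_two_mul_arctan_add_pi :
    (volume.withDensity fun t : ℝ => ENNReal.ofReal (1 / (Real.pi * (1 + t ^ 2)))).map
      (fun x => 2 * Real.arctan x + Real.pi) = angleMeasure 0 := by
  set f : ℝ → ℝ := fun x => 2 * Real.arctan x + Real.pi with hf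
  have hfm : Measurable f := by
    rw [hf]
    exact (Real.measurable_arctan.const_mul 2).add_const _
  have hfi : Function.Injective f := fun x y h => by
    have h' : 2 * Real.arctan x + Real.pi = 2 * Real.arctan y + Real.pi := h
    exact Real.arctan_injective (by linarith)
  ext s hs
  have himg : f '' (f ⁻¹' s) = s ∩ Set.Ioo 0 (0 + 2 * Real.pi) := by
    rw [Set.image_preimage_eq_inter_range]
    congr 1
    ext y
    constructor
    · rintro ⟨x, rfl⟩
      have h1 := Real.neg_pi_div_two_lt_arctan x
      have h2 := Real.arctan_lt_pi_div_two x
      exact ⟨by simp only [hf]; linarith, by simp only [hf]; linarith⟩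
    · intro hy
      refine ⟨Real.tan ((y - Real.pi) / 2), ?_⟩
      simp only [hf]
      rw [Real.arctan_tan (by linarith [hy.1]) (by linarith [hy.2])]
      ring
  have hd : ∀ x ∈ f ⁻¹' s, HasDerivWithinAt f (2 * (1 / (1 + x ^ 2))) (f ⁻¹' s) x := fun x _ =>
    (((Real.hasDerivAt_arctan x).const_mul 2).add_const _).hasDerivWithinAt
  have key := lintegral_image_eq_lintegral_abs_deriv_mul (hfm hs) hd hfi.injOn
    (fun _ => ENNReal.ofReal (1 / (2 * Real.pi)))
  rw [himg, lintegral_const, Measure.restrict_apply_univ] at key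
  rw [Measure.map_apply hfm hs, withDensity_apply _ (hfm hs), angleMeasure, Measure.smul_apply,
    Measure.restrict_congr_set Ioo_ae_eq_Ioc.symm, Measure.restrict_apply hs, smul_eq_mul, key]
  refine lintegral_congr fun x => ?_
  rw [← ENNReal.ofReal_mul (abs_nonneg _), abs_of_pos (by positivity)]
  congr 1
  field_simp

/-- The point `∞`, which `μ` may charge, receives the angle `2π`, the closed endpoint of the window;
the inverse treats it separately since the tangent has a pole there. -/
theorem isAngle_halfPlane : IsAngle .halfPlane 0
    (fun t => t.elim (2 * Real.pi) fun x => 2 * Real.arctan x.re + Real.pi)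
    (fun θ => if θ = 2 * Real.pi then OnePoint.infty
      else ((Real.tan ((θ - Real.pi) / 2) : ℝ) : ℂ)) := by
  have hA : Measurable fun t : Sphere => t.elim (2 * Real.pi)
      fun x => 2 * Real.arctan x.re + Real.pi :=
    measurable_sphere_elim _ (((Real.measurable_arctan.comp Complex.measurable_re).const_mul
      2).add_const _)
  have htan : Measurable Real.tan := by
    rw [show Real.tan = fun x => Real.sin x / Real.cos x from funext Real.tan_eq_sin_div_cos]
    exact Real.measurable_sin.div Real.measurable_cos
  have hre : ∀ x : ℂ, x.im = 0 → ((x.re : ℝ) : ℂ) = x := fun x hx =>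
    Complex.ext (by simp) (by simp [hx])
  refine ⟨hA, Measurable.ite (measurableSet_singleton _) measurable_const
    (measurable_coe_real_sphere.comp (htan.comp (by fun_prop))), ?_, ?_, ?_, ?_⟩
  · rintro _ (rfl | ⟨x, -, rfl⟩)
    · simp [Real.pi_pos]
    · have h1 := Real.neg_pi_div_two_lt_arctan x.re
      have h2 := Real.arctan_lt_pi_div_two x.re
      simp only [OnePoint.elim_some]
      exact ⟨by linarith, by linarith⟩
  · rintro _ (rfl | ⟨x, hx, rfl⟩)
    · rw [unif_halfPlane_infty, OnePoint.elim_infty, cis]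
      push_cast
      exact Complex.exp_two_pi_mul_I
    · simp only [OnePoint.elim_some]
      rw [unif_halfPlane, cis_two_mul_arctan_add_pi, hre x hx]
  · rintro _ (rfl | ⟨x, hx, rfl⟩)
    · simp
    · have h2 := Real.arctan_lt_pi_div_two x.re
      have h3 : 2 * Real.arctan x.re + Real.pi ≠ 2 * Real.pi := ne_of_lt (by linarith)
      refine (if_neg h3).trans ?_
      change (((Real.tan ((2 * Real.arctan x.re + Real.pi - Real.pi) / 2) : ℝ) : ℂ) : Sphere) = x
      rw [show (2 * Real.arctan x.re + Real.pi - Real.pi) / 2 = Real.arctan x.re by ring,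
        Real.tan_arctan, hre x hx]
  · rw [refMeasure, Measure.map_map hA measurable_coe_real_sphere, ← map_two_mul_arctan_add_pi]
    rfl

theorem exists_isAngle (O : Setting) : ∃ b A E, IsAngle O b A E := by
  cases O with
  | disk => exact ⟨_, _, _, isAngle_disk⟩
  | halfPlane => exact ⟨_, _, _, isAngle_halfPlane⟩

/-- Radon-Nikodym derivatives under an almost everywhere invertible map. -/
theorem rnDeriv_map_of_leftInverse {X Y : Type*} [MeasurableSpace X] [MeasurableSpace Y]
    {μ m : Measure X} [SigmaFinite μ] [SigmaFinite m] {A : X → Y} {E : Y → X} (hA : Measurable A)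
    (hE : Measurable E) [SigmaFinite (m.map A)] [SigmaFinite (μ.map A)]
    (hμ : ∀ᵐ t ∂μ, E (A t) = t) (hm : ∀ᵐ t ∂m, E (A t) = t) :
    ∀ᵐ t ∂m, (μ.map A).rnDeriv (m.map A) (A t) = μ.rnDeriv m t := by
  have hf : Measurable (μ.rnDeriv m) := Measure.measurable_rnDeriv μ m
  -- Preimages under `E` transport a separating set and the density to the target; the image of the
  -- Lebesgue decomposition is then again one.
  have hsing : (μ.singularPart m).map A ⟂ₘ m.map A := by
    obtain ⟨S, hS, h1, h2⟩ := Measure.mutuallySingular_singularPart μ m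
    refine ⟨E ⁻¹' S, hE hS, ?_, ?_⟩
    · rw [Measure.map_apply hA (hE hS), ← h1]
      refine measure_congr ?_
      filter_upwards [(Measure.singularPart_le μ m).absolutelyContinuous.ae_le hμ] with t ht
      exact congrArg (· ∈ S) ht
    · rw [Measure.map_apply hA (hE hS).compl, ← h2]
      refine measure_congr ?_
      filter_upwards [hm] with t ht
      exact congrArg (· ∈ Sᶜ) ht
  have hdens : (m.withDensity (μ.rnDeriv m)).map A =
      (m.map A).withDensity fun y => μ.rnDeriv m (E y) := by
    ext s hs
    rw [Measure.map_apply hA hs, withDensity_apply _ (hA hs), withDensity_apply _ hs,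
      setLIntegral_map hs (show Measurable fun y => μ.rnDeriv m (E y) from hf.comp hE) hA]
    refine setLIntegral_congr_fun_ae (hA hs) ?_
    filter_upwards [hm] with t ht _
    rw [ht]
  have hadd : μ.map A = (μ.singularPart m).map A +
      (m.map A).withDensity fun y => μ.rnDeriv m (E y) := by
    rw [← hdens, ← Measure.map_add _ _ hA, Measure.singularPart_add_rnDeriv]
  have h := ae_of_ae_map hA.aemeasurable (Measure.eq_rnDeriv (hf.comp hE) hsing hadd)
  filter_upwards [h, hm] with t ht htm
  rw [← ht, Function.comp_apply, htm]

end RatKhrushchev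

end

noncomputable section

namespace RatKhrushchev

/-! ### Boundary values along the prescribed paths -/

theorem tendsto_ofReal_mul_stolz {x : ℂ} (hx : ‖x‖ = 1) :
    Tendsto (fun r : ℝ => (r : ℂ) * x) (𝓝[<] 1) (stolz 2 x) := by
  refine tendsto_nhdsWithin_iff.2 ⟨?_, ?_⟩
  · have h : Continuous fun r : ℝ => (r : ℂ) * x := by fun_prop
    have h1 := h.tendsto 1
    rw [Complex.ofReal_one, one_mul] at h1
    exact h1.mono_left nhdsWithin_le_nhds
  · filter_upwards [Ioo_mem_nhdsLT (zero_lt_one' ℝ)] with r hr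
    have h1 : ‖(r : ℂ) * x‖ = r := by
      rw [norm_mul, hx, mul_one, Complex.norm_real, Real.norm_of_nonneg hr.1.le]
    have h2 : ‖(r : ℂ) * x - x‖ = 1 - r := by
      rw [show (r : ℂ) * x - x = ((r - 1 : ℝ) : ℂ) * x by push_cast; ring, norm_mul, hx, mul_one,
        Complex.norm_real, Real.norm_eq_abs, abs_sub_comm, abs_of_pos (by linarith [hr.2])]
    refine ⟨by rw [h1]; exact hr.2, ?_⟩
    rw [h1, h2]
    linarith [hr.2]

/-- For `z = x + iε` the distance of the images is `2ε / (|z + i| |x + i|)`, and `1 - |unif z| = 4ε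
/ (|z + i| (|z + i| + |z - i|))`. Aperture `2` suffices because `|z + i| + |z - i| ≤ 2 (|x + i| + ε)
≤ 4 |x + i|` for `ε < 1`. -/
theorem tendsto_unif_halfPlane_stolz {x : ℂ} (hx : x.im = 0) :
    Tendsto (fun ε : ℝ => unif .halfPlane ((x + ε * Complex.I : ℂ) : Sphere)) (𝓝[>] 0)
      (stolz 2 (unif .halfPlane (x : Sphere))) := by
  simp only [unif_halfPlane]
  have h0 := add_I_ne_zero hx.ge
  refine tendsto_nhdsWithin_iff.2 ⟨?_, ?_⟩
  · have h : ContinuousAt (fun ε : ℝ => (x + ε * Complex.I - Complex.I) /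
        (x + ε * Complex.I + Complex.I)) 0 :=
      ContinuousAt.div (by fun_prop) (by fun_prop) (by simpa using h0)
    have h1 := h.tendsto
    simp only [Complex.ofReal_zero, zero_mul, add_zero] at h1
    exact h1.mono_left nhdsWithin_le_nhds
  · filter_upwards [Ioo_mem_nhdsGT (zero_lt_one' ℝ)] with ε hε
    set z : ℂ := x + ε * Complex.I with hz
    have him : z.im = ε := by simp [hz, hx]
    have hzI := add_I_ne_zero (him.ge.trans' hε.1.le)
    have hN := norm_pos_iff.2 hzI
    have hp := norm_pos_iff.2 h0
    have hsq := norm_add_I_sq_sub z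
    rw [him] at hsq
    have hMN : ‖z - Complex.I‖ < ‖z + Complex.I‖ :=
      (pow_lt_pow_iff_left₀ (norm_nonneg _) (norm_nonneg _) two_ne_zero).1 (by linarith [hε.1])
    have hp1 : 1 ≤ ‖x + Complex.I‖ := by
      have := Complex.abs_im_le_norm (x + Complex.I)
      simpa [hx] using this
    have hNp : ‖z + Complex.I‖ ≤ ‖x + Complex.I‖ + ε := by
      have h1 := norm_add_le (x + Complex.I) (ε * Complex.I)
      rw [norm_mul, Complex.norm_I, mul_one, Complex.norm_real, Real.norm_of_nonneg hε.1.le] at h1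
      rwa [hz, add_right_comm]
    have hdiff : (z - Complex.I) / (z + Complex.I) - (x - Complex.I) / (x + Complex.I) =
        ((-2 * ε : ℝ) : ℂ) / ((z + Complex.I) * (x + Complex.I)) := by
      rw [div_sub_div _ _ hzI h0]
      congr 1
      rw [hz]
      push_cast
      linear_combination 2 * ε * Complex.I_mul_I
    refine ⟨by rwa [norm_div, div_lt_one hN], ?_⟩
    rw [hdiff, norm_div, norm_div, norm_mul, Complex.norm_real, norm_mul, Real.norm_eq_abs, abs_neg,
      abs_of_pos zero_lt_two, Real.norm_of_nonneg hε.1.le, one_sub_div hN.ne', ← mul_div_assoc,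
      div_le_div_iff₀ (by positivity) hN]
    have h1 : ε * 4 ≤ (‖z + Complex.I‖ - ‖z - Complex.I‖) * (4 * ‖x + Complex.I‖) := by
      have h2 : ‖z + Complex.I‖ + ‖z - Complex.I‖ ≤ 4 * ‖x + Complex.I‖ := by
        linarith [hε.2]
      nlinarith
    nlinarith

theorem hasBdryValue_of_tendsto {O : Setting} {f g : ℂ → ℂ}
    (hfg : ∀ z ∈ dom O, f z = g (unif O (z : Sphere))) {t : Sphere} (ht : t ∈ bdry O)
    (ht' : t ≠ OnePoint.infty) {w : ℂ} (h : Tendsto g (stolz 2 (unif O t)) (𝓝 w)) :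
    HasBdryValue O f t w := by
  cases O with
  | disk =>
    obtain ⟨x, hx, rfl⟩ := ht
    rw [unif_disk] at h
    refine (h.comp (tendsto_ofReal_mul_stolz hx)).congr' ?_
    filter_upwards [(tendsto_ofReal_mul_stolz hx).eventually (eventually_stolz_norm_lt 2 x)]
      with r hr
    rw [hfg _ hr, unif_disk, Function.comp_apply]
  | halfPlane =>
    rcases ht with rfl | ⟨x, hx, rfl⟩
    · exact absurd rfl ht'
    · refine (h.comp (tendsto_unif_halfPlane_stolz hx)).congr' ?_
      filter_upwards [self_mem_nhdsWithin] with ε hε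
      have hx' : x.im = 0 := hx
      have hε' : 0 < ε := hε
      rw [hfg _ (by simpa [dom, hx'] using hε'), Function.comp_apply]

/-! ### Transfer of the orthogonal rational functions and the iterates to the disk -/

section Transfer

variable {O : Setting} {α : ℕ → ℂ} {t : Sphere}

theorem blaschke_eq_bp (ht : ∀ k, zeta O (α k) t = bf (unif O (α k : Sphere)) (unif O t)) (n : ℕ) :
    blaschke O α n t = bp (fun k => unif O (α k : Sphere)) n (unif O t) := by
  simp only [blaschke, bp, ht]

theorem comb_eq_cb (ht : ∀ k, zeta O (α k) t = bf (unif O (α k : Sphere)) (unif O t)) (n : ℕ)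
    (c : ℕ → ℂ) : comb O α n c t = cb (fun k => unif O (α k : Sphere)) n c (unif O t) := by
  simp only [comb, cb, blaschke_eq_bp ht]

theorem combStar_eq_cbs (ht : ∀ k, zeta O (α k) t = bf (unif O (α k : Sphere)) (unif O t)) (n : ℕ)
    (c : ℕ → ℂ) : combStar O α n c t = cbs (fun k => unif O (α k : Sphere)) n c (unif O t) := by
  simp only [combStar, cbs, ht]

variable {μ : Measure Sphere} {b : ℝ} {A : Sphere → ℝ} {E : ℝ → Sphere}

theorem orfCoeff_succ (n : ℕ) {φ : ℕ → ℂ} (hφ : Pi.single (n + 1) 1 - ∑ k : Fin (n + 1),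
      (∫ t, conj (comb O α k (orfCoeff O α μ k) t) * blaschke O α (n + 1) t ∂μ) •
        orfCoeff O α μ k = φ) : orfCoeff O α μ (n + 1) =
    ((combStar O α (n + 1) φ (α n) * varpi O (α (n + 1)) (α n) /
      (varpi O (α n) (α n) * combStar O α n (orfCoeff O α μ n) (α n))) /
      ‖combStar O α (n + 1) φ (α n) * varpi O (α (n + 1)) (α n) /
        (varpi O (α n) (α n) * combStar O α n (orfCoeff O α μ n) (α n))‖ /
      (Real.sqrt (∫ t, ‖comb O α (n + 1) φ t‖ ^ 2 ∂μ) : ℂ)) • φ := by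
  subst hφ
  rw [orfCoeff]

variable [IsProbabilityMeasure μ] (hμ : μ (bdry O)ᶜ = 0) (hA : IsAngle O b A E)
include hμ hA

theorem integral_eq_integral_map_cis {F : Type*} [NormedAddCommGroup F] [NormedSpace ℝ F]
    {f : Sphere → F} {g : ℂ → F} (hg : ContinuousOn g (Metric.sphere 0 1))
    (h : ∀ t ∈ bdry O, f t = g (unif O t)) : ∫ t, f t ∂μ = ∫ u, g u ∂((μ.map A).map cis) := by
  have h1 := hA.measurable
  have : IsProbabilityMeasure (μ.map A) := Measure.isProbabilityMeasure_map h1.aemeasurable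
  have : IsProbabilityMeasure ((μ.map A).map cis) :=
    Measure.isProbabilityMeasure_map continuous_cis.aemeasurable
  have hi := integrable_of_continuousOn_sphere (map_cis_compl_sphere (ρ := μ.map A)) hg
  have h2 := hi.aestronglyMeasurable
  rw [Measure.map_map continuous_cis.measurable h1] at h2 ⊢
  rw [integral_map (continuous_cis.measurable.comp h1).aemeasurable h2]
  refine integral_congr_ae ?_
  filter_upwards [measure_eq_zero_iff_ae_notMem.1 hμ] with t ht
  have ht' : t ∈ bdry O := not_not.1 ht
  rw [h t ht', ← hA.cis_eq t ht', Function.comp_apply]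

theorem cFun_eq_herglotz {z : ℂ} (hz : z ∈ dom O) :
    cFun O μ z = herglotz (μ.map A) (unif O (z : Sphere)) := by
  have : IsProbabilityMeasure (μ.map A) :=
    Measure.isProbabilityMeasure_map hA.measurable.aemeasurable
  rw [herglotz_eq_integral_map (norm_unif_lt hz)]
  exact integral_eq_integral_map_cis hμ hA
    (continuousOn_div_sub (q := fun u => u + _) (by fun_prop) (norm_unif_lt hz)) fun _ _ => rfl

omit [IsProbabilityMeasure μ] in
theorem map_cis_ne_zero {n : ℕ}
    (hn : ∀ s : Finset Sphere, s.card ≤ n → μ (s : Set Sphere)ᶜ ≠ 0) (s : Finset ℂ)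
    (hs : s.card ≤ n) : ((μ.map A).map cis) (s : Set ℂ)ᶜ ≠ 0 := by
  classical
  intro h
  rw [Measure.map_map continuous_cis.measurable hA.measurable, Measure.map_apply
    (continuous_cis.measurable.comp hA.measurable) s.measurableSet.compl] at h
  refine hn (s.image (Function.invFunOn (unif O) (bdry O))) (Finset.card_image_le.trans hs) ?_
  refine measure_mono_null (fun t ht => ?_) (measure_union_null hμ h)
  by_cases htb : t ∈ bdry O
  · refine Or.inr fun hts => ht ?_
    rw [Function.comp_apply, hA.cis_eq t htb] at hts
    exact Finset.mem_coe.2 (Finset.mem_image.2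
      ⟨_, hts, (unif_injOn O).leftInvOn_invFunOn htb⟩)
  · exact Or.inl htb

variable (hα : ∀ k, α k ∈ dom O)
include hα

/-- Both sides satisfy the same division by a Blaschke factor, and continuity of `diskIterate`
identifies the value at the removed singularity. -/
theorem iterate_eq_diskIterate (hα0 : α 0 = base O) {n : ℕ}
    (hn : ∀ s : Finset Sphere, s.card ≤ n → μ (s : Set Sphere)ᶜ ≠ 0) {z : ℂ} (hz : z ∈ dom O) :
    iterate O α μ n z = diskIterate (fun k => unif O (α k : Sphere)) ((μ.map A).map cis) n
      (unif O (z : Sphere)) := by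
  have : IsProbabilityMeasure (μ.map A) :=
    Measure.isProbabilityMeasure_map hA.measurable.aemeasurable
  have ha : ∀ k, ‖unif O (α k : Sphere)‖ < 1 := fun k => norm_unif_lt (hα k)
  have ha0 : unif O (α 0 : Sphere) = 0 := by rw [hα0, unif_base]
  have hcont : ∀ m, (∀ s : Finset Sphere, s.card ≤ m → μ (s : Set Sphere)ᶜ ≠ 0) →
      ∀ c ∈ dom O, ContinuousAt (fun y : ℂ => diskIterate (fun k => unif O (α k : Sphere))
        ((μ.map A).map cis) m (unif O (y : Sphere))) c := fun m hm c hc =>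
    ContinuousAt.comp (f := fun y : ℂ => unif O (y : Sphere))
      ((differentiableOn_diskIterate ha ha0 (map_cis_ne_zero hμ hA hm)).differentiableAt
        (Metric.isOpen_ball.mem_nhds (by simpa using norm_unif_lt hc))).continuousAt
      (differentiableAt_unif hc).continuousAt
  induction n generalizing z with
  | zero =>
    refine divZeta_eq_of_forall (base_mem_dom O) (hcont 0 hn _ (base_mem_dom O))
      (fun y hy => ?_) hz
    rw [cFun_eq_herglotz hμ hA hy, ← mul_diskIterate_zero
      (a := fun k => unif O (α k : Sphere)) ha0 (norm_unif_lt hy)]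
    rfl
  | succ n ih =>
    have hn' : ∀ s : Finset Sphere, s.card ≤ n → μ (s : Set Sphere)ᶜ ≠ 0 := fun s hs =>
      hn s (by omega)
    refine divZeta_eq_of_forall (hα (n + 1)) (hcont _ hn _ (hα (n + 1))) (fun y hy => ?_) hz
    rw [ih hn' hy, ih hn' (hα (n + 1)), zeta_eq_of_coe (hα (n + 1)) (Or.inl hy)]
    exact (mul_diskIterate_succ ha ha0 (map_cis_ne_zero hμ hA hn) (norm_unif_lt hy)).symm

/-- The positivity condition involves `ϖ_n`, which `unifFactor` distinguishes from its disk
counterpart; the phases of the orthonormal functions therefore differ by `η / |η|`. -/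
theorem orfCoeff_eq_smul_diskCoeff (hα0 : α 0 = base O) (n : ℕ) :
    orfCoeff O α μ n = (unifFactor O (α n) / ‖unifFactor O (α n)‖) •
      diskCoeff (fun k => unif O (α k : Sphere)) ((μ.map A).map cis) n := by
  have ha : ∀ k, ‖unif O (α k : Sphere)‖ < 1 := fun k => norm_unif_lt (hα k)
  have hη : ∀ k, unifFactor O (α k) ≠ 0 := fun k => unifFactor_ne_zero (hα k)
  have hηn : ∀ k, (‖unifFactor O (α k)‖ : ℂ) ≠ 0 := fun k => by simpa using hη k
  have hτ : ∀ k, (unifFactor O (α k) / ‖unifFactor O (α k)‖) *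
      conj (unifFactor O (α k) / ‖unifFactor O (α k)‖) = 1 := fun k =>
    mul_conj_of_norm_eq_one (by simp [hη k])
  have hbd : ∀ t ∈ bdry O, ∀ k, zeta O (α k) t = bf (unif O (α k : Sphere)) (unif O t) :=
    fun t ht k => zeta_eq_of_mem_bdry (hα k) ht
  have hin : ∀ j k, zeta O (α k) (α j : Sphere) =
      bf (unif O (α k : Sphere)) (unif O (α j : Sphere)) :=
    fun j k => zeta_eq_of_coe (hα k) (Or.inl (hα j))
  set a : ℕ → ℂ := fun k => unif O (α k : Sphere) with haa
  set ν := (μ.map A).map cis with hν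
  induction n using Nat.strong_induction_on with
  | _ n ih =>
    rcases n with _ | n
    · rw [hα0, unifFactor_base, orfCoeff, diskCoeff]
      simp
    · have hφ : Pi.single (n + 1) 1 - ∑ k : Fin (n + 1),
          (∫ t, conj (comb O α k (orfCoeff O α μ k) t) * blaschke O α (n + 1) t ∂μ) •
            orfCoeff O α μ k = gsPoly a ν n (diskCoeff a ν) := by
        rw [gsPoly]
        congr 1
        refine Finset.sum_congr rfl fun k _ => ?_
        have hint : ∫ t, conj (comb O α k (orfCoeff O α μ k) t) * blaschke O α (n + 1) t ∂μ =
            conj (unifFactor O (α k) / ‖unifFactor O (α k)‖) *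
              ∫ u, conj (cb a k (diskCoeff a ν k) u) * bp a (n + 1) u ∂ν := by
          rw [← integral_const_mul]
          refine integral_eq_integral_map_cis hμ hA (continuousOn_const.mul ((continuousOn_conj
            (continuousOn_cb_sphere ha _ _)).mul (continuousOn_bp_sphere ha _))) fun t ht => ?_
          rw [comb_eq_cb (hbd t ht), blaschke_eq_bp (hbd t ht), ih k k.2, ← haa, cb_smul, map_mul,
            mul_assoc]
        -- An orthogonal projection does not see the phase of `Φ_k`.
        rw [hint, ih k k.2, smul_smul, mul_right_comm, mul_comm (conj _), hτ, one_mul]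
      have hsqrt : ∫ t, ‖comb O α (n + 1) (gsPoly a ν n (diskCoeff a ν)) t‖ ^ 2 ∂μ =
          ∫ u, ‖cb a (n + 1) (gsPoly a ν n (diskCoeff a ν)) u‖ ^ 2 ∂ν :=
        integral_eq_integral_map_cis hμ hA ((continuousOn_cb_sphere ha _ _).norm.pow 2)
          fun t ht => by rw [comb_eq_cb (hbd t ht)]
      obtain ⟨s, hs, hvarpi⟩ := varpi_eq (hα n)
      rw [orfCoeff_succ n hφ, diskCoeff_succ, hsqrt, combStar_eq_cbs (hin n),
        combStar_eq_cbs (hin n), ih n (Nat.lt_succ_self n), ← haa, cbs_smul, hvarpi _ (hα n),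
        hvarpi _ (hα (n + 1)), smul_smul]
      congr 1
      change cbs a (n + 1) _ (a n) * (vp (a (n + 1)) (a n) * _ * s) /
        ((vp (a n) (a n) * _ * s) * (_ * cbs a n _ (a n))) / _ / _ = _
      set W := cbs a (n + 1) (gsPoly a ν n (diskCoeff a ν)) (a n) * vp (a (n + 1)) (a n) /
        (vp (a n) (a n) * cbs a n (diskCoeff a ν n) (a n)) with hW
      have hw : cbs a (n + 1) (gsPoly a ν n (diskCoeff a ν)) (a n) *
          (vp (a (n + 1)) (a n) * unifFactor O (α (n + 1)) * s) /
          ((vp (a n) (a n) * unifFactor O (α n) * s) *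
            (conj (unifFactor O (α n) / ‖unifFactor O (α n)‖) *
              cbs a n (diskCoeff a ν n) (a n))) =
          W * (unifFactor O (α (n + 1)) / ‖unifFactor O (α n)‖) := by
        have h1 : unifFactor O (α n) * conj (unifFactor O (α n) / ‖unifFactor O (α n)‖) =
            ‖unifFactor O (α n)‖ := by
          have h2 := hτ n
          have h3 := hηn n
          rw [div_mul_eq_mul_div, div_eq_one_iff_eq h3] at h2
          exact h2
        rw [hW]
        calc _ = cbs a (n + 1) (gsPoly a ν n (diskCoeff a ν)) (a n) * vp (a (n + 1)) (a n) *
              unifFactor O (α (n + 1)) * s / (vp (a n) (a n) * cbs a n (diskCoeff a ν n) (a n) *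
              (unifFactor O (α n) * conj (unifFactor O (α n) / ‖unifFactor O (α n)‖)) * s) := by
              congr 1 <;> ring
          _ = _ := by
              rw [h1, mul_div_mul_right _ _ hs, ← mul_div_mul_comm]
      clear_value W
      rw [hw, norm_mul, norm_div, Complex.norm_real, norm_norm]
      have h3 := hηn n
      have h4 := hηn (n + 1)
      push_cast
      rcases eq_or_ne W 0 with h0 | h0
      -- If the normalizing quotient is zero, both scalars are `0 / 0 = 0`.
      · simp [h0]
      · have h5 : (‖W‖ : ℂ) ≠ 0 := by simpa using h0
        have h6 : (unifFactor O (α n)) ≠ 0 := hη n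
        field_simp

end Transfer

end RatKhrushchev

end

/-! ### Assembly: pulling the boundary identity back to the original setting. -/

theorem theoremK1 (O : RatKhrushchev.Setting) (α : ℕ → ℂ)
    (hα0 : α 0 = RatKhrushchev.base O) (hα : ∀ k, α k ∈ RatKhrushchev.dom O)
    (μ : Measure RatKhrushchev.Sphere) [IsProbabilityMeasure μ]
    (hμ : μ (RatKhrushchev.bdry O)ᶜ = 0) (n : ℕ)
    -- `μ` is not concentrated on `n` or fewer points, so that `Φ_n` and `f_n` exist
    (hn : ∀ s : Finset RatKhrushchev.Sphere, s.card ≤ n →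
      μ (s : Set RatKhrushchev.Sphere)ᶜ ≠ 0) :
    ∀ᵐ t ∂(RatKhrushchev.refMeasure O), ∃ w : ℂ,
      RatKhrushchev.HasBdryValue O (RatKhrushchev.iterate O α μ n) t w ∧
      1 - RatKhrushchev.zeta O (α n) t * RatKhrushchev.invIterate O α μ n t * w ≠ 0 ∧
      ‖RatKhrushchev.orf O α μ n t‖ ^ 2 / RatKhrushchev.kernelDR O t (α n) *
          (μ.rnDeriv (RatKhrushchev.refMeasure O) t).toReal =
        (1 - ‖w‖ ^ 2) /
          ‖1 - RatKhrushchev.zeta O (α n) t * RatKhrushchev.invIterate O α μ n t * w‖ ^ 2 := by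
  open RatKhrushchev in
  obtain ⟨b, A, E, hA⟩ := exists_isAngle O
  have : IsProbabilityMeasure (μ.map A) :=
    Measure.isProbabilityMeasure_map hA.measurable.aemeasurable
  have hfin : IsFiniteMeasure ((refMeasure O).map A) := by
    rw [hA.map_eq]
    infer_instance
  have : SigmaFinite (refMeasure O) := SigmaFinite.of_map _ hA.measurable.aemeasurable inferInstance
  have ha : ∀ k, ‖unif O (α k : Sphere)‖ < 1 := fun k => norm_unif_lt (hα k)
  have ha0 : unif O (α 0 : Sphere) = 0 := by rw [hα0, unif_base]
  have hμb : ∀ᵐ t ∂μ, t ∈ bdry O := by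
    filter_upwards [measure_eq_zero_iff_ae_notMem.1 hμ] with t ht using not_not.1 ht
  have hρ : (μ.map A) (Set.Ioc b (b + 2 * Real.pi))ᶜ = 0 := by
    rw [Measure.map_apply hA.measurable measurableSet_Ioc.compl]
    refine measure_mono_null (fun t ht => ?_) hμ
    exact fun htb => ht (hA.mem_Ioc t htb)
  have hn' := map_cis_ne_zero hμ hA hn
  have hB := ae_exists_bdryData (a := fun k => unif O (α k : Sphere)) ha ha0 hρ hn'
  -- The angle map pushes the reference measure to `angleMeasure`, so the almost everywhere
  -- statement pulls back along it.
  rw [← hA.map_eq] at hB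
  filter_upwards [ae_of_ae_map hA.measurable.aemeasurable hB, ae_refMeasure_mem_bdry O,
    ae_refMeasure_ne_infty O, rnDeriv_map_of_leftInverse hA.measurable hA.measurable_symm
      (hμb.mono hA.left_inv) ((ae_refMeasure_mem_bdry O).mono hA.left_inv)] with t hBt ht ht' hrn
  obtain ⟨w, hw⟩ := hBt
  rw [hrn, hA.cis_eq t ht] at hw
  have hu := norm_unif_eq ht
  have hz : ∀ k, zeta O (α k) t = bf (unif O (α k : Sphere)) (unif O t) := fun k =>
    zeta_eq_of_mem_bdry (hα k) ht
  have hη := unifFactor_ne_zero (hα n)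
  have hηn : (‖unifFactor O (α n)‖ : ℂ) ≠ 0 := by simpa using hη
  have hηc : conj (unifFactor O (α n)) ≠ 0 := (map_ne_zero _).2 hη
  have horf : orf O α μ n t = unifFactor O (α n) / ‖unifFactor O (α n)‖ *
      cb (fun k => unif O (α k : Sphere)) n (diskCoeff (fun k => unif O (α k : Sphere))
        ((μ.map A).map cis) n) (unif O t) := by
    rw [orf, comb_eq_cb hz, orfCoeff_eq_smul_diskCoeff hμ hA hα hα0, cb_smul]
  have hinv : invIterate O α μ n t = conj (zfac .disk (unif O (α n : Sphere))) *
      cb (fun k => unif O (α k : Sphere)) n (diskCoeff (fun k => unif O (α k : Sphere))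
        ((μ.map A).map cis) n) (unif O t) /
      cbs (fun k => unif O (α k : Sphere)) n (diskCoeff (fun k => unif O (α k : Sphere))
        ((μ.map A).map cis) n) (unif O t) := by
    -- In `b_n` the phase `η / |η|` of `Φ_n` and its conjugate in `Φ_n^*` combine to `η / conj η`,
    -- which converts `conj z_n` into its disk counterpart.
    have h1 := congrArg conj (zfac_mul_conj_unifFactor (hα n))
    rw [map_mul, map_mul, Complex.conj_conj] at h1
    rw [invIterate, horf, orfStar, combStar_eq_cbs hz, orfCoeff_eq_smul_diskCoeff hμ hA hα hα0,
      cbs_smul, map_div₀, Complex.conj_ofReal, ← mul_assoc, mul_div_mul_comm,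
      mul_div_assoc (conj (zfac .disk _))]
    congr 1
    field_simp
    linear_combination h1
  have hnorm : ‖orf O α μ n t‖ = ‖cb (fun k => unif O (α k : Sphere)) n
      (diskCoeff (fun k => unif O (α k : Sphere)) ((μ.map A).map cis) n) (unif O t)‖ := by
    rw [horf, norm_mul, norm_div, Complex.norm_real, norm_norm, div_self (norm_ne_zero_iff.2 hη),
      one_mul]
  refine ⟨w, hasBdryValue_of_tendsto (fun z hz => iterate_eq_diskIterate hμ hA hα hα0 hn hz) ht ht'
    (hw.tendsto 2 zero_le_two), ?_⟩
  rw [hz n, hinv, hnorm, kernelDR_eq ht]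
  exact hw.formula ha hu
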